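/- Consider the quantum lambda calculus with terms $$M,N,P ::= x \mid MN \mid \lambda x.M \mid \mathrm{if}\ P\ \mathrm{then}\ M\ \mathrm{else}\ N \mid 0 \mid 1 \mid \mathit{meas} \mid \mathit{new} \mid U \mid * \mid \langle M,N\rangle \mid \mathrm{let}\ \langle x,y\rangle = M\ \mathrm{in}\ N$$ (up to $\alpha$-equivalence, $U$ ranging over an effectively coded set of built-in gate names with a computable arity) and linear types $$A,B ::= \alpha \mid X \mid {!A} \mid A\multimap B \mid \top \mid A\otimes B,$$ where $\alpha$ ranges over an effectively coded set of type constants containing $\mathit{bit}$ and $\mathit{qbit}$, and $X$ over a countable set of type variables. Subtyping $<:$ is generated by: $\alpha<:\alpha$, $X<:X$, $\top<:\top$; $!A<:B$ if $A<:B$; $!A<:{!B}$ if $!A<:B$; $\otimes$ is covariant in both arguments; $A'\multimap B<:A\multimap B'$ if $A<:A'$ and $B<:B'$. Contexts are finite functions from variables to types, and commas denote unions of contexts with disjoint domains. The constants have types $A_0=A_1={!\mathit{bit}}$, $A_{\mathit{new}}={!(\mathit{bit}\multimap\mathit{qbit})}$, $A_{\mathit{meas}}={!(\mathit{qbit}\multimap{!\mathit{bit}})}$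 and $A_U={!(\mathit{qbit}^n\multimap\mathit{qbit}^n)}$ for a gate $U$ of arity $n$. Quantum typing judgements $\Gamma\rhd M:A$ are derived by the rules (for all $n\ge 0$): - $\Delta,x{:}A\rhd x:B$ if $A<:B$; $\ \Delta\rhd c:B$ if $A_c<:B$; $\ \Delta\rhd *:{!^n\top}$; - from $\Gamma_1,!\Delta\rhd P:\mathit{bit}$, $\Gamma_2,!\Delta\rhd M:A$ and $\Gamma_2,!\Delta\rhd N:A$ infer $\Gamma_1,\Gamma_2,!\Delta\rhd \mathrm{if}\ P\ \mathrm{then}\ M\ \mathrm{else}\ N:A$; - from $\Gamma_1,!\Delta\rhd M:A\multimap B$ and $\Gamma_2,!\Delta\rhd N:A$ infer $\Gamma_1,\Gamma_2,!\Delta\rhd MN:B$; - from $\Delta,x{:}A\rhd M:B$ infer $\Delta\rhd\lambda x.M:A\multimap B$; and from $\Gamma,!\Delta,x{:}A\rhd M:B$ with $FV(M)\cap|\Gamma|=\emptyset$ infer $\Gamma,!\Delta\rhd\lambda x.M:{!^{n+1}(A\multimap B)}$; - from $!\Delta,\Gamma_1\rhd M_1:{!^nA_1}$ and $!\Delta,\Gamma_2\rhd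 M_2:{!^nA_2}$ infer $!\Delta,\Gamma_1,\Gamma_2\rhd\langle M_1,M_2\rangle:{!^n(A_1\otimes A_2)}$; - from $!\Delta,\Gamma_1\rhd M:{!^n(A_1\otimes A_2)}$ and $!\Delta,\Gamma_2,x_1{:}!^nA_1,x_2{:}!^nA_2\rhd N:A$ infer $!\Delta,\Gamma_1,\Gamma_2\rhd\mathrm{let}\ \langle x_1,x_2\rangle=M\ \mathrm{in}\ N:A$. The *extended* rules add, for $\tau,\sigma\in\{0,1\}$: - $(\otimes.I')$ from $!\Delta,\Gamma_1\rhd M_1:{!A_1}$ and $!\Delta,\Gamma_2\rhd M_2:{!A_2}$ infer $!\Delta,\Gamma_1,\Gamma_2\rhd\langle M_1,M_2\rangle:{!(!^\tau A_1\otimes{!^\sigma A_2})}$; - $(\otimes.E')$ from $!\Delta,\Gamma_1\rhd M:{!(!^\tau A_1\otimes{!^\sigma A_2})}$ and $!\Delta,\Gamma_2,x_1{:}!A_1,x_2{:}!A_2\rhd N:A$ infer $!\Delta,\Gamma_1,\Gamma_2\rhd\mathrm{let}\ \langle x_1,x_2\rangle=M\ \mathrm{in}\ N:A$. A term is *quantum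 typable* if it has some derivable judgement $\Gamma\rhd M:A$ in the basic (non-extended) system. The simply-typed lambda calculus has the same terms, the types $\alpha\mid X\mid U\Rightarrow V\mid U\times V\mid\top$ and the usual rules (contexts shared by all premises; constants $c$ have the type obtained from $A_c$ by erasing all $!$ and reading $\multimap,\otimes$ as $\Rightarrow,\times$). The *skeleton* of a quantum derivation is the simply-typed derivation obtained by erasing all $!$ in its judgements and completing the contexts of the premises to the shared ones; a quantum derivation is a *decoration* of a simply-typed derivation $\pi$ if $\pi$ is its skeleton. Then: 1. It is decidable whether a given term is quantum typable. 2. Every quantum typable term is simply typable. 3. For every simply-typed derivation $\pi$ of a term $M$, the following are equivalent: $M$ is quantum typable; $\pi$ has a decoration that is a derivation in the basic system; $\pi$ has a decoration that is a derivation in the extended system in which no type contains a repeated exponential $!!$. Moreover, $\pi$ has only finitely many decorations of this last kind. 4. There are computable procedures for the following two steps. The first, given a term $M$, returns a simply-typed derivation of $M$, or reports failure, the latter only if $M$ is not simply typable. The second, given a simply-typed derivation $\pi$ of a term $M$, returns a context $\Delta$, a type $A$ and a derivation of $\Delta\rhd M:A$ in the extended system that is a decoration of $\pi$ without repeated exponentials,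 or reports failure, the latter only if $M$ is not quantum typable. If it succeeds, then $\Delta\rhd M:A$ is derivable in the basic system, so that $A$ is a valid type for $M$. -/

import Mathlib

namespace QLambda

/-! ### Finite trees as words, and their effective coding

A tree whose nodes carry labels `l : L` with `ar l` children is coded by its word of labels in
prefix (Polish) notation.  This makes the syntax trees below `Primcodable`. -/

section Coding

variable {L : Type} (ar : L → ℕ)

/-- Trees in which a node labelled `l` has `ar l` children. -/
abbrev LTree : Type := WType (fun x : L => Fin (ar x))

variable {ar}

/-- Prefix notation of a tree. -/
def LTree.word : LTree ar → List L
  | WType.mk l f => l :: (List.ofFn fun i => LTree.word (f i)).flatten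

variable (ar)

/-- One step of reading a word from right to left, keeping only the height of the stack. -/
def countStep (l : L) (k : Option ℕ) : Option ℕ :=
  k.bind fun k => if ar l ≤ k then some (k - ar l + 1) else none

/-- The number of trees of which the word is the concatenation, if it is one. -/
def count (w : List L) : Option ℕ := w.foldr (countStep ar) (some 0)

/-- One step of reading a word from right to left, keeping a stack of trees. -/
def parseStep (l : L) (s : Option (List (LTree ar))) : Option (List (LTree ar)) :=
  s.bind fun s =>
    if h : ar l ≤ s.length then
      some (WType.mk l (fun i => s[i.1]'(lt_of_lt_of_le i.2 h)) :: s.drop (ar l))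
    else none

/-- Reads a word as a concatenation of prefix notations of trees. -/
def parse (w : List L) : Option (List (LTree ar)) := w.foldr (parseStep ar) (some [])

theorem count_eq (w : List L) : count ar w = (parse ar w).map List.length := by
  induction w with
  | nil => rfl
  | cons l w ih =>
    change countStep ar l (count ar w) = (parseStep ar l (parse ar w)).map List.length
    rw [ih]
    cases parse ar w with
    | none => rfl
    | some s =>
      simp only [countStep, parseStep, Option.map_some, Option.bind_some]
      split_ifs <;> simp

theorem parse_flatten (w : List L) (s : List (LTree ar)) (hw : parse ar w = some s)
    (us : List (LTree ar))
    (h : ∀ u ∈ us, ∀ w s, parse ar w = some s → parse ar (u.word ++ w) = some (u :: s)) :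
    parse ar ((us.map LTree.word).flatten ++ w) = some (us ++ s) := by
  induction us with
  | nil => simpa using hw
  | cons u us ih =>
    simp only [List.map_cons, List.flatten_cons, List.append_assoc, List.cons_append]
    exact h u (by simp) _ _ (ih fun v hv => h v (by simp [hv]))

theorem parse_word (t : LTree ar) :
    ∀ w s, parse ar w = some s → parse ar (t.word ++ w) = some (t :: s) := by
  induction t with
  | mk l f ih =>
    intro w s hw
    have h := parse_flatten ar w s hw (List.ofFn f) (by
      intro u hu
      obtain ⟨i, rfl⟩ := (List.mem_ofFn' f u).1 hu
      exact ih i)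
    rw [List.map_ofFn] at h
    change parseStep ar l (parse ar ((List.ofFn fun i => LTree.word (f i)).flatten ++ w)) = _
    change parse ar ((List.ofFn fun i => LTree.word (f i)).flatten ++ w) = _ at h
    rw [h]
    simp only [parseStep, Option.bind_some]
    rw [dif_pos (by simp)]
    congr 2
    · congr 1
      funext i
      rw [List.getElem_append_left (by simp)]
      simp
    · rw [List.drop_left' (by simp)]

theorem word_parse (w : List L) :
    ∀ s, parse ar w = some s → (s.map LTree.word).flatten = w := by
  induction w with
  | nil =>
    intro s h
    obtain rfl : [] = s := by simpa [parse] using h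
    rfl
  | cons l w ih =>
    intro s h
    change parseStep ar l (parse ar w) = some s at h
    cases hp : parse ar w with
    | none => rw [hp] at h; simp [parseStep] at h
    | some s' =>
      rw [hp] at h
      simp only [parseStep, Option.bind_some] at h
      split_ifs at h with hl
      obtain rfl := Option.some.inj h
      have e : (List.ofFn fun i : Fin (ar l) =>
          LTree.word (s'[i.1]'(lt_of_lt_of_le i.2 hl))) = (s'.take (ar l)).map LTree.word := by
        apply List.ext_getElem
        · simp [hl]
        · intro i h1 h2
          simp
      rw [List.map_cons, List.flatten_cons, LTree.word, e, List.cons_append, ← List.flatten_append,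
        ← List.map_append, List.take_append_drop, ih s' hp]

/-- Trees are the same as words that are the prefix notation of exactly one tree. -/
def treeEquiv : LTree ar ≃ {w : List L // count ar w = some 1} where
  toFun t := ⟨t.word, by
    have := parse_word ar t [] [] rfl
    rw [List.append_nil] at this
    rw [count_eq, this]; rfl⟩
  invFun w := ((parse ar w.1).bind List.head?).get (by
    have := w.2
    rw [count_eq] at this
    obtain ⟨s, hs, h1⟩ := Option.map_eq_some_iff.1 this
    obtain ⟨t, rfl⟩ := List.length_eq_one_iff.1 h1
    simp [hs])
  left_inv t := by
    have := parse_word ar t [] [] rfl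
    rw [List.append_nil] at this
    simp [this]
  right_inv w := by
    have := w.2
    rw [count_eq] at this
    obtain ⟨s, hs, h1⟩ := Option.map_eq_some_iff.1 this
    obtain ⟨t, rfl⟩ := List.length_eq_one_iff.1 h1
    apply Subtype.ext
    have h2 := word_parse ar w.1 _ hs
    simpa [hs] using h2

theorem count_primrec [Primcodable L] (h : Primrec ar) : Primrec (count ar) := by
  have hstep : Primrec₂ (fun (_ : List L) (p : L × Option ℕ) => countStep ar p.1 p.2) := by
    unfold countStep
    refine Primrec.option_bind (Primrec.snd.comp Primrec.snd) ?_
    have ha : Primrec (fun q : (List L × L × Option ℕ) × ℕ => ar q.1.2.1) :=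
      h.comp (Primrec.fst.comp (Primrec.snd.comp Primrec.fst))
    exact Primrec.ite (Primrec.nat_le.comp ha Primrec.snd)
      (Primrec.option_some.comp (Primrec.succ.comp (Primrec.nat_sub.comp Primrec.snd ha)))
      (Primrec.const none)
  exact Primrec.list_foldr Primrec.id (Primrec.const (some 0)) hstep

/-- The coding of trees by their words in prefix notation. -/
@[reducible] def treePrimcodable [Primcodable L] (h : Primrec ar) : Primcodable (LTree ar) :=
  haveI : Primcodable {w : List L // count ar w = some 1} :=
    Primcodable.subtype (Primrec.eq.comp (count_primrec ar h) (Primrec.const (some 1)))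
  Primcodable.ofEquiv _ (treeEquiv ar)

end Coding

/-! ### Terms -/

/-- The constants of the language; `G` is the set of (names of) built-in unitary gates. -/
inductive Const (G : Type) : Type
  | zero : Const G
  | one : Const G
  | meas : Const G
  | new : Const G
  | gate : G → Const G

/-- Terms up to `α`-equivalence, in de Bruijn notation.  The free variables of a term are the
natural numbers.  `lam M` binds the variable `0` of `M`; `letp M N` is
`let ⟨x₁, x₂⟩ = M in N` and binds in `N` the variables `0` (for `x₁`) and `1` (for `x₂`). -/
inductive Term (G : Type) : Type
  | var : ℕ → Term G
  | const : Const G → Term G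
  | star : Term G
  | app : Term G → Term G → Term G
  | lam : Term G → Term G
  | ite : Term G → Term G → Term G → Term G
  | pair : Term G → Term G → Term G
  | letp : Term G → Term G → Term G

/-- `M.Free x`: the variable `x` is free in `M`. -/
def Term.Free {G : Type} : Term G → ℕ → Prop
  | .var y, x => x = y
  | .const _, _ => False
  | .star, _ => False
  | .app M N, x => M.Free x ∨ N.Free x
  | .lam M, x => M.Free (x + 1)
  | .ite P M N, x => P.Free x ∨ M.Free x ∨ N.Free x
  | .pair M N, x => M.Free x ∨ N.Free x
  | .letp M N, x => M.Free x ∨ N.Free (x + 2)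

/-! ### Types -/

/-- Linear types.  The type constants are `bit`, `qbit` and those in `κ`; the type variables are
the natural numbers. -/
inductive QType (κ : Type) : Type
  | bit : QType κ
  | qbit : QType κ
  | const : κ → QType κ
  | var : ℕ → QType κ
  | bang : QType κ → QType κ
  | lolli : QType κ → QType κ → QType κ
  | top : QType κ
  | tensor : QType κ → QType κ → QType κ

/-- Intuitionistic types. -/
inductive IType (κ : Type) : Type
  | bit : IType κ
  | qbit : IType κ
  | const : κ → IType κ
  | var : ℕ → IType κ
  | arrow : IType κ → IType κ → IType κ
  | top : IType κ
  | prod : IType κ → IType κ → IType κ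

/-- `nbang n A` is `!⋯!A` with `n` exponentials. -/
def QType.nbang {κ : Type} : ℕ → QType κ → QType κ
  | 0, A => A
  | n + 1, A => .bang (nbang n A)

/-- `A.pow n` is the `n`-fold tensor power `A ⊗ (A ⊗ ⋯)`; it is the unit type for `n = 0`. -/
def QType.pow {κ : Type} (A : QType κ) : ℕ → QType κ
  | 0 => .top
  | 1 => A
  | n + 2 => .tensor A (A.pow (n + 1))

/-- The skeleton of a linear type: all exponentials are removed. -/
def QType.skel {κ : Type} : QType κ → IType κ
  | .bit => .bit
  | .qbit => .qbit
  | .const k => .const k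
  | .var n => .var n
  | .bang A => A.skel
  | .lolli A B => .arrow A.skel B.skel
  | .top => .top
  | .tensor A B => .prod A.skel B.skel

/-- The type contains no repeated exponential `!!`. -/
def QType.NoRepeat {κ : Type} : QType κ → Prop
  | .bit => True
  | .qbit => True
  | .const _ => True
  | .var _ => True
  | .bang A => (∀ B, A ≠ .bang B) ∧ A.NoRepeat
  | .lolli A B => A.NoRepeat ∧ B.NoRepeat
  | .top => True
  | .tensor A B => A.NoRepeat ∧ B.NoRepeat

/-- The subtyping relation `A <: B`. -/
inductive SubType {κ : Type} : QType κ → QType κ → Prop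
  | bit : SubType .bit .bit
  | qbit : SubType .qbit .qbit
  | const (k : κ) : SubType (.const k) (.const k)
  | var (n : ℕ) : SubType (.var n) (.var n)
  | top : SubType .top .top
  | derelict {A B : QType κ} : SubType A B → SubType (.bang A) B
  | promote {A B : QType κ} : SubType (.bang A) B → SubType (.bang A) (.bang B)
  | tensor {A₁ A₂ B₁ B₂ : QType κ} :
      SubType A₁ B₁ → SubType A₂ B₂ → SubType (.tensor A₁ A₂) (.tensor B₁ B₂)
  | lolli {A A' B B' : QType κ} : SubType A A' → SubType B B' → SubType (.lolli A' B) (.lolli A B')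

/-- The type `A_c` of a constant `c`; `arity` gives the arity of the gates. -/
def Const.type {G : Type} (κ : Type) (arity : G → ℕ) : Const G → QType κ
  | .zero => .bang .bit
  | .one => .bang .bit
  | .new => .bang (.lolli .bit .qbit)
  | .meas => .bang (.lolli .qbit (.bang .bit))
  | .gate g => .bang (.lolli (QType.qbit.pow (arity g)) (QType.qbit.pow (arity g)))

/-! ### Effective coding of terms and types -/

section Codes

/-- Labels of the nodes of a term: variables, gates, and the ten other constructs. -/
abbrev TermLabel (G : Type) : Type := (ℕ ⊕ G) ⊕ Fin 10

/-- The numbers of children. -/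
def termArity {G : Type} (l : TermLabel G) : ℕ :=
  Sum.elim (fun _ => 0) (fun i : Fin 10 => (![0, 0, 0, 0, 0, 2, 1, 3, 2, 2] : Fin 10 → ℕ) i) l

/-- The syntax tree of a term. -/
def Term.toTree {G : Type} : Term G → LTree (termArity (G := G))
  | .var n => ⟨.inl (.inl n), Fin.elim0⟩
  | .const (.gate g) => ⟨.inl (.inr g), Fin.elim0⟩
  | .const .zero => ⟨.inr 0, Fin.elim0⟩
  | .const .one => ⟨.inr 1, Fin.elim0⟩
  | .const .meas => ⟨.inr 2, Fin.elim0⟩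
  | .const .new => ⟨.inr 3, Fin.elim0⟩
  | .star => ⟨.inr 4, Fin.elim0⟩
  | .app M N => ⟨.inr 5, ![M.toTree, N.toTree]⟩
  | .lam M => ⟨.inr 6, ![M.toTree]⟩
  | .ite P M N => ⟨.inr 7, ![P.toTree, M.toTree, N.toTree]⟩
  | .pair M N => ⟨.inr 8, ![M.toTree, N.toTree]⟩
  | .letp M N => ⟨.inr 9, ![M.toTree, N.toTree]⟩

/-- The term with a given syntax tree. -/
def Term.ofTree {G : Type} : LTree (termArity (G := G)) → Term G
  | ⟨.inl (.inl n), _⟩ => .var n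
  | ⟨.inl (.inr g), _⟩ => .const (.gate g)
  | ⟨.inr 0, _⟩ => .const .zero
  | ⟨.inr 1, _⟩ => .const .one
  | ⟨.inr 2, _⟩ => .const .meas
  | ⟨.inr 3, _⟩ => .const .new
  | ⟨.inr 4, _⟩ => .star
  | ⟨.inr 5, f⟩ => .app (ofTree (f (0 : Fin 2))) (ofTree (f (1 : Fin 2)))
  | ⟨.inr 6, f⟩ => .lam (ofTree (f (0 : Fin 1)))
  | ⟨.inr 7, f⟩ => .ite (ofTree (f (0 : Fin 3))) (ofTree (f (1 : Fin 3))) (ofTree (f (2 : Fin 3)))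
  | ⟨.inr 8, f⟩ => .pair (ofTree (f (0 : Fin 2))) (ofTree (f (1 : Fin 2)))
  | ⟨.inr 9, f⟩ => .letp (ofTree (f (0 : Fin 2))) (ofTree (f (1 : Fin 2)))

/-- Terms are their syntax trees. -/
def Term.equivTree (G : Type) : Term G ≃ LTree (termArity (G := G)) where
  toFun := Term.toTree
  invFun := Term.ofTree
  left_inv M := by
    induction M with
    | const c => cases c <;> rfl
    | var n => rfl
    | star => rfl
    | app M N hM hN => exact congrArg₂ Term.app hM hN
    | lam M hM => exact congrArg Term.lam hM
    | ite P M N hP hM hN =>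
      change Term.ite _ _ _ = _
      exact congr (congrArg₂ Term.ite hP hM) hN
    | pair M N hM hN => exact congrArg₂ Term.pair hM hN
    | letp M N hM hN => exact congrArg₂ Term.letp hM hN
  right_inv t := by
    induction t with
    | mk l f ih =>
      obtain (n | g) | i := l
      · exact congrArg (WType.mk _) (funext fun i => Fin.elim0 i)
      · exact congrArg (WType.mk _) (funext fun i => Fin.elim0 i)
      · fin_cases i
        · exact congrArg (WType.mk _) (funext fun i => Fin.elim0 i)
        · exact congrArg (WType.mk _) (funext fun i => Fin.elim0 i)
        · exact congrArg (WType.mk _) (funext fun i => Fin.elim0 i)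
        · exact congrArg (WType.mk _) (funext fun i => Fin.elim0 i)
        · exact congrArg (WType.mk _) (funext fun i => Fin.elim0 i)
        · exact congrArg (WType.mk _) (funext (Fin.forall_fin_two.2 ⟨ih (0 : Fin 2), ih (1 : Fin 2)⟩))
        · exact congrArg (WType.mk _) (funext (Fin.forall_fin_one.2 (ih (0 : Fin 1))))
        · refine congrArg (WType.mk _) (funext fun j : Fin 3 => ?_)
          fin_cases j
          · exact ih (0 : Fin 3)
          · exact ih (1 : Fin 3)
          · exact ih (2 : Fin 3)
        · exact congrArg (WType.mk _) (funext (Fin.forall_fin_two.2 ⟨ih (0 : Fin 2), ih (1 : Fin 2)⟩))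
        · exact congrArg (WType.mk _) (funext (Fin.forall_fin_two.2 ⟨ih (0 : Fin 2), ih (1 : Fin 2)⟩))

theorem sumArity_primrec {α : Type} [Primcodable α] {n : ℕ} (v : Fin n → ℕ) :
    Primrec (fun l : α ⊕ Fin n => Sum.elim (fun _ => 0) (fun i : Fin n => v i) l) := by
  have h : Primrec (fun l : α ⊕ Fin n =>
      Sum.casesOn l (fun _ => 0) (fun i : Fin n => v i) : α ⊕ Fin n → ℕ) :=
    Primrec.sumCasesOn Primrec.id (Primrec.const 0).to₂ ((Primrec.dom_finite v).comp Primrec.snd).to₂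
  exact h.of_eq fun l => by cases l <;> rfl

instance {G : Type} [Primcodable G] : Primcodable (Term G) :=
  haveI := treePrimcodable (termArity (G := G)) (sumArity_primrec _)
  Primcodable.ofEquiv _ (Term.equivTree G)

/-- Labels of the nodes of a linear type. -/
abbrev QTypeLabel (κ : Type) : Type := (ℕ ⊕ κ) ⊕ Fin 6

/-- The numbers of children. -/
def qtypeArity {κ : Type} (l : QTypeLabel κ) : ℕ :=
  Sum.elim (fun _ => 0) (fun i : Fin 6 => (![0, 0, 0, 1, 2, 2] : Fin 6 → ℕ) i) l

/-- The syntax tree of a linear type. -/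
def QType.toTree {κ : Type} : QType κ → LTree (qtypeArity (κ := κ))
  | .var n => ⟨.inl (.inl n), Fin.elim0⟩
  | .const k => ⟨.inl (.inr k), Fin.elim0⟩
  | .bit => ⟨.inr 0, Fin.elim0⟩
  | .qbit => ⟨.inr 1, Fin.elim0⟩
  | .top => ⟨.inr 2, Fin.elim0⟩
  | .bang A => ⟨.inr 3, ![A.toTree]⟩
  | .lolli A B => ⟨.inr 4, ![A.toTree, B.toTree]⟩
  | .tensor A B => ⟨.inr 5, ![A.toTree, B.toTree]⟩

/-- The linear type with a given syntax tree. -/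
def QType.ofTree {κ : Type} : LTree (qtypeArity (κ := κ)) → QType κ
  | ⟨.inl (.inl n), _⟩ => .var n
  | ⟨.inl (.inr k), _⟩ => .const k
  | ⟨.inr 0, _⟩ => .bit
  | ⟨.inr 1, _⟩ => .qbit
  | ⟨.inr 2, _⟩ => .top
  | ⟨.inr 3, f⟩ => .bang (ofTree (f (0 : Fin 1)))
  | ⟨.inr 4, f⟩ => .lolli (ofTree (f (0 : Fin 2))) (ofTree (f (1 : Fin 2)))
  | ⟨.inr 5, f⟩ => .tensor (ofTree (f (0 : Fin 2))) (ofTree (f (1 : Fin 2)))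

/-- Linear types are their syntax trees. -/
def QType.equivTree (κ : Type) : QType κ ≃ LTree (qtypeArity (κ := κ)) where
  toFun := QType.toTree
  invFun := QType.ofTree
  left_inv A := by
    induction A with
    | bang A hA => exact congrArg QType.bang hA
    | lolli A B hA hB => exact congrArg₂ QType.lolli hA hB
    | tensor A B hA hB => exact congrArg₂ QType.tensor hA hB
    | _ => rfl
  right_inv t := by
    induction t with
    | mk l f ih =>
      obtain (n | k) | i := l
      · exact congrArg (WType.mk _) (funext fun i => Fin.elim0 i)
      · exact congrArg (WType.mk _) (funext fun i => Fin.elim0 i)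
      · fin_cases i
        · exact congrArg (WType.mk _) (funext fun i => Fin.elim0 i)
        · exact congrArg (WType.mk _) (funext fun i => Fin.elim0 i)
        · exact congrArg (WType.mk _) (funext fun i => Fin.elim0 i)
        · exact congrArg (WType.mk _) (funext (Fin.forall_fin_one.2 (ih (0 : Fin 1))))
        · exact congrArg (WType.mk _) (funext (Fin.forall_fin_two.2 ⟨ih (0 : Fin 2), ih (1 : Fin 2)⟩))
        · exact congrArg (WType.mk _) (funext (Fin.forall_fin_two.2 ⟨ih (0 : Fin 2), ih (1 : Fin 2)⟩))

instance {κ : Type} [Primcodable κ] : Primcodable (QType κ) :=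
  haveI := treePrimcodable (qtypeArity (κ := κ)) (sumArity_primrec _)
  Primcodable.ofEquiv _ (QType.equivTree κ)

/-- Labels of the nodes of an intuitionistic type. -/
abbrev ITypeLabel (κ : Type) : Type := (ℕ ⊕ κ) ⊕ Fin 5

/-- The numbers of children. -/
def itypeArity {κ : Type} (l : ITypeLabel κ) : ℕ :=
  Sum.elim (fun _ => 0) (fun i : Fin 5 => (![0, 0, 0, 2, 2] : Fin 5 → ℕ) i) l

/-- The syntax tree of an intuitionistic type. -/
def IType.toTree {κ : Type} : IType κ → LTree (itypeArity (κ := κ))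
  | .var n => ⟨.inl (.inl n), Fin.elim0⟩
  | .const k => ⟨.inl (.inr k), Fin.elim0⟩
  | .bit => ⟨.inr 0, Fin.elim0⟩
  | .qbit => ⟨.inr 1, Fin.elim0⟩
  | .top => ⟨.inr 2, Fin.elim0⟩
  | .arrow U V => ⟨.inr 3, ![U.toTree, V.toTree]⟩
  | .prod U V => ⟨.inr 4, ![U.toTree, V.toTree]⟩

/-- The intuitionistic type with a given syntax tree. -/
def IType.ofTree {κ : Type} : LTree (itypeArity (κ := κ)) → IType κ
  | ⟨.inl (.inl n), _⟩ => .var n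
  | ⟨.inl (.inr k), _⟩ => .const k
  | ⟨.inr 0, _⟩ => .bit
  | ⟨.inr 1, _⟩ => .qbit
  | ⟨.inr 2, _⟩ => .top
  | ⟨.inr 3, f⟩ => .arrow (ofTree (f (0 : Fin 2))) (ofTree (f (1 : Fin 2)))
  | ⟨.inr 4, f⟩ => .prod (ofTree (f (0 : Fin 2))) (ofTree (f (1 : Fin 2)))

/-- Intuitionistic types are their syntax trees. -/
def IType.equivTree (κ : Type) : IType κ ≃ LTree (itypeArity (κ := κ)) where
  toFun := IType.toTree
  invFun := IType.ofTree
  left_inv U := by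
    induction U with
    | arrow U V hU hV => exact congrArg₂ IType.arrow hU hV
    | prod U V hU hV => exact congrArg₂ IType.prod hU hV
    | _ => rfl
  right_inv t := by
    induction t with
    | mk l f ih =>
      obtain (n | k) | i := l
      · exact congrArg (WType.mk _) (funext fun i => Fin.elim0 i)
      · exact congrArg (WType.mk _) (funext fun i => Fin.elim0 i)
      · fin_cases i
        · exact congrArg (WType.mk _) (funext fun i => Fin.elim0 i)
        · exact congrArg (WType.mk _) (funext fun i => Fin.elim0 i)
        · exact congrArg (WType.mk _) (funext fun i => Fin.elim0 i)
        · exact congrArg (WType.mk _) (funext (Fin.forall_fin_two.2 ⟨ih (0 : Fin 2), ih (1 : Fin 2)⟩))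
        · exact congrArg (WType.mk _) (funext (Fin.forall_fin_two.2 ⟨ih (0 : Fin 2), ih (1 : Fin 2)⟩))

instance {κ : Type} [Primcodable κ] : Primcodable (IType κ) :=
  haveI := treePrimcodable (itypeArity (κ := κ)) (sumArity_primrec _)
  Primcodable.ofEquiv _ (IType.equivTree κ)

end Codes

/-! ### Contexts -/

/-- A typing context, i.e. a function from a finite set `|Δ|` of variables to types: the entry at
position `x` is the type of the variable `x`, and is `none` (or missing) if `x ∉ |Δ|`.  In
particular `some A :: Δ` is the context `x : A, Δ` under a binder of `x`. -/
abbrev QCtx (κ : Type) : Type := List (Option (QType κ))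

/-- Contexts of intuitionistic types. -/
abbrev SCtx (κ : Type) : Type := List (Option (IType κ))

/-- The skeleton of a context. -/
def QCtx.skel {κ : Type} (Γ : QCtx κ) : SCtx κ := Γ.map (Option.map QType.skel)

/-- `Γ` is a restriction of `Γ'`. -/
def SCtx.Le {κ : Type} (Γ Γ' : SCtx κ) : Prop :=
  ∀ (x : ℕ) (U : IType κ), Γ[x]? = some (some U) → Γ'[x]? = some (some U)

/-- `Split Γ Γ' Γ''` says that `Γ = Γ₁, Γ₂, !Δ` and `Γ' = Γ₁, !Δ` and `Γ'' = Γ₂, !Δ` for some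
contexts `Γ₁, Γ₂, Δ` with disjoint domains. -/
inductive Split {κ : Type} : QCtx κ → QCtx κ → QCtx κ → Prop
  | nil : Split [] [] []
  | none {Γ Γ₁ Γ₂ : QCtx κ} : Split Γ Γ₁ Γ₂ → Split (none :: Γ) (none :: Γ₁) (none :: Γ₂)
  | left {Γ Γ₁ Γ₂ : QCtx κ} (A : QType κ) :
      Split Γ Γ₁ Γ₂ → Split (some A :: Γ) (some A :: Γ₁) (Option.none :: Γ₂)
  | right {Γ Γ₁ Γ₂ : QCtx κ} (A : QType κ) :
      Split Γ Γ₁ Γ₂ → Split (some A :: Γ) (Option.none :: Γ₁) (some A :: Γ₂)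
  | both {Γ Γ₁ Γ₂ : QCtx κ} (A : QType κ) :
      Split Γ Γ₁ Γ₂ → Split (some A.bang :: Γ) (some A.bang :: Γ₁) (some A.bang :: Γ₂)

/-- The side condition of the second abstraction rule for `λx.M`: the context is `Γ, !Δ` where no
variable of `|Γ|` is free in `M`. -/
def Promotable {G κ : Type} (Γ : QCtx κ) (M : Term G) : Prop :=
  ∀ (x : ℕ) (A : QType κ), Γ[x]? = some (some A) → M.Free (x + 1) → ∃ B : QType κ, A = B.bang

/-! ### Typing derivations -/

/-- The two sets of quantum typing rules: the basic rules, and the basic rules together with the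
derived rules `(⊗.I')` and `(⊗.E')`. -/
inductive RuleSet : Type
  | basic : RuleSet
  | extended : RuleSet

/-- `QDeriv arity s Γ M A` is the type of derivations of the judgement `Γ ▷ M : A` of the quantum
lambda calculus from the rules `s`. -/
inductive QDeriv {G κ : Type} (arity : G → ℕ) (s : RuleSet) :
    QCtx κ → Term G → QType κ → Type
  | ax₁ {Γ : QCtx κ} {x : ℕ} {A B : QType κ} (hx : Γ[x]? = some (some A)) (h : SubType A B) :
      QDeriv arity s Γ (.var x) B
  | ax₂ {Γ : QCtx κ} {c : Const G} {B : QType κ} (h : SubType (c.type κ arity) B) :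
      QDeriv arity s Γ (.const c) B
  | ite {Γ Γ₁ Γ₂ : QCtx κ} {P M N : Term G} {A : QType κ} (h : Split Γ Γ₁ Γ₂)
      (p : QDeriv arity s Γ₁ P .bit) (d : QDeriv arity s Γ₂ M A) (e : QDeriv arity s Γ₂ N A) :
      QDeriv arity s Γ (.ite P M N) A
  | app {Γ Γ₁ Γ₂ : QCtx κ} {M N : Term G} {A B : QType κ} (h : Split Γ Γ₁ Γ₂)
      (d : QDeriv arity s Γ₁ M (.lolli A B)) (e : QDeriv arity s Γ₂ N A) :
      QDeriv arity s Γ (.app M N) B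
  | lam₁ {Γ : QCtx κ} {M : Term G} {A B : QType κ} (d : QDeriv arity s (some A :: Γ) M B) :
      QDeriv arity s Γ (.lam M) (.lolli A B)
  | lam₂ {Γ : QCtx κ} {M : Term G} {A B : QType κ} (n : ℕ) (h : Promotable Γ M)
      (d : QDeriv arity s (some A :: Γ) M B) :
      QDeriv arity s Γ (.lam M) (.nbang (n + 1) (.lolli A B))
  | pair {Γ Γ₁ Γ₂ : QCtx κ} {M N : Term G} {A B : QType κ} (n : ℕ) (h : Split Γ Γ₁ Γ₂)
      (d : QDeriv arity s Γ₁ M (.nbang n A)) (e : QDeriv arity s Γ₂ N (.nbang n B)) :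
      QDeriv arity s Γ (.pair M N) (.nbang n (.tensor A B))
  | star {Γ : QCtx κ} (n : ℕ) : QDeriv arity s Γ .star (.nbang n .top)
  | letp {Γ Γ₁ Γ₂ : QCtx κ} {M N : Term G} {A B C : QType κ} (n : ℕ) (h : Split Γ Γ₁ Γ₂)
      (d : QDeriv arity s Γ₁ M (.nbang n (.tensor A B)))
      (e : QDeriv arity s (some (.nbang n A) :: some (.nbang n B) :: Γ₂) N C) :
      QDeriv arity s Γ (.letp M N) C
  | pair' {Γ Γ₁ Γ₂ : QCtx κ} {M N : Term G} {A B : QType κ} (hs : s = .extended)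
      (τ σ : Fin 2) (h : Split Γ Γ₁ Γ₂)
      (d : QDeriv arity s Γ₁ M (.bang A)) (e : QDeriv arity s Γ₂ N (.bang B)) :
      QDeriv arity s Γ (.pair M N) (.bang (.tensor (.nbang τ A) (.nbang σ B)))
  | letp' {Γ Γ₁ Γ₂ : QCtx κ} {M N : Term G} {A B C : QType κ} (hs : s = .extended)
      (τ σ : Fin 2) (h : Split Γ Γ₁ Γ₂)
      (d : QDeriv arity s Γ₁ M (.bang (.tensor (.nbang τ A) (.nbang σ B))))
      (e : QDeriv arity s (some (.bang A) :: some (.bang B) :: Γ₂) N C) :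
      QDeriv arity s Γ (.letp M N) C

/-- `SDeriv arity Γ M U` is the type of derivations of the judgement `Γ ▶ M : U` of the
simply-typed lambda calculus. -/
inductive SDeriv {G κ : Type} (arity : G → ℕ) : SCtx κ → Term G → IType κ → Type
  | ax₁ {Γ : SCtx κ} {x : ℕ} {U : IType κ} (hx : Γ[x]? = some (some U)) :
      SDeriv arity Γ (.var x) U
  | ax₂ {Γ : SCtx κ} {c : Const G} {U : IType κ} (h : (c.type κ arity).skel = U) :
      SDeriv arity Γ (.const c) U
  | ite {Γ : SCtx κ} {P M N : Term G} {U : IType κ}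
      (p : SDeriv arity Γ P .bit) (d : SDeriv arity Γ M U) (e : SDeriv arity Γ N U) :
      SDeriv arity Γ (.ite P M N) U
  | app {Γ : SCtx κ} {M N : Term G} {U V : IType κ}
      (d : SDeriv arity Γ M (.arrow U V)) (e : SDeriv arity Γ N U) :
      SDeriv arity Γ (.app M N) V
  | lam {Γ : SCtx κ} {M : Term G} {U V : IType κ} (d : SDeriv arity (some U :: Γ) M V) :
      SDeriv arity Γ (.lam M) (.arrow U V)
  | pair {Γ : SCtx κ} {M N : Term G} {U V : IType κ}
      (d : SDeriv arity Γ M U) (e : SDeriv arity Γ N V) :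
      SDeriv arity Γ (.pair M N) (.prod U V)
  | star {Γ : SCtx κ} : SDeriv arity Γ .star .top
  | letp {Γ : SCtx κ} {M N : Term G} {U V W : IType κ}
      (d : SDeriv arity Γ M (.prod U V)) (e : SDeriv arity (some U :: some V :: Γ) N W) :
      SDeriv arity Γ (.letp M N) W

/-- `M` is typable in the quantum lambda calculus (with type constants `bit`, `qbit` and `κ`). -/
def QTypable {G : Type} (κ : Type) (arity : G → ℕ) (M : Term G) : Prop :=
  ∃ (Γ : QCtx κ) (A : QType κ), Nonempty (QDeriv arity .basic Γ M A)

/-- `M` is typable in the simply-typed lambda calculus. -/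
def STypable {G : Type} (κ : Type) (arity : G → ℕ) (M : Term G) : Prop :=
  ∃ (Γ : SCtx κ) (U : IType κ), Nonempty (SDeriv arity Γ M U)

/-- Quantum typing judgements `Γ ▷ M : A`. -/
abbrev QJudgement (G κ : Type) : Type := QCtx κ × Term G × QType κ

/-- Simple typing judgements `Γ ▶ M : U`. -/
abbrev SJudgement (G κ : Type) : Type := SCtx κ × Term G × IType κ

/-- A derivation written out as the list of the judgements at its nodes, in prefix order. -/
def QDeriv.judgements {G κ : Type} {arity : G → ℕ} {s : RuleSet} {Γ : QCtx κ} {M : Term G}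
    {A : QType κ} (q : QDeriv arity s Γ M A) : List (QJudgement G κ) :=
  (Γ, M, A) :: match q with
  | .ax₁ _ _ => []
  | .ax₂ _ => []
  | .ite _ p d e => p.judgements ++ d.judgements ++ e.judgements
  | .app _ d e => d.judgements ++ e.judgements
  | .lam₁ d => d.judgements
  | .lam₂ _ _ d => d.judgements
  | .pair _ _ d e => d.judgements ++ e.judgements
  | .star _ => []
  | .letp _ _ d e => d.judgements ++ e.judgements
  | .pair' _ _ _ _ d e => d.judgements ++ e.judgements
  | .letp' _ _ _ _ d e => d.judgements ++ e.judgements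

/-- A derivation written out as the list of the judgements at its nodes, in prefix order. -/
def SDeriv.judgements {G κ : Type} {arity : G → ℕ} {Γ : SCtx κ} {M : Term G} {U : IType κ}
    (π : SDeriv arity Γ M U) : List (SJudgement G κ) :=
  (Γ, M, U) :: match π with
  | .ax₁ _ => []
  | .ax₂ _ => []
  | .ite p d e => p.judgements ++ d.judgements ++ e.judgements
  | .app d e => d.judgements ++ e.judgements
  | .lam d => d.judgements
  | .pair d e => d.judgements ++ e.judgements
  | .star => []
  | .letp d e => d.judgements ++ e.judgements

/-- No type occurring in the derivation has repeated exponentials. -/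
def QDeriv.NoRepeat {G κ : Type} {arity : G → ℕ} {s : RuleSet} {Γ : QCtx κ} {M : Term G}
    {A : QType κ} (q : QDeriv arity s Γ M A) : Prop :=
  ∀ j ∈ q.judgements, (∀ B : QType κ, some B ∈ j.1 → B.NoRepeat) ∧ j.2.2.NoRepeat

/-! ### Skeletons of derivations -/

theorem SubType.skel_eq {κ : Type} {A B : QType κ} (h : SubType A B) : A.skel = B.skel := by
  induction h <;> simp_all [QType.skel]

theorem QType.skel_nbang {κ : Type} (n : ℕ) (A : QType κ) : (QType.nbang n A).skel = A.skel := by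
  induction n with
  | zero => rfl
  | succ n ih => exact ih

theorem QCtx.skel_get {κ : Type} {Γ : QCtx κ} {x : ℕ} {A : QType κ}
    (h : Γ[x]? = some (some A)) : Γ.skel[x]? = some (some A.skel) := by
  simp [QCtx.skel, h]

theorem SCtx.Le.cons {κ : Type} {Γ Γ' : SCtx κ} (h : SCtx.Le Γ Γ') (o : Option (IType κ)) :
    SCtx.Le (o :: Γ) (o :: Γ') := by
  intro x U
  cases x with
  | zero => simp
  | succ x => simpa using h x U

theorem Split.le_left {κ : Type} {Γ Γ₁ Γ₂ : QCtx κ} (h : Split Γ Γ₁ Γ₂) :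
    SCtx.Le Γ₁.skel Γ.skel := by
  induction h with
  | nil => intro x U hx; exact hx
  | right A _ ih =>
    intro x U
    cases x with
    | zero => simp [QCtx.skel]
    | succ x => simpa [QCtx.skel] using ih x U
  | _ => rename_i ih; exact ih.cons _

theorem Split.le_right {κ : Type} {Γ Γ₁ Γ₂ : QCtx κ} (h : Split Γ Γ₁ Γ₂) :
    SCtx.Le Γ₂.skel Γ.skel := by
  induction h with
  | nil => intro x U hx; exact hx
  | left A _ ih =>
    intro x U
    cases x with
    | zero => simp [QCtx.skel]
    | succ x => simpa [QCtx.skel] using ih x U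
  | _ => rename_i ih; exact ih.cons _

theorem SCtx.Le.trans {κ : Type} {Γ Γ' Γ'' : SCtx κ} (h : SCtx.Le Γ Γ') (h' : SCtx.Le Γ' Γ'') :
    SCtx.Le Γ Γ'' :=
  fun x U hx => h' x U (h x U hx)

/-- The skeleton of a quantum derivation of `Γ ▷ M : A`, as a simply-typed derivation: the
exponentials are erased in every judgement, and every context is completed to the one that the
simply-typed rules (which do not split contexts) prescribe, starting from a context `Γ'` at the
root.  For the skeleton proper, `Γ'` is the skeleton of `Γ`. -/
def QDeriv.skelOver {G κ : Type} {arity : G → ℕ} {s : RuleSet} :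
    {Γ : QCtx κ} → {M : Term G} → {A : QType κ} → QDeriv arity s Γ M A →
    (Γ' : SCtx κ) → (U : IType κ) → SCtx.Le Γ.skel Γ' → A.skel = U → SDeriv arity Γ' M U
  | _, _, _, .ax₁ hx h, _, _, hΓ, hU =>
      .ax₁ (hΓ _ _ (by rw [QCtx.skel_get hx, h.skel_eq, hU]))
  | _, _, _, .ax₂ h, _, _, _, hU => .ax₂ (h.skel_eq.trans hU)
  | _, _, _, .ite h p d e, Γ', U, hΓ, hU =>
      .ite (p.skelOver Γ' .bit (h.le_left.trans hΓ) rfl)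
        (d.skelOver Γ' U (h.le_right.trans hΓ) hU)
        (e.skelOver Γ' U (h.le_right.trans hΓ) hU)
  | _, _, _, .app (A := A) h d e, Γ', U, hΓ, hU =>
      .app (d.skelOver Γ' (.arrow A.skel U) (h.le_left.trans hΓ) (by rw [← hU]; rfl))
        (e.skelOver Γ' A.skel (h.le_right.trans hΓ) rfl)
  | _, _, _, .lam₁ (A := A) (B := B) d, Γ', U, hΓ, hU =>
      (show IType.arrow A.skel B.skel = U from hU) ▸
        SDeriv.lam (d.skelOver (some A.skel :: Γ') B.skel (hΓ.cons _) rfl)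
  | _, _, _, .lam₂ (A := A) (B := B) n _ d, Γ', U, hΓ, hU =>
      (show IType.arrow A.skel B.skel = U from (QType.skel_nbang (n + 1) _).symm.trans hU) ▸
        SDeriv.lam (d.skelOver (some A.skel :: Γ') B.skel (hΓ.cons _) rfl)
  | _, _, _, .pair (A := A) (B := B) n h d e, Γ', U, hΓ, hU =>
      (show IType.prod A.skel B.skel = U from (QType.skel_nbang n _).symm.trans hU) ▸
        SDeriv.pair (d.skelOver Γ' A.skel (h.le_left.trans hΓ) (QType.skel_nbang n _))
          (e.skelOver Γ' B.skel (h.le_right.trans hΓ) (QType.skel_nbang n _))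
  | _, _, _, .star n, _, U, _, hU =>
      (show IType.top = U from (QType.skel_nbang n _).symm.trans hU) ▸ SDeriv.star
  | _, _, _, .letp (A := A) (B := B) n h d e, Γ', U, hΓ, hU =>
      .letp (d.skelOver Γ' (.prod A.skel B.skel) (h.le_left.trans hΓ) (QType.skel_nbang n _))
        (e.skelOver (some A.skel :: some B.skel :: Γ') U
          (by
            have := ((h.le_right.trans hΓ).cons (some B.skel)).cons (some A.skel)
            rw [← QType.skel_nbang n A, ← QType.skel_nbang n B] at this ⊢
            exact this) hU)
  | _, _, _, .pair' (A := A) (B := B) _ τ σ h d e, Γ', U, hΓ, hU =>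
      (show IType.prod A.skel B.skel = U by
        rw [← hU, ← QType.skel_nbang τ A, ← QType.skel_nbang σ B]; rfl) ▸
        SDeriv.pair (d.skelOver Γ' A.skel (h.le_left.trans hΓ) rfl)
          (e.skelOver Γ' B.skel (h.le_right.trans hΓ) rfl)
  | _, _, _, .letp' (A := A) (B := B) _ τ σ h d e, Γ', U, hΓ, hU =>
      .letp (d.skelOver Γ' (.prod A.skel B.skel) (h.le_left.trans hΓ)
          (by rw [← QType.skel_nbang τ A, ← QType.skel_nbang σ B]; rfl))
        (e.skelOver (some A.skel :: some B.skel :: Γ') U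
          (((h.le_right.trans hΓ).cons (some B.skel)).cons (some A.skel)) hU)

/-- The quantum derivation `q` is a decoration of the simply-typed derivation `π`, that is, `π` is
the skeleton of `q`. -/
def QDeriv.IsDecoration {G κ : Type} {arity : G → ℕ} {s : RuleSet} {Γ : QCtx κ} {M : Term G}
    {A : QType κ} (q : QDeriv arity s Γ M A) {Γ' : SCtx κ} {U : IType κ}
    (π : SDeriv arity Γ' M U) : Prop :=
  ∃ (hΓ : Γ.skel = Γ') (hU : A.skel = U), q.skelOver Γ' U (fun _ _ h => hΓ ▸ h) hU = π

end QLambda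

open QLambda

/-! A quantum derivation becomes a simply-typed one when its exponentials are erased. The heart of
the theorem is the converse direction: whether exponentials can be put back does not depend on the
simply-typed derivation that is chosen.

Transport: `A.merge U` copies the exponentials of `A` onto the skeleton `U` as far as the two shapes
agree, and adds none elsewhere. It respects subtyping (`SubType.merge`) and keeps an exponential at
the root of a type, and the side conditions of the typing rules ask for nothing more. Hence a basic
derivation of `M` can be rebuilt over every simply-typed derivation of `M` (`QDeriv.exists_over`).

Contraction: `!!A` and `!A` are subtypes of each other, so each block of exponentials may be
contracted to a single one (`collapse`). Only the rules for pairs are not stable under this: the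
type `!!A` of a component is contracted, while in `!(!A ⊗ B)` the inner exponential survives. The
two extended rules absorb exactly this mismatch (`QDeriv.exists_noRepeat`), and they are admissible
in the basic system because subsumption is (`QDeriv.subsume`, `QDeriv.basic_of_extended`).

Finiteness: a skeleton carries finitely many types without repeated exponentials, so the judgements
of such decorations lie in a finite set; together with one Boolean per node they determine the
derivation (`QDeriv.ext_judgements`).

Algorithm: trees are coded by prefix words, and each of the two searches is a single evaluation of a
word on a stack, where the value of a node is the list of all admissible derivations ending there
(`SDeriv.evalsTo_check`, `Term.evalsTo_find`). The search for decorations ranges over the finite set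
above. The search for simply-typed derivations is bounded by `STypable.exists_within`: structure of
types on which no rule depends can be cut off and replaced by a type variable, which bounds heights
by the weight of the term. Running the two searches in succession decides typability, because the
first derivation found is as good as any other. -/

namespace QLambda

/-! ### Primitive recursive functions on lists -/

section PrimrecHelpers

variable {α β γ σ : Type*} [Primcodable α] [Primcodable β] [Primcodable γ] [Primcodable σ]

theorem primrec_filter {f : α → List β} {p : α → β → Prop} [∀ a, DecidablePred (p a)]
    (hf : Primrec f) (hp : PrimrecPred fun x : α × β => p x.1 x.2) :
    Primrec fun a => (f a).filter fun b => p a b := by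
  have h := Primrec.listFilterMap (f := f) (g := fun a b => if p a b then some b else none) hf
    (Primrec.ite (c := fun x : α × β => p x.1 x.2) hp (Primrec.option_some.comp Primrec.snd)
      (Primrec.const none)).to₂
  refine h.of_eq fun a => ?_
  rw [← List.filterMap_eq_filter]
  congr 1
  funext b
  by_cases hb : p a b <;> simp [hb, Option.guard]

/-- Existential choices in the typing rules will be expressed as choices from computed lists, so
that bounded quantification suffices. -/
theorem primrecPred_exists_mem {f : α → List β} {p : α → β → Prop}
    (hf : Primrec f) (hp : PrimrecPred fun x : α × β => p x.1 x.2) :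
    PrimrecPred fun a => ∃ b ∈ f a, p a b := by
  have h : PrimrecRel fun (b : β) (a : α) => p a b := hp.comp (Primrec.pair Primrec.snd Primrec.fst)
  exact h.exists_mem_list.comp hf Primrec.id

theorem primrecPred_forall_mem {f : α → List β} {p : α → β → Prop}
    (hf : Primrec f) (hp : PrimrecPred fun x : α × β => p x.1 x.2) :
    PrimrecPred fun a => ∀ b ∈ f a, p a b := by
  have h : PrimrecRel fun (b : β) (a : α) => p a b := hp.comp (Primrec.pair Primrec.snd Primrec.fst)
  exact h.forall_mem_list.comp hf Primrec.id

theorem primrecPred_mem {f : α → β} {g : α → List β} (hf : Primrec f) (hg : Primrec g) :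
    PrimrecPred fun a => f a ∈ g a := by
  have h : PrimrecPred fun a => ∃ b ∈ g a, b = f a :=
    primrecPred_exists_mem (p := fun a b => b = f a) hg
      (Primrec.eq.comp Primrec.snd (hf.comp Primrec.fst))
  exact h.of_eq fun a => by simp

theorem primrecPred_eq {f g : α → β} (hf : Primrec f) (hg : Primrec g) :
    PrimrecPred fun a => f a = g a :=
  Primrec.eq.comp hf hg

theorem primrec_sections : Primrec (List.sections : List (List α) → List (List α)) := by
  have h : Primrec fun L : List (List α) =>
      L.foldr (fun l S => S.flatMap fun s => l.map fun a => a :: s) [[]] := by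
    refine Primrec.list_foldr Primrec.id (Primrec.const [[]])
      (h := fun _ (p : List α × List (List α)) => p.2.flatMap fun s => p.1.map fun a => a :: s) ?_
    refine Primrec.list_flatMap (Primrec.snd.comp Primrec.snd) ?_
    refine Primrec.list_map (Primrec.fst.comp (Primrec.snd.comp Primrec.fst)) ?_
    exact Primrec.list_cons.comp Primrec.snd (Primrec.snd.comp Primrec.fst)
  refine h.of_eq fun L => ?_
  induction L with
  | nil => rfl
  | cons l L ih => simp only [List.foldr_cons, ih, List.sections]

theorem primrec_list_sum : Primrec (List.sum : List ℕ → ℕ) := by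
  have h : Primrec fun l : List ℕ => l.foldr (fun a b => a + b) 0 :=
    Primrec.list_foldr Primrec.id (Primrec.const 0)
      (h := fun _ p => p.1 + p.2)
      (Primrec.nat_add.comp (Primrec.fst.comp Primrec.snd) (Primrec.snd.comp Primrec.snd))
  exact h.of_eq fun l => rfl

/-- The gate arity is only assumed computable. Mapping it over a word is the one place where it
enters the searches; everything after that is primitive recursive. -/
theorem computable_list_map {f : β → σ} (hf : Computable f) :
    Computable (List.map f : List β → List σ) := by
  have h : Computable fun l : List β => Nat.rec (motive := fun _ => List σ) []
      (fun n r => r ++ ((l[n]?).map f).toList) l.length := by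
    refine Computable.nat_rec (h := fun l p => p.2 ++ ((l[p.1]?).map f).toList)
      Computable.list_length (Computable.const []) ?_
    refine Computable.list_append.comp (Computable.snd.comp Computable.snd) ?_
    refine Primrec.optionToList.to_comp.comp ?_
    refine Computable.option_map ?_ (hf.comp Computable.snd).to₂
    exact Computable.list_getElem?.comp Computable.fst (Computable.fst.comp Computable.snd)
  refine h.of_eq fun l => ?_
  -- After `n` steps the recursion holds the image of the first `n` entries.
  have key : ∀ n ≤ l.length, Nat.rec (motive := fun _ => List σ) []
      (fun n r => r ++ ((l[n]?).map f).toList) n = (l.take n).map f := by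
    intro n
    induction n with
    | zero => intro _; rfl
    | succ n ih =>
      intro hn
      have hn' : n < l.length := hn
      simp only [ih hn'.le, List.take_add_one, List.map_append]
      congr 1
      cases l[n]? <;> rfl
  simpa using key l.length le_rfl

end PrimrecHelpers

/-! ### Evaluation of words in prefix notation -/

section Eval

variable {N β : Type*}

/-- Reads a word in prefix notation from right to left, keeping a stack of the values of the
trees that were read. -/
def evalWord (ar : N → ℕ) (F : N → List β → β) (w : List N) : List β :=
  w.foldr (fun n s => F n (s.take (ar n)) :: s.drop (ar n)) []

/-- The word `w` is the prefix notation of one tree, whose value is `b`. -/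
def EvalsTo (ar : N → ℕ) (F : N → List β → β) (w : List N) (b : β) : Prop :=
  ∀ w', evalWord ar F (w ++ w') = b :: evalWord ar F w'

variable {ar : N → ℕ} {F : N → List β → β}

/-- Since `EvalsTo` quantifies over the rest of the word, the values of the subtrees end up on top
of whatever stack the rest produces. The label then removes exactly these values, as their number is
its arity. -/
theorem EvalsTo.node {n : N} {ws : List (List N)} {bs : List β} (hn : ar n = bs.length)
    (h : List.Forall₂ (EvalsTo ar F) ws bs) : EvalsTo ar F (n :: ws.flatten) (F n bs) := by
  have key : ∀ w', evalWord ar F (ws.flatten ++ w') = bs ++ evalWord ar F w' := by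
    intro w'
    clear hn
    induction h with
    | nil => rfl
    | cons h1 _ ih => rw [List.flatten_cons, List.append_assoc, h1, ih]; rfl
  intro w'
  have h2 : evalWord ar F (n :: ws.flatten ++ w') =
      F n ((evalWord ar F (ws.flatten ++ w')).take (ar n)) ::
        (evalWord ar F (ws.flatten ++ w')).drop (ar n) := rfl
  rw [h2, key, hn, List.take_left, List.drop_left]

theorem EvalsTo.node₀ {n : N} (hn : ar n = 0) : EvalsTo ar F [n] (F n []) :=
  EvalsTo.node (ws := []) hn .nil

theorem EvalsTo.node₁ {n : N} {w : List N} {b : β} (hn : ar n = 1) (h : EvalsTo ar F w b) :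
    EvalsTo ar F (n :: w) (F n [b]) := by
  simpa using EvalsTo.node (ws := [w]) hn (.cons h .nil)

theorem EvalsTo.node₂ {n : N} {w₁ w₂ : List N} {b₁ b₂ : β} (hn : ar n = 2)
    (h₁ : EvalsTo ar F w₁ b₁) (h₂ : EvalsTo ar F w₂ b₂) :
    EvalsTo ar F (n :: (w₁ ++ w₂)) (F n [b₁, b₂]) := by
  simpa using EvalsTo.node (ws := [w₁, w₂]) hn (.cons h₁ (.cons h₂ .nil))

theorem EvalsTo.node₃ {n : N} {w₁ w₂ w₃ : List N} {b₁ b₂ b₃ : β} (hn : ar n = 3)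
    (h₁ : EvalsTo ar F w₁ b₁) (h₂ : EvalsTo ar F w₂ b₂) (h₃ : EvalsTo ar F w₃ b₃) :
    EvalsTo ar F (n :: (w₁ ++ w₂ ++ w₃)) (F n [b₁, b₂, b₃]) := by
  simpa using EvalsTo.node (ws := [w₁, w₂, w₃]) hn (.cons h₁ (.cons h₂ (.cons h₃ .nil)))

theorem EvalsTo.evalWord {w : List N} {b : β} (h : EvalsTo ar F w b) :
    evalWord ar F w = [b] := by
  simpa [QLambda.evalWord] using h []

/-- A structural recursion on trees becomes a right fold over the prefix word. Functions on terms
and types and both searches are shown to be primitive recursive in this way. -/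
theorem evalWord_primrec {α : Type*} [Primcodable α] [Primcodable N] [Primcodable β]
    {F : α → N → List β → β} {w : α → List N} (har : Primrec ar)
    (hF : Primrec fun p : α × N × List β => F p.1 p.2.1 p.2.2) (hw : Primrec w) :
    Primrec fun a => QLambda.evalWord ar (F a) (w a) := by
  refine Primrec.list_foldr (h := fun a p => F a p.1 (p.2.take (ar p.1)) :: p.2.drop (ar p.1))
    hw (Primrec.const []) ?_
  have h1 : Primrec fun x : α × N × List β => x.2.1 := Primrec.fst.comp Primrec.snd
  have h2 : Primrec fun x : α × N × List β => x.2.2 := Primrec.snd.comp Primrec.snd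
  have ht : Primrec fun x : α × N × List β => x.2.2.take (ar x.2.1) :=
    Primrec.list_take.comp (har.comp h1) h2
  refine Primrec.list_cons.comp ?_ (Primrec.list_drop.comp (har.comp h1) h2)
  exact hF.comp (Primrec.pair Primrec.fst (Primrec.pair h1 ht))

end Eval

/-! ### The words of terms and types -/

section Words

/-- The code of a tree is by construction the code of its word, so primitive recursiveness can be
checked on words. -/
theorem tree_primrec_iff {L α : Type} [Primcodable L] [Primcodable α] {ar : L → ℕ}
    (h : Primrec ar) {f : α → LTree ar} :
    letI := treePrimcodable ar h
    Primrec f ↔ Primrec fun a => (f a).word := by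
  let : Primcodable {w : List L // count ar w = some 1} :=
    Primcodable.subtype (Primrec.eq.comp (count_primrec ar h) (Primrec.const (some 1)))
  refine (Primrec.of_equiv_iff (treeEquiv ar)).symm.trans ?_
  exact Primrec.subtype_val_iff.symm

variable {G κ α : Type}

/-- The prefix notation of a term. -/
def Term.word (M : Term G) : List (TermLabel G) := M.toTree.word

/-- The prefix notation of a linear type. -/
def QType.word (A : QType κ) : List (QTypeLabel κ) := A.toTree.word

/-- The prefix notation of an intuitionistic type. -/
def IType.word (U : IType κ) : List (ITypeLabel κ) := U.toTree.word

theorem termArity_primrec [Primcodable G] : Primrec (termArity (G := G)) := sumArity_primrec _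

theorem qtypeArity_primrec [Primcodable κ] : Primrec (qtypeArity (κ := κ)) := sumArity_primrec _

theorem itypeArity_primrec [Primcodable κ] : Primrec (itypeArity (κ := κ)) := sumArity_primrec _

theorem Term.primrec_iff [Primcodable G] [Primcodable α] {f : α → Term G} :
    Primrec f ↔ Primrec fun a => (f a).word := by
  let := treePrimcodable (termArity (G := G)) (sumArity_primrec _)
  exact (Primrec.of_equiv_iff (Term.equivTree G)).symm.trans (tree_primrec_iff _)

theorem QType.primrec_iff [Primcodable κ] [Primcodable α] {f : α → QType κ} :
    Primrec f ↔ Primrec fun a => (f a).word := by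
  let := treePrimcodable (qtypeArity (κ := κ)) (sumArity_primrec _)
  exact (Primrec.of_equiv_iff (QType.equivTree κ)).symm.trans (tree_primrec_iff _)

theorem IType.primrec_iff [Primcodable κ] [Primcodable α] {f : α → IType κ} :
    Primrec f ↔ Primrec fun a => (f a).word := by
  let := treePrimcodable (itypeArity (κ := κ)) (sumArity_primrec _)
  exact (Primrec.of_equiv_iff (IType.equivTree κ)).symm.trans (tree_primrec_iff _)

theorem Term.word_primrec [Primcodable G] : Primrec (Term.word (G := G)) :=
  Term.primrec_iff.1 Primrec.id

theorem QType.word_primrec [Primcodable κ] : Primrec (QType.word (κ := κ)) :=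
  QType.primrec_iff.1 Primrec.id

theorem IType.word_primrec [Primcodable κ] : Primrec (IType.word (κ := κ)) :=
  IType.primrec_iff.1 Primrec.id

section

@[simp] theorem Term.word_var (n : ℕ) : (Term.var n : Term G).word = [.inl (.inl n)] := rfl
@[simp] theorem Term.word_gate (g : G) : (Term.const (.gate g)).word = [.inl (.inr g)] := rfl
@[simp] theorem Term.word_zero : (Term.const .zero : Term G).word = [.inr 0] := rfl
@[simp] theorem Term.word_one : (Term.const .one : Term G).word = [.inr 1] := rfl
@[simp] theorem Term.word_meas : (Term.const .meas : Term G).word = [.inr 2] := rfl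
@[simp] theorem Term.word_new : (Term.const .new : Term G).word = [.inr 3] := rfl
@[simp] theorem Term.word_star : (Term.star : Term G).word = [.inr 4] := rfl
@[simp] theorem Term.word_app (M N : Term G) :
    (Term.app M N).word = .inr 5 :: (M.word ++ N.word) :=
  congrArg (List.cons _) (by
    change M.word ++ (N.word ++ []) = _
    simp)
@[simp] theorem Term.word_lam (M : Term G) : (Term.lam M).word = .inr 6 :: M.word :=
  congrArg (List.cons _) (by
    change M.word ++ [] = _
    simp)
@[simp] theorem Term.word_ite (P M N : Term G) :
    (Term.ite P M N).word = .inr 7 :: (P.word ++ M.word ++ N.word) :=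
  congrArg (List.cons _) (by
    change P.word ++ (M.word ++ (N.word ++ [])) = _
    simp)
@[simp] theorem Term.word_pair (M N : Term G) :
    (Term.pair M N).word = .inr 8 :: (M.word ++ N.word) :=
  congrArg (List.cons _) (by
    change M.word ++ (N.word ++ []) = _
    simp)
@[simp] theorem Term.word_letp (M N : Term G) :
    (Term.letp M N).word = .inr 9 :: (M.word ++ N.word) :=
  congrArg (List.cons _) (by
    change M.word ++ (N.word ++ []) = _
    simp)

@[simp] theorem QType.word_var (n : ℕ) : (QType.var n : QType κ).word = [.inl (.inl n)] := rfl
@[simp] theorem QType.word_const (k : κ) : (QType.const k).word = [.inl (.inr k)] := rfl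
@[simp] theorem QType.word_bit : (QType.bit : QType κ).word = [.inr 0] := rfl
@[simp] theorem QType.word_qbit : (QType.qbit : QType κ).word = [.inr 1] := rfl
@[simp] theorem QType.word_top : (QType.top : QType κ).word = [.inr 2] := rfl
@[simp] theorem QType.word_bang (A : QType κ) : A.bang.word = .inr 3 :: A.word :=
  congrArg (List.cons _) (by
    change A.word ++ [] = _
    simp)
@[simp] theorem QType.word_lolli (A B : QType κ) :
    (QType.lolli A B).word = .inr 4 :: (A.word ++ B.word) :=
  congrArg (List.cons _) (by
    change A.word ++ (B.word ++ []) = _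
    simp)
@[simp] theorem QType.word_tensor (A B : QType κ) :
    (QType.tensor A B).word = .inr 5 :: (A.word ++ B.word) :=
  congrArg (List.cons _) (by
    change A.word ++ (B.word ++ []) = _
    simp)

@[simp] theorem IType.word_var (n : ℕ) : (IType.var n : IType κ).word = [.inl (.inl n)] := rfl
@[simp] theorem IType.word_const (k : κ) : (IType.const k).word = [.inl (.inr k)] := rfl
@[simp] theorem IType.word_bit : (IType.bit : IType κ).word = [.inr 0] := rfl
@[simp] theorem IType.word_qbit : (IType.qbit : IType κ).word = [.inr 1] := rfl
@[simp] theorem IType.word_top : (IType.top : IType κ).word = [.inr 2] := rfl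
@[simp] theorem IType.word_arrow (U V : IType κ) :
    (IType.arrow U V).word = .inr 3 :: (U.word ++ V.word) :=
  congrArg (List.cons _) (by
    change U.word ++ (V.word ++ []) = _
    simp)
@[simp] theorem IType.word_prod (U V : IType κ) :
    (IType.prod U V).word = .inr 4 :: (U.word ++ V.word) :=
  congrArg (List.cons _) (by
    change U.word ++ (V.word ++ []) = _
    simp)

end

/-! ### Primitive recursive constructors -/

section Constructors

variable [Primcodable G] [Primcodable κ] [Primcodable α]

theorem Term.var_primrec : Primrec (Term.var : ℕ → Term G) :=
  Term.primrec_iff.2 <| Primrec.list_cons.comp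
    (Primrec.sumInl.comp Primrec.sumInl) (Primrec.const [])

theorem Term.gate_primrec : Primrec (fun g : G => Term.const (.gate g)) :=
  Term.primrec_iff.2 <| Primrec.list_cons.comp
    (Primrec.sumInl.comp Primrec.sumInr) (Primrec.const [])

theorem primrec_node₁ {L β : Type} [Primcodable L] [Primcodable β] (l : L) {wd : β → List L}
    (h : Primrec wd) {f : α → β} (hf : Primrec f) : Primrec fun a => l :: wd (f a) :=
  Primrec.list_cons.comp (Primrec.const l) (h.comp hf)

theorem primrec_node₂ {L β : Type} [Primcodable L] [Primcodable β] (l : L) {wd : β → List L}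
    (h : Primrec wd) {f g : α → β} (hf : Primrec f) (hg : Primrec g) :
    Primrec fun a => l :: (wd (f a) ++ wd (g a)) :=
  Primrec.list_cons.comp (Primrec.const l) (Primrec.list_append.comp (h.comp hf) (h.comp hg))

theorem Term.app_primrec {f g : α → Term G} (hf : Primrec f) (hg : Primrec g) :
    Primrec fun a => Term.app (f a) (g a) :=
  Term.primrec_iff.2 <| (primrec_node₂ (.inr 5) Term.word_primrec hf hg).of_eq fun _ => by simp

theorem Term.pair_primrec {f g : α → Term G} (hf : Primrec f) (hg : Primrec g) :
    Primrec fun a => Term.pair (f a) (g a) :=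
  Term.primrec_iff.2 <| (primrec_node₂ (.inr 8) Term.word_primrec hf hg).of_eq fun _ => by simp

theorem Term.letp_primrec {f g : α → Term G} (hf : Primrec f) (hg : Primrec g) :
    Primrec fun a => Term.letp (f a) (g a) :=
  Term.primrec_iff.2 <| (primrec_node₂ (.inr 9) Term.word_primrec hf hg).of_eq fun _ => by simp

theorem Term.lam_primrec {f : α → Term G} (hf : Primrec f) : Primrec fun a => Term.lam (f a) :=
  Term.primrec_iff.2 <| (primrec_node₁ (.inr 6) Term.word_primrec hf).of_eq fun _ => by simp

theorem Term.ite_primrec {e f g : α → Term G} (he : Primrec e) (hf : Primrec f)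
    (hg : Primrec g) : Primrec fun a => Term.ite (e a) (f a) (g a) :=
  Term.primrec_iff.2 <| (Primrec.list_cons.comp (Primrec.const (.inr 7))
    (Primrec.list_append.comp (Primrec.list_append.comp (Term.word_primrec.comp he)
      (Term.word_primrec.comp hf)) (Term.word_primrec.comp hg))).of_eq fun _ => by simp

theorem QType.var_primrec : Primrec (QType.var : ℕ → QType κ) :=
  QType.primrec_iff.2 <| Primrec.list_cons.comp
    (Primrec.sumInl.comp Primrec.sumInl) (Primrec.const [])

theorem QType.const_primrec : Primrec (QType.const : κ → QType κ) :=
  QType.primrec_iff.2 <| Primrec.list_cons.comp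
    (Primrec.sumInl.comp Primrec.sumInr) (Primrec.const [])

theorem QType.bang_primrec {f : α → QType κ} (hf : Primrec f) :
    Primrec fun a => QType.bang (f a) :=
  QType.primrec_iff.2 <| (primrec_node₁ (.inr 3) QType.word_primrec hf).of_eq fun _ => by simp

theorem QType.lolli_primrec {f g : α → QType κ} (hf : Primrec f) (hg : Primrec g) :
    Primrec fun a => QType.lolli (f a) (g a) :=
  QType.primrec_iff.2 <| (primrec_node₂ (.inr 4) QType.word_primrec hf hg).of_eq fun _ => by simp

theorem QType.tensor_primrec {f g : α → QType κ} (hf : Primrec f) (hg : Primrec g) :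
    Primrec fun a => QType.tensor (f a) (g a) :=
  QType.primrec_iff.2 <| (primrec_node₂ (.inr 5) QType.word_primrec hf hg).of_eq fun _ => by simp

theorem IType.var_primrec : Primrec (IType.var : ℕ → IType κ) :=
  IType.primrec_iff.2 <| Primrec.list_cons.comp
    (Primrec.sumInl.comp Primrec.sumInl) (Primrec.const [])

theorem IType.const_primrec : Primrec (IType.const : κ → IType κ) :=
  IType.primrec_iff.2 <| Primrec.list_cons.comp
    (Primrec.sumInl.comp Primrec.sumInr) (Primrec.const [])

theorem IType.arrow_primrec {f g : α → IType κ} (hf : Primrec f) (hg : Primrec g) :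
    Primrec fun a => IType.arrow (f a) (g a) :=
  IType.primrec_iff.2 <| (primrec_node₂ (.inr 3) IType.word_primrec hf hg).of_eq fun _ => by simp

theorem IType.prod_primrec {f g : α → IType κ} (hf : Primrec f) (hg : Primrec g) :
    Primrec fun a => IType.prod (f a) (g a) :=
  IType.primrec_iff.2 <| (primrec_node₂ (.inr 4) IType.word_primrec hf hg).of_eq fun _ => by simp

end Constructors

end Words

/-! ### The subtyping relation -/

section Types

variable {κ : Type}

/-- The outermost construct of the type is not an exponential. -/
def QType.Plain (A : QType κ) : Prop := ∀ B, A ≠ .bang B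

theorem SubType.refl (A : QType κ) : SubType A A := by
  induction A with
  | bit => exact .bit
  | qbit => exact .qbit
  | const k => exact .const k
  | var n => exact .var n
  | bang A ih => exact .promote (.derelict ih)
  | lolli A B hA hB => exact .lolli hA hB
  | top => exact .top
  | tensor A B hA hB => exact .tensor hA hB

/-- Induction on the middle type. If it is `!B`, derelictions on the left are peeled off until a
promotion appears; then a dereliction on the right cancels against it and leaves a cut at `B`, while
a promotion on the right is kept. -/
theorem SubType.trans {A B C : QType κ} (h : SubType A B) (h' : SubType B C) : SubType A C := by
  induction B generalizing A C with
  | bang B ih =>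
    generalize hX : QType.bang B = X at h
    induction h with
    | @derelict A X h1 ih1 => exact .derelict (ih1 hX)
    | @promote A X h1 ih1 =>
      cases hX
      clear ih1
      generalize hY : QType.bang B = Y at h'
      induction h' with
      | derelict h2 => cases hY; exact ih h1 h2
      | promote h2 ih2 => cases hY; exact .promote (ih2 rfl)
      | _ => cases hY
    | _ => cases hX
  | lolli B₁ B₂ ih₁ ih₂ =>
    generalize hX : QType.lolli B₁ B₂ = X at h
    induction h with
    | derelict h1 ih1 => exact .derelict (ih1 hX)
    | lolli h1 h2 =>
      cases hX
      cases h' with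
      | lolli h3 h4 => exact .lolli (ih₁ h3 h1) (ih₂ h2 h4)
    | _ => cases hX
  | tensor B₁ B₂ ih₁ ih₂ =>
    generalize hX : QType.tensor B₁ B₂ = X at h
    induction h with
    | derelict h1 ih1 => exact .derelict (ih1 hX)
    | tensor h1 h2 =>
      cases hX
      cases h' with
      | tensor h3 h4 => exact .tensor (ih₁ h1 h3) (ih₂ h2 h4)
    | _ => cases hX
  | _ => cases h'; exact h

theorem SubType.of_bang_right {A B : QType κ} (h : SubType A B.bang) : SubType A B :=
  h.trans (.derelict (.refl B))

theorem SubType.exists_bang {A B : QType κ} (h : SubType A B.bang) : ∃ A', A = .bang A' := by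
  cases h with
  | derelict h => exact ⟨_, rfl⟩
  | promote h => exact ⟨_, rfl⟩

theorem subType_bang_bang {A B : QType κ} : SubType A.bang B.bang ↔ SubType A.bang B :=
  ⟨SubType.of_bang_right, .promote⟩

theorem bang_subType_plain {A B : QType κ} (hB : B.Plain) : SubType A.bang B ↔ SubType A B := by
  refine ⟨fun h => ?_, .derelict⟩
  cases h with
  | derelict h => exact h
  | promote h => exact absurd rfl (hB _)

/-- Dereliction discards any number of exponentials, and promotion creates any number from a single
one. Only the presence of an exponential matters, not how many there are. -/
theorem nbang_subType_nbang {A B : QType κ} {n m : ℕ} (h : SubType A B) (hnm : n = 0 → m = 0) :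
    SubType (.nbang n A) (.nbang m B) := by
  have h1 : ∀ n, SubType (.nbang n A) B := by
    intro n
    induction n with
    | zero => exact h
    | succ n ih => exact .derelict ih
  induction m with
  | zero => exact h1 n
  | succ m ih =>
    obtain _ | n := n
    · cases hnm rfl
    · exact .promote (ih fun h => by cases h)

/-- Inversion of subtyping below a block of exponentials: the plain parts are compared separately,
and the sole constraint on the blocks is that a nonempty one cannot arise from an empty one. -/
theorem nbang_subType {A C : QType κ} {n : ℕ} (hA : A.Plain) (h : SubType (.nbang n A) C) :
    ∃ m B, C = .nbang m B ∧ B.Plain ∧ SubType A B ∧ (n = 0 → m = 0) := by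
  generalize hX : QType.nbang n A = X at h
  induction h generalizing n with
  | derelict h ih =>
    obtain _ | n := n
    · exact absurd hX (hA _)
    · cases hX
      obtain ⟨m, B, h1, h2, h3, -⟩ := ih rfl
      exact ⟨m, B, h1, h2, h3, by simp⟩
  | promote h ih =>
    obtain ⟨m, B, h1, h2, h3, -⟩ := ih hX
    refine ⟨m + 1, B, by rw [h1]; rfl, h2, h3, ?_⟩
    rintro rfl
    exact absurd hX (hA _)
  | lolli h1 h2 =>
    obtain _ | n := n
    · cases hX; exact ⟨0, _, rfl, fun _ => by simp, .lolli h1 h2, fun _ => rfl⟩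
    · cases hX
  | tensor h1 h2 =>
    obtain _ | n := n
    · cases hX; exact ⟨0, _, rfl, fun _ => by simp, .tensor h1 h2, fun _ => rfl⟩
    · cases hX
  | _ =>
    obtain _ | n := n
    · cases hX; exact ⟨0, _, rfl, hA, .refl _, fun _ => rfl⟩
    · cases hX

theorem nbang_lolli_subType {A B C : QType κ} {n : ℕ} (h : SubType (.nbang n (.lolli A B)) C) :
    ∃ m A' B', C = .nbang m (.lolli A' B') ∧ SubType A' A ∧ SubType B B' ∧ (n = 0 → m = 0) := by
  obtain ⟨m, X, rfl, -, h, hnm⟩ := nbang_subType (by intro _; simp) h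
  cases h with
  | lolli h1 h2 => exact ⟨m, _, _, rfl, h1, h2, hnm⟩

theorem nbang_tensor_subType {A B C : QType κ} {n : ℕ} (h : SubType (.nbang n (.tensor A B)) C) :
    ∃ m A' B', C = .nbang m (.tensor A' B') ∧ SubType A A' ∧ SubType B B' ∧ (n = 0 → m = 0) := by
  obtain ⟨m, X, rfl, -, h, hnm⟩ := nbang_subType (by intro _; simp) h
  cases h with
  | tensor h1 h2 => exact ⟨m, _, _, rfl, h1, h2, hnm⟩

theorem nbang_top_subType {C : QType κ} {n : ℕ} (h : SubType (.nbang n .top) C) :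
    ∃ m, C = .nbang m .top := by
  obtain ⟨m, X, rfl, -, h, hnm⟩ := nbang_subType (by intro _; simp) h
  cases h with
  | top => exact ⟨m, rfl⟩

/-! ### Transport of exponentials to another skeleton -/

/-- The intuitionistic type as a linear type without exponentials. -/
def IType.embed : IType κ → QType κ
  | .bit => .bit
  | .qbit => .qbit
  | .const k => .const k
  | .var n => .var n
  | .arrow U V => .lolli U.embed V.embed
  | .top => .top
  | .prod U V => .tensor U.embed V.embed

/-- `A.merge U` has the skeleton `U`, with exponentials as in `A` as far as the structures of the
two types agree. -/
def QType.merge : QType κ → IType κ → QType κ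
  | .bang A, U => .bang (A.merge U)
  | .lolli A B, .arrow U V => .lolli (A.merge U) (B.merge V)
  | .tensor A B, .prod U V => .tensor (A.merge U) (B.merge V)
  | _, U => U.embed

theorem IType.skel_embed (U : IType κ) : U.embed.skel = U := by
  induction U <;> simp_all [IType.embed, QType.skel]

theorem QType.skel_merge (A : QType κ) (U : IType κ) : (A.merge U).skel = U := by
  induction A, U using QType.merge.induct <;>
    simp_all [QType.merge, QType.skel, IType.skel_embed]

theorem QType.merge_skel (A : QType κ) : A.merge A.skel = A := by
  induction A <;> simp_all [QType.merge, QType.skel, IType.embed]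

theorem QType.merge_nbang (n : ℕ) (A : QType κ) (U : IType κ) :
    (QType.nbang n A).merge U = .nbang n (A.merge U) := by
  induction n with
  | zero => rfl
  | succ n ih => simp [QType.nbang, QType.merge, ih]

/-- The rules for exponentials do not look at the skeleton. Where the shape of the types differs
from `U`, both sides become the same type `U.embed`, and reflexivity applies. -/
theorem SubType.merge {A B : QType κ} (h : SubType A B) (U : IType κ) :
    SubType (A.merge U) (B.merge U) := by
  induction h generalizing U with
  | derelict _ ih => rw [QType.merge]; exact .derelict (ih U)
  | promote _ ih => simp only [QType.merge] at ih ⊢; exact .promote (ih U)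
  | tensor _ _ ih₁ ih₂ =>
    cases U <;> simp only [QType.merge]
    case prod U V => exact .tensor (ih₁ U) (ih₂ V)
    all_goals exact .refl _
  | lolli _ _ ih₁ ih₂ =>
    cases U <;> simp only [QType.merge]
    case arrow U V => exact .lolli (ih₁ U) (ih₂ V)
    all_goals exact .refl _
  | _ => exact .refl _

/-! ### Removal of repeated exponentials -/

/-- The type `!A`, or `A` itself if it is of this form already. -/
def QType.bangOnce : QType κ → QType κ
  | .bang A => .bang A
  | A => .bang A

/-- The type with all repeated exponentials contracted. -/
def QType.collapse : QType κ → QType κ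
  | .bang A => A.collapse.bangOnce
  | .lolli A B => .lolli A.collapse B.collapse
  | .tensor A B => .tensor A.collapse B.collapse
  | A => A

theorem QType.bangOnce_of_plain {A : QType κ} (h : A.Plain) : A.bangOnce = .bang A := by
  cases A <;> first | rfl | exact absurd rfl (h _)

theorem QType.bangOnce_cases (A : QType κ) :
    (A.Plain ∧ A.bangOnce = .bang A) ∨ ∃ B, A = .bang B ∧ A.bangOnce = .bang B := by
  cases A with
  | bang B => exact .inr ⟨B, rfl, rfl⟩
  | _ => exact .inl ⟨fun _ => by simp, rfl⟩

theorem QType.bangOnce_bangOnce (A : QType κ) : A.bangOnce.bangOnce = A.bangOnce := by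
  cases A <;> rfl

theorem QType.skel_collapse (A : QType κ) : A.collapse.skel = A.skel := by
  induction A with
  | bang A ih =>
    rcases A.collapse.bangOnce_cases with ⟨-, h⟩ | ⟨B, h, h'⟩
    · simp [QType.collapse, QType.skel, h, ih]
    · rw [h] at ih
      simpa [QType.collapse, h, QType.bangOnce, QType.skel] using ih
  | _ => simp_all [QType.collapse, QType.skel]

theorem QType.noRepeat_collapse (A : QType κ) : A.collapse.NoRepeat := by
  induction A with
  | bang A ih =>
    rcases A.collapse.bangOnce_cases with ⟨h, h'⟩ | ⟨B, h, h'⟩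
    · rw [QType.collapse, h']; exact ⟨h, ih⟩
    · rw [QType.collapse, h', ← h]; exact ih
  | lolli A B hA hB => exact ⟨hA, hB⟩
  | tensor A B hA hB => exact ⟨hA, hB⟩
  | _ => trivial

theorem QType.NoRepeat.collapse_eq {A : QType κ} (h : A.NoRepeat) : A.collapse = A := by
  induction A with
  | bang A ih => rw [QType.collapse, ih h.2, QType.bangOnce_of_plain h.1]
  | lolli A B hA hB => rw [QType.collapse, hA h.1, hB h.2]
  | tensor A B hA hB => rw [QType.collapse, hA h.1, hB h.2]
  | _ => rfl

theorem QType.collapse_nbang_succ (n : ℕ) (A : QType κ) :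
    (QType.nbang (n + 1) A).collapse = A.collapse.bangOnce := by
  induction n with
  | zero => rfl
  | succ n ih =>
    rw [QType.nbang, QType.collapse, ih, QType.bangOnce_bangOnce]

/-- A dereliction or promotion at an exponential that is contracted away becomes vacuous; the other
uses of the rules remain. -/
theorem SubType.collapse {A B : QType κ} (h : SubType A B) : SubType A.collapse B.collapse := by
  induction h with
  | @derelict A B h ih =>
    rw [QType.collapse]
    rcases A.collapse.bangOnce_cases with ⟨-, h⟩ | ⟨B, h, h'⟩
    · rw [h]; exact .derelict ih
    · rw [h', ← h]; exact ih
  | @promote A B h ih =>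
    rw [QType.collapse] at ih ⊢
    -- Four cases, according to whether the contractions of `A` and `B` already start with an
    -- exponential. If that of `B` does, the promotion disappears.
    rcases A.collapse.bangOnce_cases with ⟨-, h⟩ | ⟨A', -, h⟩ <;>
    rcases B.collapse.bangOnce_cases with ⟨-, h'⟩ | ⟨B', h'', h'⟩ <;>
    rw [h] at ih ⊢ <;> rw [QType.collapse, h'] <;>
    first | exact .promote ih | (rw [← h'']; exact ih)
  | tensor _ _ h₁ h₂ => exact .tensor h₁ h₂
  | lolli _ _ h₁ h₂ => exact .lolli h₁ h₂
  | _ => exact .refl _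

theorem QType.noRepeat_pow_qbit (n : ℕ) : (QType.qbit.pow n : QType κ).NoRepeat := by
  obtain _ | n := n
  · trivial
  · induction n with
    | zero => trivial
    | succ n ih => exact ⟨trivial, ih⟩

theorem Const.noRepeat_type {G : Type} (arity : G → ℕ) (c : Const G) :
    (c.type κ arity).NoRepeat := by
  cases c with
  | gate g =>
    exact ⟨fun _ => by simp, QType.noRepeat_pow_qbit _, QType.noRepeat_pow_qbit _⟩
  | _ => simp [Const.type, QType.NoRepeat]

end Types

/-! ### Contexts -/

section Contexts

variable {κ : Type}

theorem Split.get_left {Γ Γ₁ Γ₂ : QCtx κ} (h : Split Γ Γ₁ Γ₂) {x : ℕ} {A : QType κ}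
    (hx : Γ₁[x]? = some (some A)) : Γ[x]? = some (some A) := by
  induction h generalizing x with
  | nil => exact hx
  | _ => rename_i ih; cases x <;> simp_all

theorem Split.get_right {Γ Γ₁ Γ₂ : QCtx κ} (h : Split Γ Γ₁ Γ₂) {x : ℕ} {A : QType κ}
    (hx : Γ₂[x]? = some (some A)) : Γ[x]? = some (some A) := by
  induction h generalizing x with
  | nil => exact hx
  | _ => rename_i ih; cases x <;> simp_all

/-- Only the constructor `both` keeps a variable on the two sides. -/
theorem Split.get_both {Γ Γ₁ Γ₂ : QCtx κ} (h : Split Γ Γ₁ Γ₂) {x : ℕ} {A A' : QType κ}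
    (hx : Γ₁[x]? = some (some A)) (hx' : Γ₂[x]? = some (some A')) : ∃ B, A = .bang B := by
  induction h generalizing x with
  | nil => simp at hx
  | both B _ ih =>
    cases x with
    | zero => simp at hx; exact ⟨B, hx.symm⟩
    | succ x => exact ih (by simpa using hx) (by simpa using hx')
  | _ =>
    rename_i ih
    cases x with
    | zero => simp at hx hx'
    | succ x => exact ih (by simpa using hx) (by simpa using hx')

/-- The predicates say which variables each premise needs. Variables needed twice are shared, which
is allowed as their types are exponentials; those not needed on the left are sent to the right. -/
theorem exists_split (Δ : QCtx κ) (p₁ p₂ : ℕ → Prop)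
    (h : ∀ x A, Δ[x]? = some (some A) → p₁ x → p₂ x → ∃ B, A = .bang B) :
    ∃ Δ₁ Δ₂, Split Δ Δ₁ Δ₂ ∧ (∀ x, p₁ x → Δ₁[x]? = Δ[x]?) ∧ (∀ x, p₂ x → Δ₂[x]? = Δ[x]?) := by
  induction Δ generalizing p₁ p₂ with
  | nil => exact ⟨[], [], .nil, by simp, by simp⟩
  | cons o Δ ih =>
    obtain ⟨Δ₁, Δ₂, hs, h₁, h₂⟩ := ih (fun x => p₁ (x + 1)) (fun x => p₂ (x + 1))
      (fun x A hx => h (x + 1) A (by simpa using hx))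
    cases o with
    | none =>
      refine ⟨none :: Δ₁, none :: Δ₂, .none hs, ?_, ?_⟩ <;> rintro (_ | x) hx <;> simp_all
    | some A =>
      by_cases hp₁ : p₁ 0
      · by_cases hp₂ : p₂ 0
        · obtain ⟨B, rfl⟩ := h 0 A rfl hp₁ hp₂
          refine ⟨_, _, .both B hs, ?_, ?_⟩ <;> rintro (_ | x) hx <;> simp_all
        · refine ⟨_, _, .left A hs, ?_, ?_⟩ <;> rintro (_ | x) hx <;> simp_all
      · refine ⟨_, _, .right A hs, ?_, ?_⟩ <;> rintro (_ | x) hx <;> simp_all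

/-- The contexts have the same domain, and subtypes in the first of the types in the second. -/
abbrev QCtx.Sub (Γ Γ' : QCtx κ) : Prop := List.Forall₂ (Option.Rel SubType) Γ Γ'

theorem QCtx.Sub.refl (Γ : QCtx κ) : Γ.Sub Γ := by
  induction Γ with
  | nil => exact .nil
  | cons o Γ ih =>
    cases o with
    | none => exact .cons .none ih
    | some A => exact .cons (.some (.refl A)) ih

theorem QCtx.Sub.get {Γ Γ' : QCtx κ} (h : Γ'.Sub Γ) {x : ℕ} {A : QType κ}
    (hx : Γ[x]? = some (some A)) : ∃ A', Γ'[x]? = some (some A') ∧ SubType A' A := by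
  induction h generalizing x with
  | nil => simp at hx
  | cons h _ ih =>
    cases x with
    | zero =>
      cases h with
      | some h => simp at hx; subst hx; exact ⟨_, rfl, h⟩
      | none => simp at hx
    | succ x => simpa using ih (by simpa using hx)

theorem QCtx.Sub.get' {Γ Γ' : QCtx κ} (h : Γ'.Sub Γ) {x : ℕ} {A' : QType κ}
    (hx : Γ'[x]? = some (some A')) : ∃ A, Γ[x]? = some (some A) ∧ SubType A' A := by
  induction h generalizing x with
  | nil => simp at hx
  | cons h _ ih =>
    cases x with
    | zero =>
      cases h with
      | some h => simp at hx; subst hx; exact ⟨_, rfl, h⟩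
      | none => simp at hx
    | succ x => simpa using ih (by simpa using hx)

/-- A shared variable stays shareable when its type is strengthened, since every subtype of an
exponential is an exponential. -/
theorem Split.sub {Γ Γ₁ Γ₂ Γ' : QCtx κ} (h : Split Γ Γ₁ Γ₂) (h' : Γ'.Sub Γ) :
    ∃ Γ₁' Γ₂', Split Γ' Γ₁' Γ₂' ∧ Γ₁'.Sub Γ₁ ∧ Γ₂'.Sub Γ₂ := by
  induction h generalizing Γ' with
  | nil => cases h'; exact ⟨[], [], .nil, .nil, .nil⟩
  | none _ ih =>
    cases h' with
    | cons h h' =>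
      cases h
      obtain ⟨Γ₁', Γ₂', hs, h₁, h₂⟩ := ih h'
      exact ⟨_, _, .none hs, .cons .none h₁, .cons .none h₂⟩
  | left A _ ih =>
    cases h' with
    | cons h h' =>
      cases h with
      | some h =>
        obtain ⟨Γ₁', Γ₂', hs, h₁, h₂⟩ := ih h'
        exact ⟨_, _, .left _ hs, .cons (.some h) h₁, .cons .none h₂⟩
  | right A _ ih =>
    cases h' with
    | cons h h' =>
      cases h with
      | some h =>
        obtain ⟨Γ₁', Γ₂', hs, h₁, h₂⟩ := ih h'
        exact ⟨_, _, .right _ hs, .cons .none h₁, .cons (.some h) h₂⟩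
  | both A _ ih =>
    cases h' with
    | cons h h' =>
      cases h with
      | some h =>
        obtain ⟨Γ₁', Γ₂', hs, h₁, h₂⟩ := ih h'
        obtain ⟨B, rfl⟩ := h.exists_bang
        exact ⟨_, _, .both _ hs, .cons (.some h) h₁, .cons (.some h) h₂⟩

end Contexts

/-! ### Subsumption, and the admissibility of the extended rules -/

section Admissible

variable {G κ : Type} {arity : G → ℕ}

theorem QDeriv.free_mem {s : RuleSet} {Γ : QCtx κ} {M : Term G} {A : QType κ}
    (q : QDeriv arity s Γ M A) {x : ℕ} (hx : M.Free x) : ∃ B, Γ[x]? = some (some B) := by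
  induction q generalizing x with
  | @ax₁ _ _ B _ h => cases hx; exact ⟨B, h⟩
  | ax₂ => cases hx
  | star => cases hx
  | ite h _ _ _ ihp ihd ihe =>
    rcases hx with hx | hx | hx
    · exact (ihp hx).imp fun _ => h.get_left
    · exact (ihd hx).imp fun _ => h.get_right
    · exact (ihe hx).imp fun _ => h.get_right
  | lam₁ _ ih => simpa using ih (x := x + 1) hx
  | lam₂ _ _ _ ih => simpa using ih (x := x + 1) hx
  | app h _ _ ihd ihe =>
    rcases hx with hx | hx
    · exact (ihd hx).imp fun _ => h.get_left
    · exact (ihe hx).imp fun _ => h.get_right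
  | pair _ h _ _ ihd ihe =>
    rcases hx with hx | hx
    · exact (ihd hx).imp fun _ => h.get_left
    · exact (ihe hx).imp fun _ => h.get_right
  | pair' _ _ _ h _ _ ihd ihe =>
    rcases hx with hx | hx
    · exact (ihd hx).imp fun _ => h.get_left
    · exact (ihe hx).imp fun _ => h.get_right
  | letp _ h _ _ ihd ihe =>
    rcases hx with hx | hx
    · exact (ihd hx).imp fun _ => h.get_left
    · obtain ⟨B, hB⟩ := ihe (x := x + 2) hx
      exact ⟨B, h.get_right (by simpa using hB)⟩
  | letp' _ _ _ h _ _ ihd ihe =>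
    rcases hx with hx | hx
    · exact (ihd hx).imp fun _ => h.get_left
    · obtain ⟨B, hB⟩ := ihe (x := x + 2) hx
      exact ⟨B, h.get_right (by simpa using hB)⟩

theorem SDeriv.free_mem {Γ : SCtx κ} {M : Term G} {U : IType κ}
    (π : SDeriv arity Γ M U) {x : ℕ} (hx : M.Free x) : ∃ V, Γ[x]? = some (some V) := by
  induction π generalizing x with
  | @ax₁ _ _ U h => cases hx; exact ⟨U, h⟩
  | ax₂ => cases hx
  | star => cases hx
  | ite _ _ _ ihp ihd ihe => exact hx.elim ihp fun hx => hx.elim ihd ihe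
  | lam _ ih => simpa using ih (x := x + 1) hx
  | app _ _ ihd ihe => exact hx.elim ihd ihe
  | pair _ _ ihd ihe => exact hx.elim ihd ihe
  | letp _ _ ihd ihe => exact hx.elim ihd fun hx => by simpa using ihe (x := x + 2) hx

theorem Promotable.sub {Γ Γ' : QCtx κ} {M : Term G} (h : Promotable Γ M) (h' : Γ'.Sub Γ) :
    Promotable Γ' M := by
  intro x A hx hM
  obtain ⟨B, hB, hAB⟩ := h'.get' hx
  obtain ⟨C, rfl⟩ := h x B hB hM
  exact hAB.exists_bang

/-- Subsumption is admissible: types of variables may be strengthened and the type of the term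
may be weakened. -/
theorem QDeriv.subsume {Γ : QCtx κ} {M : Term G} {A : QType κ}
    (q : QDeriv arity .basic Γ M A) {Γ' : QCtx κ} {C : QType κ} (hΓ : Γ'.Sub Γ)
    (hC : SubType A C) : Nonempty (QDeriv arity .basic Γ' M C) := by
  induction q generalizing Γ' C with
  | ax₁ hx h =>
    obtain ⟨A', hx', h'⟩ := hΓ.get hx
    exact ⟨.ax₁ hx' (h'.trans (h.trans hC))⟩
  | ax₂ h => exact ⟨.ax₂ (h.trans hC)⟩
  | star n => obtain ⟨m, rfl⟩ := nbang_top_subType hC; exact ⟨.star m⟩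
  | ite h _ _ _ ihp ihd ihe =>
    obtain ⟨Γ₁', Γ₂', hs, h₁, h₂⟩ := h.sub hΓ
    obtain ⟨p⟩ := ihp h₁ (.refl _)
    obtain ⟨d⟩ := ihd h₂ hC
    obtain ⟨e⟩ := ihe h₂ hC
    exact ⟨.ite hs p d e⟩
  | app h _ _ ihd ihe =>
    obtain ⟨Γ₁', Γ₂', hs, h₁, h₂⟩ := h.sub hΓ
    obtain ⟨d⟩ := ihd h₁ (.lolli (.refl _) hC)
    obtain ⟨e⟩ := ihe h₂ (.refl _)
    exact ⟨.app hs d e⟩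
  | lam₁ _ ih =>
    obtain ⟨m, A', B', rfl, hA, hB, hm⟩ := nbang_lolli_subType (n := 0) hC
    cases hm rfl
    obtain ⟨d⟩ := ih (.cons (.some hA) hΓ) hB
    exact ⟨.lam₁ d⟩
  | lam₂ n h _ ih =>
    obtain ⟨m, A', B', rfl, hA, hB, -⟩ := nbang_lolli_subType hC
    obtain ⟨d⟩ := ih (.cons (.some hA) hΓ) hB
    -- Subsumption may remove all exponentials, and then the rule for linear abstraction takes over.
    cases m with
    | zero => exact ⟨.lam₁ d⟩
    | succ m => exact ⟨.lam₂ m (h.sub hΓ) d⟩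
  | pair n h _ _ ihd ihe =>
    obtain ⟨Γ₁', Γ₂', hs, h₁, h₂⟩ := h.sub hΓ
    -- The passage from `n` to `m` exponentials is performed on both components as well, as the pair
    -- rule uses the same number in all three places.
    obtain ⟨m, A', B', rfl, hA, hB, hm⟩ := nbang_tensor_subType hC
    obtain ⟨d⟩ := ihd h₁ (nbang_subType_nbang hA hm)
    obtain ⟨e⟩ := ihe h₂ (nbang_subType_nbang hB hm)
    exact ⟨.pair m hs d e⟩
  | letp n h _ _ ihd ihe =>
    obtain ⟨Γ₁', Γ₂', hs, h₁, h₂⟩ := h.sub hΓ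
    obtain ⟨d⟩ := ihd h₁ (.refl _)
    obtain ⟨e⟩ := ihe (.cons (.some (.refl _)) (.cons (.some (.refl _)) h₂)) hC
    exact ⟨.letp n hs d e⟩
  | pair' hs => cases hs
  | letp' hs => cases hs

/-- With the next lemma: below an exponential, further exponentials are immaterial up to mutual
subtyping. This is the whole difference between the primed rules and the basic rules with `n = 1`.
-/
theorem bang_subType_bang_nbang (A : QType κ) (n : ℕ) :
    SubType (.bang A) (.bang (.nbang n A)) :=
  nbang_subType_nbang (n := 1) (m := n + 1) (.refl A) (by simp)

theorem bang_nbang_subType_bang (A : QType κ) (n : ℕ) :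
    SubType (.bang (.nbang n A)) (.bang A) :=
  nbang_subType_nbang (n := n + 1) (m := 1) (.refl A) (by simp)

/-- The extended rules are admissible in the basic system. -/
theorem QDeriv.basic_of_extended {s : RuleSet} {Γ : QCtx κ} {M : Term G} {A : QType κ}
    (q : QDeriv arity s Γ M A) : Nonempty (QDeriv arity .basic Γ M A) := by
  induction q with
  | ax₁ hx h => exact ⟨.ax₁ hx h⟩
  | ax₂ h => exact ⟨.ax₂ h⟩
  | star n => exact ⟨.star n⟩
  | ite h _ _ _ ihp ihd ihe =>
    obtain ⟨p⟩ := ihp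
    obtain ⟨d⟩ := ihd
    obtain ⟨e⟩ := ihe
    exact ⟨.ite h p d e⟩
  | app h _ _ ihd ihe => obtain ⟨d⟩ := ihd; obtain ⟨e⟩ := ihe; exact ⟨.app h d e⟩
  | lam₁ _ ih => obtain ⟨d⟩ := ih; exact ⟨.lam₁ d⟩
  | lam₂ n h _ ih => obtain ⟨d⟩ := ih; exact ⟨.lam₂ n h d⟩
  | pair n h _ _ ihd ihe => obtain ⟨d⟩ := ihd; obtain ⟨e⟩ := ihe; exact ⟨.pair n h d e⟩
  | letp n h _ _ ihd ihe => obtain ⟨d⟩ := ihd; obtain ⟨e⟩ := ihe; exact ⟨.letp n h d e⟩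
  | pair' _ τ σ h _ _ ihd ihe =>
    obtain ⟨d⟩ := ihd
    obtain ⟨e⟩ := ihe
    obtain ⟨d⟩ := d.subsume (QCtx.Sub.refl _) (bang_subType_bang_nbang _ τ)
    obtain ⟨e⟩ := e.subsume (QCtx.Sub.refl _) (bang_subType_bang_nbang _ σ)
    exact ⟨.pair 1 h d e⟩
  | letp' _ τ σ h _ _ ihd ihe =>
    obtain ⟨d⟩ := ihd
    obtain ⟨e⟩ := ihe
    obtain ⟨e⟩ := e.subsume (.cons (.some (bang_nbang_subType_bang _ τ))
      (.cons (.some (bang_nbang_subType_bang _ σ)) (QCtx.Sub.refl _))) (.refl _)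
    exact ⟨.letp 1 h d e⟩

end Admissible

/-! ### Quantum derivations over a simply-typed derivation -/

section Over

variable {G κ : Type} {arity : G → ℕ} {s : RuleSet}

/-- The quantum derivation `q` is a decoration of `π`, up to a restriction of the contexts. -/
def QDeriv.Over {Γ : QCtx κ} {M : Term G} {A : QType κ} (q : QDeriv arity s Γ M A)
    {Γ' : SCtx κ} {U : IType κ} (π : SDeriv arity Γ' M U) : Prop :=
  ∃ (hΓ : SCtx.Le Γ.skel Γ') (hU : A.skel = U), q.skelOver Γ' U hΓ hU = π

/-- Premises of a quantum rule have smaller contexts than the premises of the simply-typed rule.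
Inductions therefore run on `Over`, and equality of the contexts is only imposed at the root. -/
theorem QDeriv.isDecoration_iff {Γ : QCtx κ} {M : Term G} {A : QType κ}
    {q : QDeriv arity s Γ M A} {Γ' : SCtx κ} {U : IType κ} {π : SDeriv arity Γ' M U} :
    q.IsDecoration π ↔ Γ.skel = Γ' ∧ q.Over π := by
  constructor
  · rintro ⟨hΓ, hU, h⟩
    exact ⟨hΓ, _, hU, h⟩
  · rintro ⟨hΓ, _, hU, h⟩
    exact ⟨hΓ, hU, h⟩

variable {Γ Γ₁ Γ₂ : QCtx κ} {Γ' : SCtx κ} {P M N : Term G} {A B C : QType κ} {U V W : IType κ}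

theorem QDeriv.Over.le {q : QDeriv arity s Γ M A} {π : SDeriv arity Γ' M U} (h : q.Over π) :
    SCtx.Le Γ.skel Γ' := h.1

theorem QDeriv.Over.skel_eq {q : QDeriv arity s Γ M A} {π : SDeriv arity Γ' M U}
    (h : q.Over π) : A.skel = U := h.2.1

theorem SCtx.Le.of_cons {o o' : Option (IType κ)} {Γ Γ' : SCtx κ}
    (h : SCtx.Le (o :: Γ) (o' :: Γ')) : SCtx.Le Γ Γ' :=
  fun x U hx => by simpa using h (x + 1) U (by simpa using hx)

theorem SCtx.Le.head_eq {U V : IType κ} {Γ Γ' : SCtx κ}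
    (h : SCtx.Le (some U :: Γ) (some V :: Γ')) : U = V := by
  simpa using (h 0 U rfl).symm

/-! ### Inversion of `Over`, one rule at a time -/

theorem over_ax₁ {x : ℕ} {hx : Γ[x]? = some (some A)} {h : SubType A B}
    {hx' : Γ'[x]? = some (some U)} :
    (QDeriv.ax₁ (arity := arity) (s := s) hx h).Over (.ax₁ hx') ↔
      SCtx.Le Γ.skel Γ' ∧ B.skel = U :=
  ⟨fun h => ⟨h.1, h.2.1⟩, fun h => ⟨h.1, h.2, rfl⟩⟩

theorem over_ax₂ {c : Const G} {h : SubType (c.type κ arity) B}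
    {h' : (c.type κ arity).skel = U} :
    (QDeriv.ax₂ (Γ := Γ) (s := s) h).Over (SDeriv.ax₂ (Γ := Γ') h') ↔ SCtx.Le Γ.skel Γ' :=
  ⟨fun h => h.1, fun hΓ => ⟨hΓ, h.skel_eq.symm.trans h', rfl⟩⟩

theorem over_star {n : ℕ} :
    (QDeriv.star (arity := arity) (Γ := Γ) (s := s) n).Over (SDeriv.star (Γ := Γ')) ↔
      SCtx.Le Γ.skel Γ' :=
  ⟨fun h => h.1, fun hΓ => ⟨hΓ, QType.skel_nbang n _, rfl⟩⟩

theorem over_ite {h : Split Γ Γ₁ Γ₂} {p : QDeriv arity s Γ₁ P .bit} {d : QDeriv arity s Γ₂ M A}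
    {e : QDeriv arity s Γ₂ N A} {p' : SDeriv arity Γ' P .bit} {d' : SDeriv arity Γ' M U}
    {e' : SDeriv arity Γ' N U} :
    (QDeriv.ite h p d e).Over (.ite p' d' e') ↔
      SCtx.Le Γ.skel Γ' ∧ p.Over p' ∧ d.Over d' ∧ e.Over e' := by
  constructor
  · rintro ⟨hΓ, hU, hq⟩
    simp only [QDeriv.skelOver, SDeriv.ite.injEq] at hq
    exact ⟨hΓ, ⟨_, _, hq.1⟩, ⟨_, _, hq.2.1⟩, ⟨_, _, hq.2.2⟩⟩
  · rintro ⟨hΓ, ⟨_, _, rfl⟩, ⟨_, hU, rfl⟩, ⟨_, _, rfl⟩⟩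
    exact ⟨hΓ, hU, rfl⟩

theorem over_app {h : Split Γ Γ₁ Γ₂} {d : QDeriv arity s Γ₁ M (.lolli A B)}
    {e : QDeriv arity s Γ₂ N A} {d' : SDeriv arity Γ' M (.arrow U V)}
    {e' : SDeriv arity Γ' N U} :
    (QDeriv.app h d e).Over (.app d' e') ↔ SCtx.Le Γ.skel Γ' ∧ d.Over d' ∧ e.Over e' := by
  constructor
  · rintro ⟨hΓ, hU, hq⟩
    -- The argument type is not visible in the conclusion, so injectivity yields it together with
    -- heterogeneous equalities, which become ordinary ones once the types are identified.
    simp only [QDeriv.skelOver, SDeriv.app.injEq] at hq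
    obtain ⟨rfl, h1, h2⟩ := hq
    exact ⟨hΓ, ⟨_, _, eq_of_heq h1⟩, ⟨_, _, eq_of_heq h2⟩⟩
  · rintro ⟨hΓ, ⟨_, hU, rfl⟩, ⟨_, rfl, rfl⟩⟩
    exact ⟨hΓ, (IType.arrow.inj hU).2, rfl⟩

theorem over_lam₁ {d : QDeriv arity s (some A :: Γ) M B} {d' : SDeriv arity (some U :: Γ') M V} :
    (QDeriv.lam₁ d).Over (.lam d') ↔ d.Over d' := by
  constructor
  · rintro ⟨hΓ, hU, hq⟩
    -- Once the skeletons agree definitionally, the cast in `skelOver` is trivial.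
    obtain ⟨rfl, rfl⟩ := IType.arrow.inj hU
    exact ⟨hΓ.cons _, rfl, SDeriv.lam.inj hq⟩
  · rintro ⟨hΓ, rfl, rfl⟩
    obtain rfl := hΓ.head_eq
    exact ⟨hΓ.of_cons, rfl, rfl⟩

theorem over_lam₂ {n : ℕ} {h : Promotable Γ M} {d : QDeriv arity s (some A :: Γ) M B}
    {d' : SDeriv arity (some U :: Γ') M V} :
    (QDeriv.lam₂ n h d).Over (.lam d') ↔ d.Over d' := by
  constructor
  · rintro ⟨hΓ, hU, hq⟩
    obtain ⟨rfl, rfl⟩ := IType.arrow.inj ((QType.skel_nbang (n + 1) _).symm.trans hU)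
    exact ⟨hΓ.cons _, rfl, SDeriv.lam.inj hq⟩
  · rintro ⟨hΓ, rfl, rfl⟩
    obtain rfl := hΓ.head_eq
    exact ⟨hΓ.of_cons, QType.skel_nbang (n + 1) _, rfl⟩

theorem over_pair {n : ℕ} {h : Split Γ Γ₁ Γ₂} {d : QDeriv arity s Γ₁ M (.nbang n A)}
    {e : QDeriv arity s Γ₂ N (.nbang n B)} {d' : SDeriv arity Γ' M U}
    {e' : SDeriv arity Γ' N V} :
    (QDeriv.pair n h d e).Over (.pair d' e') ↔ SCtx.Le Γ.skel Γ' ∧ d.Over d' ∧ e.Over e' := by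
  constructor
  · rintro ⟨hΓ, hU, hq⟩
    obtain ⟨rfl, rfl⟩ := IType.prod.inj ((QType.skel_nbang n _).symm.trans hU)
    obtain ⟨h1, h2⟩ := SDeriv.pair.inj hq
    exact ⟨hΓ, ⟨_, _, h1⟩, ⟨_, _, h2⟩⟩
  · rintro ⟨hΓ, ⟨_, hU, rfl⟩, ⟨_, hV, rfl⟩⟩
    obtain rfl := (QType.skel_nbang n _).symm.trans hU
    obtain rfl := (QType.skel_nbang n _).symm.trans hV
    exact ⟨hΓ, QType.skel_nbang n _, rfl⟩

theorem over_pair' {hs : s = .extended} {τ σ : Fin 2} {h : Split Γ Γ₁ Γ₂}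
    {d : QDeriv arity s Γ₁ M (.bang A)} {e : QDeriv arity s Γ₂ N (.bang B)}
    {d' : SDeriv arity Γ' M U} {e' : SDeriv arity Γ' N V} :
    (QDeriv.pair' hs τ σ h d e).Over (.pair d' e') ↔
      SCtx.Le Γ.skel Γ' ∧ d.Over d' ∧ e.Over e' := by
  constructor
  · rintro ⟨hΓ, hU, hq⟩
    have hU' : IType.prod A.skel B.skel = .prod U V := by
      rw [← hU, ← QType.skel_nbang τ A, ← QType.skel_nbang σ B]; rfl
    obtain ⟨rfl, rfl⟩ := IType.prod.inj hU'
    obtain ⟨h1, h2⟩ := SDeriv.pair.inj hq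
    exact ⟨hΓ, ⟨_, _, h1⟩, ⟨_, _, h2⟩⟩
  · rintro ⟨hΓ, ⟨_, rfl, rfl⟩, ⟨_, rfl, rfl⟩⟩
    refine ⟨hΓ, ?_, rfl⟩
    simp only [QType.skel, QType.skel_nbang]

theorem over_letp {n : ℕ} {h : Split Γ Γ₁ Γ₂} {d : QDeriv arity s Γ₁ M (.nbang n (.tensor A B))}
    {e : QDeriv arity s (some (.nbang n A) :: some (.nbang n B) :: Γ₂) N C}
    {d' : SDeriv arity Γ' M (.prod U V)} {e' : SDeriv arity (some U :: some V :: Γ') N W} :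
    (QDeriv.letp n h d e).Over (.letp d' e') ↔ SCtx.Le Γ.skel Γ' ∧ d.Over d' ∧ e.Over e' := by
  constructor
  · rintro ⟨hΓ, hU, hq⟩
    simp only [QDeriv.skelOver, SDeriv.letp.injEq] at hq
    obtain ⟨rfl, rfl, h1, h2⟩ := hq
    exact ⟨hΓ, ⟨_, _, eq_of_heq h1⟩, ⟨_, _, eq_of_heq h2⟩⟩
  · rintro ⟨hΓ, ⟨_, hU, rfl⟩, ⟨_, hW, rfl⟩⟩
    obtain ⟨rfl, rfl⟩ := IType.prod.inj ((QType.skel_nbang n _).symm.trans hU)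
    exact ⟨hΓ, hW, rfl⟩

theorem over_letp' {hs : s = .extended} {τ σ : Fin 2} {h : Split Γ Γ₁ Γ₂}
    {d : QDeriv arity s Γ₁ M (.bang (.tensor (.nbang τ A) (.nbang σ B)))}
    {e : QDeriv arity s (some (.bang A) :: some (.bang B) :: Γ₂) N C}
    {d' : SDeriv arity Γ' M (.prod U V)} {e' : SDeriv arity (some U :: some V :: Γ') N W} :
    (QDeriv.letp' hs τ σ h d e).Over (.letp d' e') ↔
      SCtx.Le Γ.skel Γ' ∧ d.Over d' ∧ e.Over e' := by
  constructor
  · rintro ⟨hΓ, hU, hq⟩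
    simp only [QDeriv.skelOver, SDeriv.letp.injEq] at hq
    obtain ⟨rfl, rfl, h1, h2⟩ := hq
    exact ⟨hΓ, ⟨_, _, eq_of_heq h1⟩, ⟨_, _, eq_of_heq h2⟩⟩
  · rintro ⟨hΓ, ⟨_, hU, rfl⟩, ⟨_, hW, rfl⟩⟩
    have hU' : IType.prod A.skel B.skel = .prod U V := by
      rw [← hU, ← QType.skel_nbang τ A, ← QType.skel_nbang σ B]; rfl
    obtain ⟨rfl, rfl⟩ := IType.prod.inj hU'
    exact ⟨hΓ, hW, rfl⟩

end Over

/-! ### Existence of decorations -/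

section Decorations

variable {G κ : Type} {arity : G → ℕ}

theorem QCtx.skel_le_cons {Γ : QCtx κ} {Γ' : SCtx κ} (h : SCtx.Le Γ.skel Γ') {A : QType κ}
    {U : IType κ} (hA : A.skel = U) : SCtx.Le (QCtx.skel (some A :: Γ)) (some U :: Γ') := by
  subst hA
  exact h.cons (some A.skel)

/-- On the variables that satisfy `p`, the types in `Δ` are those in `Γ`, transported to the
skeletons in `Γ'`. -/
def QCtx.MergeOn (p : ℕ → Prop) (Γ : QCtx κ) (Γ' : SCtx κ) (Δ : QCtx κ) : Prop :=
  ∀ x A, p x → Γ[x]? = some (some A) →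
    ∃ U, Γ'[x]? = some (some U) ∧ Δ[x]? = some (some (A.merge U))

theorem QCtx.MergeOn.cons {p q : ℕ → Prop} {Γ Δ : QCtx κ} {Γ' : SCtx κ}
    (h : QCtx.MergeOn p Γ Γ' Δ) (hq : ∀ x, q (x + 1) → p x) (A : QType κ) (U : IType κ) :
    QCtx.MergeOn q (some A :: Γ) (some U :: Γ') (some (A.merge U) :: Δ) := by
  intro x B hx hB
  cases x with
  | zero => obtain rfl : A = B := by simpa using hB
            exact ⟨U, rfl, rfl⟩
  | succ x => simpa using h x B (hq x hx) (by simpa using hB)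

/-- The new context is not split along `Γ₁` and `Γ₂` but by need. A variable needed by both premises
is present in both parts of `Γ`, so it has an exponential type there, and `merge` keeps the
outermost exponential. -/
theorem QCtx.MergeOn.split {p₁ p₂ : ℕ → Prop} {Γ Γ₁ Γ₂ Δ : QCtx κ} {Γ' : SCtx κ}
    (h : QCtx.MergeOn (fun x => p₁ x ∨ p₂ x) Γ Γ' Δ) (hs : Split Γ Γ₁ Γ₂)
    (h₁ : ∀ x, p₁ x → ∃ A, Γ₁[x]? = some (some A)) (h₂ : ∀ x, p₂ x → ∃ A, Γ₂[x]? = some (some A)) :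
    ∃ Δ₁ Δ₂, Split Δ Δ₁ Δ₂ ∧ QCtx.MergeOn p₁ Γ₁ Γ' Δ₁ ∧ QCtx.MergeOn p₂ Γ₂ Γ' Δ₂ := by
  obtain ⟨Δ₁, Δ₂, hΔ, e₁, e₂⟩ := exists_split Δ p₁ p₂ (by
    intro x A hA hx₁ hx₂
    obtain ⟨B, hB⟩ := h₁ x hx₁
    obtain ⟨B', hB'⟩ := h₂ x hx₂
    obtain ⟨C, rfl⟩ := hs.get_both hB hB'
    obtain ⟨U, -, hU⟩ := h x _ (.inl hx₁) (hs.get_left hB)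
    obtain rfl := Option.some.inj (Option.some.inj (hA.symm.trans hU))
    exact ⟨C.merge U, by rw [QType.merge]⟩)
  refine ⟨Δ₁, Δ₂, hΔ, ?_, ?_⟩
  · intro x A hx hA
    rw [e₁ x hx]
    exact h x A (.inl hx) (hs.get_left hA)
  · intro x A hx hA
    rw [e₂ x hx]
    exact h x A (.inr hx) (hs.get_right hA)

theorem QCtx.MergeOn.mono {p q : ℕ → Prop} {Γ Δ : QCtx κ} {Γ' : SCtx κ}
    (h : QCtx.MergeOn p Γ Γ' Δ) (hq : ∀ x, q x → p x) : QCtx.MergeOn q Γ Γ' Δ :=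
  fun x A hx => h x A (hq x hx)

/-- Any basic quantum derivation of `M` can be transported to any simply-typed derivation
of `M`. -/
theorem QDeriv.exists_over {Γ : QCtx κ} {M : Term G} {A : QType κ}
    (q : QDeriv arity .basic Γ M A) {Γ' : SCtx κ} {U : IType κ} (π : SDeriv arity Γ' M U)
    {Δ : QCtx κ} (hle : SCtx.Le Δ.skel Γ') (hΔ : QCtx.MergeOn M.Free Γ Γ' Δ) :
    ∃ q' : QDeriv arity .basic Δ M (A.merge U), q'.Over π := by
  induction q generalizing Γ' U Δ with
  | @ax₁ Γ x A B hx h =>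
    cases π with
    | ax₁ hx' =>
      obtain ⟨V, hV, hV'⟩ := hΔ x A rfl hx
      obtain rfl := Option.some.inj (Option.some.inj (hx'.symm.trans hV))
      exact ⟨.ax₁ hV' (h.merge U), over_ax₁.2 ⟨hle, QType.skel_merge _ _⟩⟩
  | ax₂ h =>
    cases π with
    | ax₂ h' =>
      -- The type of the constant already has skeleton `U`, so merging leaves it unchanged.
      have h1 := h.merge U
      rw [← h', QType.merge_skel, h'] at h1
      exact ⟨.ax₂ h1, over_ax₂.2 hle⟩
  | star n =>
    cases π with
    | star =>
      rw [QType.merge_nbang]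
      exact ⟨.star n, over_star.2 hle⟩
  | ite h p d e ihp ihd ihe =>
    cases π with
    | ite p' d' e' =>
      -- The two branches share one context, so the second predicate collects the free variables of
      -- both.
      obtain ⟨Δ₁, Δ₂, hs, h₁, h₂⟩ := QCtx.MergeOn.split (p₁ := Term.Free _) (p₂ := fun x => _ ∨ _)
        hΔ h (fun x => p.free_mem) (fun x hx => hx.elim d.free_mem e.free_mem)
      obtain ⟨p₁, hp⟩ := ihp p' (hs.le_left.trans hle) h₁
      obtain ⟨d₁, hd⟩ := ihd d' (hs.le_right.trans hle) (h₂.mono fun _ => .inl)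
      obtain ⟨e₁, he⟩ := ihe e' (hs.le_right.trans hle) (h₂.mono fun _ => .inr)
      exact ⟨.ite hs p₁ d₁ e₁, over_ite.2 ⟨hle, hp, hd, he⟩⟩
  | app h d e ihd ihe =>
    cases π with
    | app d' e' =>
      obtain ⟨Δ₁, Δ₂, hs, h₁, h₂⟩ := QCtx.MergeOn.split hΔ h (fun x => d.free_mem)
        (fun x => e.free_mem)
      have hd := ihd d' (hs.le_left.trans hle) h₁
      -- The argument type `U` of the given derivation need not be the skeleton of `A`; it is
      -- replaced by `A.merge U` consistently in the function and in the argument.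
      simp only [QType.merge] at hd
      obtain ⟨d₁, hd⟩ := hd
      obtain ⟨e₁, he⟩ := ihe e' (hs.le_right.trans hle) h₂
      exact ⟨.app hs d₁ e₁, over_app.2 ⟨hle, hd, he⟩⟩
  | @lam₁ _ _ A B d ih =>
    cases π with
    | @lam _ _ U V d' =>
      obtain ⟨d₁, hd⟩ := ih d' (QCtx.skel_le_cons hle (QType.skel_merge A U))
        (hΔ.cons (fun _ h => h) A U)
      simp only [QType.merge]
      exact ⟨.lam₁ d₁, over_lam₁.2 hd⟩
  | @lam₂ _ _ A B n h d ih =>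
    cases π with
    | @lam _ _ U V d' =>
      obtain ⟨d₁, hd⟩ := ih d' (QCtx.skel_le_cons hle (QType.skel_merge A U))
        (hΔ.cons (fun _ h => h) A U)
      rw [QType.merge_nbang]
      simp only [QType.merge]
      refine ⟨.lam₂ n ?_ d₁, over_lam₂.2 hd⟩
      -- A free variable of the body had an exponential type in the old context, and its new type is
      -- a merge of that one.
      intro x C hC hx
      obtain ⟨D, hD⟩ := d.free_mem hx
      obtain ⟨E, rfl⟩ := h x D (by simpa using hD) hx
      obtain ⟨W, -, hW⟩ := hΔ x _ hx (by simpa using hD)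
      obtain rfl := Option.some.inj (Option.some.inj (hC.symm.trans hW))
      exact ⟨E.merge W, by rw [QType.merge]⟩
  | pair n h d e ihd ihe =>
    cases π with
    | pair d' e' =>
      obtain ⟨Δ₁, Δ₂, hs, h₁, h₂⟩ := QCtx.MergeOn.split hΔ h (fun x => d.free_mem)
        (fun x => e.free_mem)
      have hd := ihd d' (hs.le_left.trans hle) h₁
      have he := ihe e' (hs.le_right.trans hle) h₂
      rw [QType.merge_nbang] at hd he ⊢
      simp only [QType.merge]
      obtain ⟨d₁, hd⟩ := hd
      obtain ⟨e₁, he⟩ := he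
      exact ⟨.pair n hs d₁ e₁, over_pair.2 ⟨hle, hd, he⟩⟩
  | @letp _ _ _ _ _ A B C n h d e ihd ihe =>
    cases π with
    | @letp _ _ _ U V _ d' e' =>
      obtain ⟨Δ₁, Δ₂, hs, h₁, h₂⟩ := QCtx.MergeOn.split (p₂ := fun x => Term.Free _ (x + 2)) hΔ h
        (fun x => d.free_mem) (fun x hx => by simpa using e.free_mem hx)
      have hd := ihd d' (hs.le_left.trans hle) h₁
      rw [QType.merge_nbang] at hd
      simp only [QType.merge] at hd
      obtain ⟨d₁, hd⟩ := hd
      have hm := (h₂.cons (q := fun x => Term.Free _ (x + 1)) (fun _ h => h) (.nbang n B) V).cons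
        (q := Term.Free _) (fun _ h => h) (.nbang n A) U
      have he := ihe e' (QCtx.skel_le_cons (QCtx.skel_le_cons (hs.le_right.trans hle)
        (QType.skel_merge (.nbang n B) V)) (QType.skel_merge (.nbang n A) U)) hm
      rw [QType.merge_nbang, QType.merge_nbang] at he
      obtain ⟨e₁, he⟩ := he
      exact ⟨.letp n hs d₁ e₁, over_letp.2 ⟨hle, hd, he⟩⟩
  | pair' hs => cases hs
  | letp' hs => cases hs

/-- The context with the skeleton `Γ'` whose exponentials are those of `Γ`. -/
def QCtx.merge (Γ : QCtx κ) (Γ' : SCtx κ) : QCtx κ :=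
  Γ'.mapIdx fun x o => o.map fun U =>
    match Γ[x]? with
    | some (some A) => A.merge U
    | _ => U.embed

theorem QCtx.skel_merge (Γ : QCtx κ) (Γ' : SCtx κ) : (Γ.merge Γ').skel = Γ' := by
  apply List.ext_getElem?
  intro x
  simp only [QCtx.merge, QCtx.skel, List.getElem?_map, List.getElem?_mapIdx, Option.map_map]
  rcases h : Γ'[x]? with _ | _ | U
  · rfl
  · rfl
  · simp only [Option.map_some, Function.comp]
    rcases Γ[x]? with _ | _ | A <;> simp [IType.skel_embed, QType.skel_merge]

/-- Every simply-typed derivation of a quantum typable term has a basic decoration. -/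
theorem QTypable.exists_isDecoration {Γ : SCtx κ} {M : Term G} {U : IType κ}
    (h : QTypable κ arity M) (π : SDeriv arity Γ M U) :
    ∃ (Δ : QCtx κ) (A : QType κ) (q : QDeriv arity .basic Δ M A), q.IsDecoration π := by
  obtain ⟨Γ₀, A₀, ⟨q⟩⟩ := h
  have hsk := QCtx.skel_merge Γ₀ Γ
  -- The free variables of `M` are declared both in `Γ` and in `Γ₀`. Variables of `Γ` that `Γ₀`
  -- lacks receive a type without exponentials.
  obtain ⟨q', hq'⟩ := q.exists_over π (Δ := Γ₀.merge Γ) (by rw [hsk]; exact fun _ _ h => h) (by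
    intro x A hx hA
    obtain ⟨V, hV⟩ := π.free_mem hx
    exact ⟨V, hV, by simp [QCtx.merge, hV, hA]⟩)
  exact ⟨_, _, q', QDeriv.isDecoration_iff.2 ⟨hsk, hq'⟩⟩

/-! ### Decorations without repeated exponentials -/

/-- The context has no types with repeated exponentials. -/
def QCtx.NoRepeat (Γ : QCtx κ) : Prop := ∀ B : QType κ, some B ∈ Γ → B.NoRepeat

variable {s : RuleSet} {Γ Γ₁ Γ₂ : QCtx κ} {P M N : Term G} {A B C : QType κ}

theorem QDeriv.NoRepeat.root {q : QDeriv arity s Γ M A} (h : q.NoRepeat) :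
    Γ.NoRepeat ∧ A.NoRepeat :=
  h (Γ, M, A) (by cases q <;> exact List.mem_cons_self)

theorem noRepeat_ax₁ {x : ℕ} {hx : Γ[x]? = some (some A)} {h : SubType A B} :
    (QDeriv.ax₁ (arity := arity) (s := s) hx h).NoRepeat ↔ Γ.NoRepeat ∧ B.NoRepeat := by
  simp [QDeriv.NoRepeat, QDeriv.judgements, QCtx.NoRepeat]

theorem noRepeat_ax₂ {c : Const G} {h : SubType (c.type κ arity) B} :
    (QDeriv.ax₂ (Γ := Γ) (s := s) h).NoRepeat ↔ Γ.NoRepeat ∧ B.NoRepeat := by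
  simp [QDeriv.NoRepeat, QDeriv.judgements, QCtx.NoRepeat]

theorem noRepeat_star {n : ℕ} :
    (QDeriv.star (arity := arity) (Γ := Γ) (s := s) n).NoRepeat ↔
      Γ.NoRepeat ∧ (QType.nbang n (.top : QType κ)).NoRepeat := by
  simp [QDeriv.NoRepeat, QDeriv.judgements, QCtx.NoRepeat]

theorem noRepeat_ite {h : Split Γ Γ₁ Γ₂} {p : QDeriv arity s Γ₁ P .bit}
    {d : QDeriv arity s Γ₂ M A} {e : QDeriv arity s Γ₂ N A} :
    (QDeriv.ite h p d e).NoRepeat ↔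
      (Γ.NoRepeat ∧ A.NoRepeat) ∧ p.NoRepeat ∧ d.NoRepeat ∧ e.NoRepeat := by
  simp only [QDeriv.NoRepeat, QDeriv.judgements, QCtx.NoRepeat, List.forall_mem_cons,
    List.forall_mem_append, and_assoc]

theorem noRepeat_app {h : Split Γ Γ₁ Γ₂} {d : QDeriv arity s Γ₁ M (.lolli A B)}
    {e : QDeriv arity s Γ₂ N A} :
    (QDeriv.app h d e).NoRepeat ↔ (Γ.NoRepeat ∧ B.NoRepeat) ∧ d.NoRepeat ∧ e.NoRepeat := by
  simp only [QDeriv.NoRepeat, QDeriv.judgements, QCtx.NoRepeat, List.forall_mem_cons,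
    List.forall_mem_append, and_assoc]

theorem noRepeat_lam₁ {d : QDeriv arity s (some A :: Γ) M B} :
    (QDeriv.lam₁ d).NoRepeat ↔ (Γ.NoRepeat ∧ (QType.lolli A B).NoRepeat) ∧ d.NoRepeat := by
  simp only [QDeriv.NoRepeat, QDeriv.judgements, QCtx.NoRepeat, List.forall_mem_cons, and_assoc]

theorem noRepeat_lam₂ {n : ℕ} {h : Promotable Γ M} {d : QDeriv arity s (some A :: Γ) M B} :
    (QDeriv.lam₂ n h d).NoRepeat ↔
      (Γ.NoRepeat ∧ (QType.nbang (n + 1) (QType.lolli A B)).NoRepeat) ∧ d.NoRepeat := by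
  simp only [QDeriv.NoRepeat, QDeriv.judgements, QCtx.NoRepeat, List.forall_mem_cons, and_assoc]

theorem noRepeat_pair {n : ℕ} {h : Split Γ Γ₁ Γ₂} {d : QDeriv arity s Γ₁ M (.nbang n A)}
    {e : QDeriv arity s Γ₂ N (.nbang n B)} :
    (QDeriv.pair n h d e).NoRepeat ↔
      (Γ.NoRepeat ∧ (QType.nbang n (.tensor A B)).NoRepeat) ∧ d.NoRepeat ∧ e.NoRepeat := by
  simp only [QDeriv.NoRepeat, QDeriv.judgements, QCtx.NoRepeat, List.forall_mem_cons,
    List.forall_mem_append, and_assoc]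

theorem noRepeat_letp {n : ℕ} {h : Split Γ Γ₁ Γ₂}
    {d : QDeriv arity s Γ₁ M (.nbang n (.tensor A B))}
    {e : QDeriv arity s (some (.nbang n A) :: some (.nbang n B) :: Γ₂) N C} :
    (QDeriv.letp n h d e).NoRepeat ↔ (Γ.NoRepeat ∧ C.NoRepeat) ∧ d.NoRepeat ∧ e.NoRepeat := by
  simp only [QDeriv.NoRepeat, QDeriv.judgements, QCtx.NoRepeat, List.forall_mem_cons,
    List.forall_mem_append, and_assoc]

theorem noRepeat_pair' {hs : s = .extended} {τ σ : Fin 2} {h : Split Γ Γ₁ Γ₂}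
    {d : QDeriv arity s Γ₁ M (.bang A)} {e : QDeriv arity s Γ₂ N (.bang B)} :
    (QDeriv.pair' hs τ σ h d e).NoRepeat ↔
      (Γ.NoRepeat ∧ (QType.bang (.tensor (.nbang τ A) (.nbang σ B))).NoRepeat) ∧
        d.NoRepeat ∧ e.NoRepeat := by
  simp only [QDeriv.NoRepeat, QDeriv.judgements, QCtx.NoRepeat, List.forall_mem_cons,
    List.forall_mem_append, and_assoc]

theorem noRepeat_letp' {hs : s = .extended} {τ σ : Fin 2} {h : Split Γ Γ₁ Γ₂}
    {d : QDeriv arity s Γ₁ M (.bang (.tensor (.nbang τ A) (.nbang σ B)))}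
    {e : QDeriv arity s (some (.bang A) :: some (.bang B) :: Γ₂) N C} :
    (QDeriv.letp' hs τ σ h d e).NoRepeat ↔
      (Γ.NoRepeat ∧ C.NoRepeat) ∧ d.NoRepeat ∧ e.NoRepeat := by
  simp only [QDeriv.NoRepeat, QDeriv.judgements, QCtx.NoRepeat, List.forall_mem_cons,
    List.forall_mem_append, and_assoc]

/-- The context with all repeated exponentials contracted. -/
def QCtx.collapse (Γ : QCtx κ) : QCtx κ := Γ.map (Option.map QType.collapse)

theorem QCtx.skel_collapse (Γ : QCtx κ) : Γ.collapse.skel = Γ.skel := by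
  have h : QType.skel ∘ QType.collapse = (QType.skel : QType κ → IType κ) :=
    funext QType.skel_collapse
  simp [QCtx.collapse, QCtx.skel, h]

theorem QCtx.noRepeat_collapse (Γ : QCtx κ) : Γ.collapse.NoRepeat := by
  intro B hB
  obtain ⟨o, -, ho⟩ := List.mem_map.1 hB
  obtain ⟨A, -, rfl⟩ := Option.map_eq_some_iff.1 ho
  exact A.noRepeat_collapse

theorem QCtx.collapse_get {Γ : QCtx κ} {x : ℕ} {A : QType κ} (h : Γ[x]? = some (some A)) :
    Γ.collapse[x]? = some (some A.collapse) := by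
  simp [QCtx.collapse, h]

theorem QType.exists_collapse_bang (A : QType κ) : ∃ B, A.bang.collapse = .bang B := by
  rw [QType.collapse]
  rcases A.collapse.bangOnce_cases with ⟨-, h⟩ | ⟨B, -, h⟩ <;> exact ⟨_, h⟩

theorem Split.collapse (h : Split Γ Γ₁ Γ₂) : Split Γ.collapse Γ₁.collapse Γ₂.collapse := by
  induction h with
  | nil => exact .nil
  | none _ ih => exact .none ih
  | left A _ ih => exact .left _ ih
  | right A _ ih => exact .right _ ih
  | both A _ ih =>
    obtain ⟨B, hB⟩ := A.exists_collapse_bang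
    have := Split.both B ih
    rw [← hB] at this
    exact this

theorem Promotable.collapse (h : Promotable Γ M) : Promotable Γ.collapse M := by
  intro x A hx hM
  rw [QCtx.collapse, List.getElem?_map] at hx
  obtain ⟨o, ho, hA⟩ := Option.map_eq_some_iff.1 hx
  obtain ⟨C, rfl, rfl⟩ := Option.map_eq_some_iff.1 hA
  obtain ⟨D, rfl⟩ := h x C ho hM
  exact D.exists_collapse_bang

/-- A type `!A` without repeated exponentials such that `!!A` contracts to it, and the number of
exponentials that were contracted. -/
theorem QType.exists_bangOnce (A : QType κ) :
    ∃ (τ : Fin 2) (B : QType κ), A.bangOnce = .bang B ∧ A = .nbang τ B := by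
  rcases A.bangOnce_cases with ⟨-, h⟩ | ⟨B, h, h'⟩
  · exact ⟨0, A, h, rfl⟩
  · exact ⟨1, B, h', h⟩

/-- Contracting all repeated exponentials turns a decoration in the basic system into one in the
extended system without repeated exponentials. -/
theorem QDeriv.exists_noRepeat (q : QDeriv arity .basic Γ M A) {Γ' : SCtx κ} {U : IType κ}
    {π : SDeriv arity Γ' M U} (h : q.Over π) :
    ∃ q' : QDeriv arity .extended Γ.collapse M A.collapse, q'.Over π ∧ q'.NoRepeat := by
  have hle : SCtx.Le Γ.collapse.skel Γ' := by rw [QCtx.skel_collapse]; exact h.le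
  induction q generalizing Γ' U with
  | @ax₁ Γ x A B hx hAB =>
    cases π with
    | ax₁ hx' =>
      rw [over_ax₁] at h
      exact ⟨.ax₁ (QCtx.collapse_get hx) hAB.collapse,
        over_ax₁.2 ⟨hle, by rw [QType.skel_collapse, h.2]⟩,
        noRepeat_ax₁.2 ⟨QCtx.noRepeat_collapse _, QType.noRepeat_collapse _⟩⟩
  | @ax₂ Γ c B hB =>
    cases π with
    | ax₂ h' =>
      have h1 := hB.collapse
      rw [(Const.noRepeat_type arity c).collapse_eq] at h1
      exact ⟨.ax₂ h1, over_ax₂.2 hle,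
        noRepeat_ax₂.2 ⟨QCtx.noRepeat_collapse _, QType.noRepeat_collapse _⟩⟩
  | star n =>
    cases π with
    | star =>
      -- Here `m` is `0` or `1`, according to whether there is any exponential to contract.
      have key : ∃ m, (QType.nbang n .top : QType κ).collapse = .nbang m .top := by
        cases n with
        | zero => exact ⟨0, rfl⟩
        | succ n => exact ⟨1, QType.collapse_nbang_succ n _⟩
      have hn := QType.noRepeat_collapse (QType.nbang n .top : QType κ)
      obtain ⟨m, hm⟩ := key
      rw [hm] at hn ⊢
      exact ⟨.star m, over_star.2 hle, noRepeat_star.2 ⟨QCtx.noRepeat_collapse _, hn⟩⟩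
  | ite hs p d e ihp ihd ihe =>
    cases π with
    | ite p' d' e' =>
      obtain ⟨-, hp, hd, he⟩ := over_ite.1 h
      obtain ⟨p₁, hp₁, np⟩ := ihp hp (hs.collapse.le_left.trans hle)
      obtain ⟨d₁, hd₁, nd⟩ := ihd hd (hs.collapse.le_right.trans hle)
      obtain ⟨e₁, he₁, ne⟩ := ihe he (hs.collapse.le_right.trans hle)
      exact ⟨.ite hs.collapse p₁ d₁ e₁, over_ite.2 ⟨hle, hp₁, hd₁, he₁⟩,
        noRepeat_ite.2 ⟨⟨QCtx.noRepeat_collapse _, QType.noRepeat_collapse _⟩, np, nd, ne⟩⟩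
  | app hs d e ihd ihe =>
    cases π with
    | app d' e' =>
      obtain ⟨-, hd, he⟩ := over_app.1 h
      obtain ⟨d₁, hd₁, nd⟩ := ihd hd (hs.collapse.le_left.trans hle)
      obtain ⟨e₁, he₁, ne⟩ := ihe he (hs.collapse.le_right.trans hle)
      exact ⟨.app hs.collapse d₁ e₁, over_app.2 ⟨hle, hd₁, he₁⟩,
        noRepeat_app.2 ⟨⟨QCtx.noRepeat_collapse _, QType.noRepeat_collapse _⟩, nd, ne⟩⟩
  | lam₁ d ih =>
    cases π with
    | lam d' =>
      have hd := over_lam₁.1 h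
      obtain ⟨d₁, hd₁, nd⟩ := ih hd (by rw [QCtx.skel_collapse]; exact hd.le)
      exact ⟨.lam₁ d₁, over_lam₁.2 hd₁, noRepeat_lam₁.2 ⟨⟨QCtx.noRepeat_collapse _,
        QType.noRepeat_collapse _, QType.noRepeat_collapse _⟩, nd⟩⟩
  | @lam₂ _ _ A B n hM d ih =>
    cases π with
    | lam d' =>
      have hd := over_lam₂.1 h
      obtain ⟨d₁, hd₁, nd⟩ := ih hd (by rw [QCtx.skel_collapse]; exact hd.le)
      have hn := QType.noRepeat_collapse (.nbang (n + 1) (.lolli A B))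
      have key : (QType.nbang (n + 1) (.lolli A B)).collapse =
        .nbang (0 + 1) (.lolli A.collapse B.collapse) := QType.collapse_nbang_succ n _
      rw [key] at hn ⊢
      exact ⟨.lam₂ 0 hM.collapse d₁, over_lam₂.2 hd₁,
        noRepeat_lam₂.2 ⟨⟨QCtx.noRepeat_collapse _, hn⟩, nd⟩⟩
  | @pair _ _ _ _ _ A B n hs d e ihd ihe =>
    cases π with
    | pair d' e' =>
      obtain ⟨-, hd, he⟩ := over_pair.1 h
      have hd₁ := ihd hd (hs.collapse.le_left.trans hle)
      have he₁ := ihe he (hs.collapse.le_right.trans hle)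
      have hn := QType.noRepeat_collapse (.nbang n (.tensor A B))
      cases n with
      | zero =>
        obtain ⟨d₁, hd₁, nd⟩ := hd₁
        obtain ⟨e₁, he₁, ne⟩ := he₁
        exact ⟨.pair 0 hs.collapse d₁ e₁, over_pair.2 ⟨hle, hd₁, he₁⟩,
          noRepeat_pair.2 ⟨⟨QCtx.noRepeat_collapse _, hn⟩, nd, ne⟩⟩
      | succ n =>
        rw [QType.collapse_nbang_succ] at hd₁ he₁ hn ⊢
        have key : (QType.tensor A B).collapse.bangOnce =
          .bang (.tensor A.collapse B.collapse) := rfl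
        rw [key] at hn ⊢
        -- The component now has type `!A'`, while inside the tensor the contracted `A` is `!^τ A'`:
        -- the exponential in front of the tensor does not merge with one under it. This is the
        -- situation covered by `pair'`.
        obtain ⟨τ, A', hA, hA'⟩ := A.collapse.exists_bangOnce
        obtain ⟨σ, B', hB, hB'⟩ := B.collapse.exists_bangOnce
        rw [hA] at hd₁
        rw [hB] at he₁
        rw [hA', hB'] at hn ⊢
        obtain ⟨d₁, hd₁, nd⟩ := hd₁
        obtain ⟨e₁, he₁, ne⟩ := he₁
        exact ⟨.pair' rfl τ σ hs.collapse d₁ e₁, over_pair'.2 ⟨hle, hd₁, he₁⟩,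
          noRepeat_pair'.2 ⟨⟨QCtx.noRepeat_collapse _, hn⟩, nd, ne⟩⟩
  | @letp _ Γ₁ Γ₂ _ _ A B C n hs d e ihd ihe =>
    cases π with
    | letp d' e' =>
      obtain ⟨-, hd, he⟩ := over_letp.1 h
      have hd₁ := ihd hd (hs.collapse.le_left.trans hle)
      have he₁ := ihe he (by rw [QCtx.skel_collapse]; exact he.le)
      have key : QCtx.collapse (some (.nbang n A) :: some (.nbang n B) :: Γ₂) =
        some (QType.nbang n A).collapse :: some (QType.nbang n B).collapse :: Γ₂.collapse := rfl
      rw [key] at he₁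
      cases n with
      | zero =>
        obtain ⟨d₁, hd₁, nd⟩ := hd₁
        obtain ⟨e₁, he₁, ne⟩ := he₁
        exact ⟨.letp 0 hs.collapse d₁ e₁, over_letp.2 ⟨hle, hd₁, he₁⟩, noRepeat_letp.2
          ⟨⟨QCtx.noRepeat_collapse _, QType.noRepeat_collapse _⟩, nd, ne⟩⟩
      | succ n =>
        rw [QType.collapse_nbang_succ] at hd₁
        rw [QType.collapse_nbang_succ, QType.collapse_nbang_succ] at he₁
        have key : (QType.tensor A B).collapse.bangOnce =
          .bang (.tensor A.collapse B.collapse) := rfl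
        rw [key] at hd₁
        -- Dually, the bound variables get the types `!A'` and `!B'` while the tensor may retain
        -- inner exponentials, so `letp'` is needed.
        obtain ⟨τ, A', hA, hA'⟩ := A.collapse.exists_bangOnce
        obtain ⟨σ, B', hB, hB'⟩ := B.collapse.exists_bangOnce
        rw [hA, hB] at he₁
        rw [hA', hB'] at hd₁
        obtain ⟨d₁, hd₁, nd⟩ := hd₁
        obtain ⟨e₁, he₁, ne⟩ := he₁
        exact ⟨.letp' rfl τ σ hs.collapse d₁ e₁, over_letp'.2 ⟨hle, hd₁, he₁⟩, noRepeat_letp'.2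
          ⟨⟨QCtx.noRepeat_collapse _, QType.noRepeat_collapse _⟩, nd, ne⟩⟩
  | pair' hs => cases hs
  | letp' hs => cases hs

theorem QTypable.exists_noRepeat {Γ : SCtx κ} {U : IType κ}
    (h : QTypable κ arity M) (π : SDeriv arity Γ M U) :
    ∃ (Δ : QCtx κ) (A : QType κ) (q : QDeriv arity .extended Δ M A),
      q.IsDecoration π ∧ q.NoRepeat := by
  obtain ⟨Δ, A, q, hq⟩ := h.exists_isDecoration π
  obtain ⟨hΔ, hq⟩ := QDeriv.isDecoration_iff.1 hq
  obtain ⟨q', hq', hn⟩ := q.exists_noRepeat hq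
  exact ⟨_, _, q', QDeriv.isDecoration_iff.2 ⟨by rw [QCtx.skel_collapse, hΔ], hq'⟩, hn⟩

theorem QDeriv.qTypable (q : QDeriv arity s Γ M A) : QTypable κ arity M :=
  ⟨Γ, A, q.basic_of_extended⟩

theorem QTypable.sTypable (h : QTypable κ arity M) : STypable κ arity M := by
  obtain ⟨Γ, A, ⟨q⟩⟩ := h
  exact ⟨Γ.skel, A.skel, ⟨q.skelOver _ _ (fun _ _ h => h) rfl⟩⟩

end Decorations

/-! ### Enumeration of decorations -/

section Enumeration

variable {G κ : Type}

/-- The list with the types `!A` for its elements `A` added. -/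
def withBang (l : List (QType κ)) : List (QType κ) := l ++ l.map .bang

/-- All linear types without repeated exponentials that have a given skeleton. -/
def IType.decorations : IType κ → List (QType κ)
  | .bit => withBang [.bit]
  | .qbit => withBang [.qbit]
  | .const k => withBang [.const k]
  | .var n => withBang [.var n]
  | .arrow U V => withBang (U.decorations.flatMap fun A => V.decorations.map fun B => .lolli A B)
  | .top => withBang [.top]
  | .prod U V => withBang (U.decorations.flatMap fun A => V.decorations.map fun B => .tensor A B)

theorem mem_withBang {l : List (QType κ)} {A : QType κ} :
    A ∈ withBang l ↔ A ∈ l ∨ ∃ B ∈ l, A = .bang B := by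
  simp [withBang, eq_comm]

theorem IType.mem_decorations {U : IType κ} {A : QType κ} :
    A ∈ U.decorations ↔ A.skel = U ∧ A.NoRepeat := by
  -- A type without repetition is either plain or one exponential applied to a plain type, so only
  -- the plain decorations have to be listed.
  have key : ∀ {U : IType κ} {l : List (QType κ)},
      (∀ A, A ∈ l ↔ A.skel = U ∧ A.NoRepeat ∧ A.Plain) →
      ∀ A, A ∈ withBang l ↔ A.skel = U ∧ A.NoRepeat := by
    intro U l h A
    rw [mem_withBang, h]
    constructor
    · rintro (h1 | ⟨B, hB, rfl⟩)
      · exact ⟨h1.1, h1.2.1⟩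
      · obtain ⟨h1, h2, h3⟩ := (h B).1 hB
        exact ⟨h1, h3, h2⟩
    · rintro ⟨h1, h2⟩
      cases A with
      | bang B => exact .inr ⟨B, (h B).2 ⟨h1, h2.2, h2.1⟩, rfl⟩
      | _ => exact .inl ⟨h1, h2, fun _ => by simp⟩
  induction U generalizing A with
  | arrow U V ihU ihV =>
    refine key (fun A => ?_) A
    simp only [List.mem_flatMap, List.mem_map, ihU, ihV]
    constructor
    · rintro ⟨B, ⟨rfl, hB⟩, C, ⟨rfl, hC⟩, rfl⟩
      exact ⟨rfl, ⟨hB, hC⟩, fun _ => by simp⟩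
    · rintro ⟨h1, h2, h3⟩
      cases A with
      | lolli B C =>
        obtain ⟨rfl, rfl⟩ := IType.arrow.inj h1
        exact ⟨B, ⟨rfl, h2.1⟩, C, ⟨rfl, h2.2⟩, rfl⟩
      | bang B => exact absurd rfl (h3 B)
      | _ => simp [QType.skel] at h1
  | prod U V ihU ihV =>
    refine key (fun A => ?_) A
    simp only [List.mem_flatMap, List.mem_map, ihU, ihV]
    constructor
    · rintro ⟨B, ⟨rfl, hB⟩, C, ⟨rfl, hC⟩, rfl⟩
      exact ⟨rfl, ⟨hB, hC⟩, fun _ => by simp⟩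
    · rintro ⟨h1, h2, h3⟩
      cases A with
      | tensor B C =>
        obtain ⟨rfl, rfl⟩ := IType.prod.inj h1
        exact ⟨B, ⟨rfl, h2.1⟩, C, ⟨rfl, h2.2⟩, rfl⟩
      | bang B => exact absurd rfl (h3 B)
      | _ => simp [QType.skel] at h1
  | _ =>
    refine key (fun A => ?_) A
    cases A <;> simp [QType.skel, QType.NoRepeat, QType.Plain, eq_comm]

/-- All decorations without repeated exponentials of restrictions of a context. -/
def SCtx.decorations (Γ : SCtx κ) : List (QCtx κ) :=
  (Γ.map fun o => none :: (o.toList.flatMap IType.decorations).map some).sections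

theorem SCtx.mem_decorations {Γ : SCtx κ} {Δ : QCtx κ} :
    Δ ∈ Γ.decorations ↔ Δ.length = Γ.length ∧ SCtx.Le Δ.skel Γ ∧ Δ.NoRepeat := by
  rw [SCtx.decorations, List.mem_sections]
  induction Γ generalizing Δ with
  | nil =>
    constructor
    · intro h
      cases h
      exact ⟨rfl, fun x U h => h, fun B h => by simp at h⟩
    · rintro ⟨h, -⟩
      rw [List.length_eq_zero_iff.1 h]
      exact .nil
  | cons o Γ ih =>
    cases Δ with
    | nil => simp
    | cons o' Δ =>
      rw [List.map_cons, List.forall₂_cons, ih]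
      constructor
      · rintro ⟨h, h1, h2, h3⟩
        rcases o' with _ | A
        · refine ⟨by simp [h1], ?_, fun B hB => h3 B (by simpa using hB)⟩
          intro x U hx
          cases x with
          | zero => simp [QCtx.skel] at hx
          | succ x => simpa using h2 x U (by simpa [QCtx.skel] using hx)
        · rcases o with _ | U
          · simp at h
          · simp only [Option.toList_some, List.flatMap_singleton, List.mem_cons, reduceCtorEq,
              List.mem_map, Option.some.injEq, exists_eq_right, false_or,
              IType.mem_decorations] at h
            refine ⟨by simp [h1], QCtx.skel_le_cons h2 h.1, fun B hB => ?_⟩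
            rcases List.mem_cons.1 hB with hB | hB
            · obtain rfl := Option.some.inj hB
              exact h.2
            · exact h3 B hB
      · rintro ⟨h1, h2, h3⟩
        refine ⟨?_, by simpa using h1, h2.of_cons, fun B hB => h3 B (by simp [hB])⟩
        rcases o' with _ | A
        · simp
        · have := h2 0 A.skel rfl
          obtain rfl : o = some A.skel := by simpa using this
          simp [IType.mem_decorations, h3 A (by simp)]

theorem SCtx.cons_mem_decorations {Γ : SCtx κ} {Δ : QCtx κ} {A : QType κ} {U : IType κ} :
    some A :: Δ ∈ SCtx.decorations (some U :: Γ) ↔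
      (A.skel = U ∧ A.NoRepeat) ∧ Δ ∈ Γ.decorations := by
  simp only [SCtx.decorations, List.mem_sections]
  rw [List.map_cons, List.forall₂_cons]
  simp [IType.mem_decorations]

theorem Split.length_eq {Γ Γ₁ Γ₂ : QCtx κ} (h : Split Γ Γ₁ Γ₂) :
    Γ₁.length = Γ.length ∧ Γ₂.length = Γ.length := by
  induction h <;> simp_all

theorem Split.noRepeat {Γ Γ₁ Γ₂ : QCtx κ} (h : Split Γ Γ₁ Γ₂) (hΓ : Γ.NoRepeat) :
    Γ₁.NoRepeat ∧ Γ₂.NoRepeat := by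
  refine ⟨fun B hB => ?_, fun B hB => ?_⟩
  · obtain ⟨x, hx⟩ := List.mem_iff_getElem?.1 hB
    exact hΓ B (List.mem_iff_getElem?.2 ⟨x, h.get_left hx⟩)
  · obtain ⟨x, hx⟩ := List.mem_iff_getElem?.1 hB
    exact hΓ B (List.mem_iff_getElem?.2 ⟨x, h.get_right hx⟩)

/-- Hence the search never leaves a fixed list of contexts when it passes from a conclusion to its
premises; binders are handled by `SCtx.cons_mem_decorations`. -/
theorem Split.mem_decorations {Γ Γ₁ Γ₂ : QCtx κ} {Γ' : SCtx κ} (h : Split Γ Γ₁ Γ₂)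
    (hΓ : Γ ∈ Γ'.decorations) : Γ₁ ∈ Γ'.decorations ∧ Γ₂ ∈ Γ'.decorations := by
  rw [SCtx.mem_decorations] at hΓ ⊢
  rw [SCtx.mem_decorations]
  exact ⟨⟨h.length_eq.1.trans hΓ.1, h.le_left.trans hΓ.2.1, (h.noRepeat hΓ.2.2).1⟩,
    ⟨h.length_eq.2.trans hΓ.1, h.le_right.trans hΓ.2.1, (h.noRepeat hΓ.2.2).2⟩⟩

/-- All decorations without repeated exponentials of a judgement, with a restricted context. -/
def decorationsOf (j : SJudgement G κ) : List (QJudgement G κ) :=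
  (SCtx.decorations j.1).flatMap fun Δ => j.2.2.decorations.map fun A => (Δ, j.2.1, A)

theorem mem_decorationsOf {Γ : SCtx κ} {M N : Term G} {U : IType κ} {Δ : QCtx κ} {A : QType κ} :
    (Δ, N, A) ∈ decorationsOf (Γ, M, U) ↔
      N = M ∧ Δ ∈ Γ.decorations ∧ A ∈ U.decorations := by
  simp only [decorationsOf, List.mem_flatMap, List.mem_map, Prod.mk.injEq]
  constructor
  · rintro ⟨Δ, hΔ, A, hA, rfl, rfl, rfl⟩
    exact ⟨rfl, hΔ, hA⟩
  · rintro ⟨rfl, hΔ, hA⟩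
    exact ⟨Δ, hΔ, A, hA, rfl, rfl, rfl⟩

end Enumeration

/-! ### Finiteness of the set of decorations -/

section Finiteness

variable {G κ : Type} {arity : G → ℕ}

/-- Marks the uses of the two additional rules in a derivation, in prefix order. -/
def QDeriv.marks {s : RuleSet} {Γ : QCtx κ} {M : Term G}
    {A : QType κ} (q : QDeriv arity s Γ M A) : List Bool :=
  match q with
  | .ax₁ _ _ => [false]
  | .ax₂ _ => [false]
  | .ite _ p d e => false :: (p.marks ++ d.marks ++ e.marks)
  | .app _ d e => false :: (d.marks ++ e.marks)
  | .lam₁ d => false :: d.marks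
  | .lam₂ _ _ d => false :: d.marks
  | .pair _ _ d e => false :: (d.marks ++ e.marks)
  | .star _ => [false]
  | .letp _ _ d e => false :: (d.marks ++ e.marks)
  | .pair' _ _ _ _ d e => true :: (d.marks ++ e.marks)
  | .letp' _ _ _ _ d e => true :: (d.marks ++ e.marks)

theorem QDeriv.length_marks {s : RuleSet} {Γ : QCtx κ} {M : Term G} {A : QType κ}
    (q : QDeriv arity s Γ M A) : q.marks.length = q.judgements.length := by
  induction q <;> simp_all [QDeriv.marks, QDeriv.judgements]

/-- The trailing lists allow this to be applied to the first of several concatenated premises. -/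
theorem QDeriv.judgements_append_inj {s : RuleSet} {Γ Γ' : QCtx κ} {M M' : Term G}
    {A A' : QType κ} {q : QDeriv arity s Γ M A} {q' : QDeriv arity s Γ' M' A'}
    {l l' : List (QJudgement G κ)} (h : q.judgements ++ l = q'.judgements ++ l') :
    Γ = Γ' ∧ A = A' := by
  have h1 : ∀ {Γ : QCtx κ} {M : Term G} {A : QType κ} (q : QDeriv arity s Γ M A), ∃ t, q.judgements = (Γ, M, A) :: t := by
    intro Γ M A q
    cases q <;> exact ⟨_, rfl⟩
  obtain ⟨t, ht⟩ := h1 q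
  obtain ⟨t', ht'⟩ := h1 q'
  rw [ht, ht'] at h
  simp at h
  exact ⟨h.1.1, h.1.2.2⟩

theorem nbang_inj_of_plain {A B : QType κ} (hA : A.Plain) (hB : B.Plain) {n m : ℕ}
    (h : QType.nbang n A = .nbang m B) : n = m ∧ A = B := by
  induction n generalizing m with
  | zero =>
    cases m with
    | zero => exact ⟨rfl, h⟩
    | succ m => exact absurd h (hA _)
  | succ n ih =>
    cases m with
    | zero => exact absurd h.symm (hB _)
    | succ m =>
      obtain ⟨rfl, rfl⟩ := ih (QType.bang.inj h)
      exact ⟨rfl, rfl⟩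

/-- Proved by size, because `A` may itself start with an exponential. It recovers `τ` and `σ` from
the types in the primed rules. -/
theorem nbang_right_injective {A : QType κ} {n m : ℕ} (h : QType.nbang n A = .nbang m A) :
    n = m := by
  have key : ∀ n, sizeOf (QType.nbang n A) = n + sizeOf A := by
    intro n
    induction n with
    | zero => simp [QType.nbang]
    | succ n ih => simp [QType.nbang, ih]; omega
  have := congrArg sizeOf h
  rw [key, key] at this
  omega

theorem nbang_tensor_inj {A A' B B' : QType κ} {n m : ℕ}
    (h : QType.nbang n (.tensor A B) = .nbang m (.tensor A' B')) : n = m ∧ A = A' ∧ B = B' := by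
  obtain ⟨h1, h2⟩ := nbang_inj_of_plain (fun _ => by simp) (fun _ => by simp) h
  exact ⟨h1, QType.tensor.inj h2⟩

theorem nbang_lolli_inj {A A' B B' : QType κ} {n m : ℕ}
    (h : QType.nbang n (.lolli A B) = .nbang m (.lolli A' B')) : n = m ∧ A = A' ∧ B = B' := by
  obtain ⟨h1, h2⟩ := nbang_inj_of_plain (fun _ => by simp) (fun _ => by simp) h
  exact ⟨h1, QType.lolli.inj h2⟩

/-- A derivation is determined by its judgements and its marks. -/
theorem QDeriv.ext_judgements {s : RuleSet} {Γ Γ' : QCtx κ} {M : Term G} {A A' : QType κ}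
    {q : QDeriv arity s Γ M A} {q' : QDeriv arity s Γ' M A'} {l l' : List (QJudgement G κ)}
    {t t' : List Bool} (h : q.judgements ++ l = q'.judgements ++ l')
    (ht : q.marks ++ t = q'.marks ++ t') :
    (⟨Γ, A, q⟩ : Σ (Γ : QCtx κ) (A : QType κ), QDeriv arity s Γ M A) = ⟨Γ', A', q'⟩ ∧
      l = l' ∧ t = t' := by
  induction q generalizing Γ' A' l l' t t' with
  | ax₁ hx hA =>
    obtain ⟨rfl, rfl⟩ := judgements_append_inj h
    cases q' with
    | ax₁ hx' hA' =>
      -- The declared type of the variable is not part of the type in the judgement, but the context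
      -- determines it.
      obtain rfl := Option.some.inj (Option.some.inj (hx.symm.trans hx'))
      exact ⟨rfl, by simpa [judgements] using h, by simpa [marks] using ht⟩
  | ax₂ hA =>
    obtain ⟨rfl, rfl⟩ := judgements_append_inj h
    cases q' with
    | ax₂ hA' => exact ⟨rfl, by simpa [judgements] using h, by simpa [marks] using ht⟩
  | star n =>
    have h0 := judgements_append_inj h
    cases q' with
    | star m =>
      obtain ⟨rfl, hA⟩ := h0
      obtain ⟨rfl, -⟩ := nbang_inj_of_plain (fun _ => by simp) (fun _ => by simp) hA
      exact ⟨rfl, by simpa [judgements] using h, by simpa [marks] using ht⟩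
  | ite hs p d e ihp ihd ihe =>
    obtain ⟨rfl, rfl⟩ := judgements_append_inj h
    cases q' with
    | ite hs' p' d' e' =>
      simp only [judgements, marks, List.cons_append, List.cons.injEq, true_and,
        List.append_assoc] at h ht
      obtain ⟨h1, h', ht'⟩ := ihp h ht
      obtain ⟨h2, h'', ht''⟩ := ihd h' ht'
      obtain ⟨h3, hr, hr'⟩ := ihe h'' ht''
      cases h1
      cases h2
      cases h3
      exact ⟨rfl, hr, hr'⟩
  | app hs d e ihd ihe =>
    obtain ⟨rfl, rfl⟩ := judgements_append_inj h
    cases q' with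
    | app hs' d' e' =>
      simp only [judgements, marks, List.cons_append, List.cons.injEq, true_and,
        List.append_assoc] at h ht
      obtain ⟨h1, h', ht'⟩ := ihd h ht
      obtain ⟨h2, hr, hr'⟩ := ihe h' ht'
      cases h1
      cases h2
      exact ⟨rfl, hr, hr'⟩
  | lam₁ d ih =>
    have h0 := judgements_append_inj h
    cases q' with
    | lam₁ d' =>
      simp only [judgements, marks, List.cons_append, List.cons.injEq] at h ht
      obtain ⟨h1, hr, hr'⟩ := ih h.2 ht.2
      cases h1
      exact ⟨rfl, hr, hr'⟩
    | lam₂ => exact absurd h0.2 (by simp [QType.nbang])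
  | lam₂ n hM d ih =>
    have h0 := judgements_append_inj h
    cases q' with
    | lam₁ d' => exact absurd h0.2 (by simp [QType.nbang])
    | lam₂ m hM' d' =>
      simp only [judgements, marks, List.cons_append, List.cons.injEq] at h ht
      obtain ⟨h1, hr, hr'⟩ := ih h.2 ht.2
      obtain ⟨h3, -⟩ := nbang_lolli_inj h0.2
      obtain rfl := Nat.succ.inj h3
      cases h1
      exact ⟨rfl, hr, hr'⟩
  | pair n hs d e ihd ihe =>
    obtain ⟨rfl, h0⟩ := judgements_append_inj h
    cases q' with
    | pair m hs' d' e' =>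
      simp only [judgements, marks, List.cons_append, List.cons.injEq,
        List.append_assoc] at h ht
      obtain ⟨rfl, rfl, rfl⟩ := nbang_tensor_inj h0
      obtain ⟨h1, h', ht'⟩ := ihd h.2 ht.2
      obtain ⟨h2, hr, hr'⟩ := ihe h' ht'
      cases h1
      cases h2
      exact ⟨rfl, hr, hr'⟩
    -- The judgements alone do not separate `pair` with `n = 1` from `pair'` with `τ = σ = 0`; the
    -- marks do.
    | pair' => simp [marks] at ht
  | letp n hs d e ihd ihe =>
    obtain ⟨rfl, rfl⟩ := judgements_append_inj h
    cases q' with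
    | letp m hs' d' e' =>
      simp only [judgements, marks, List.cons_append, List.cons.injEq, true_and,
        List.append_assoc] at h ht
      -- The conclusion does not mention `n`, `A` and `B`; they are read off the type of the first
      -- premise.
      obtain ⟨rfl, rfl, rfl⟩ := nbang_tensor_inj (judgements_append_inj h).2
      obtain ⟨h1, h', ht'⟩ := ihd h ht
      obtain ⟨h2, hr, hr'⟩ := ihe h' ht'
      cases h1
      cases h2
      exact ⟨rfl, hr, hr'⟩
    | letp' => simp [marks] at ht
  | pair' hs τ σ h0 d e ihd ihe =>
    obtain ⟨rfl, h0⟩ := judgements_append_inj h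
    cases q' with
    | pair => simp [marks] at ht
    | pair' hs' τ' σ' h0' d' e' =>
      simp only [judgements, marks, List.cons_append, List.cons.injEq,
        List.append_assoc] at h ht
      obtain ⟨h1, h', ht'⟩ := ihd h.2 ht.2
      obtain ⟨h2, hr, hr'⟩ := ihe h' ht'
      cases h1
      cases h2
      obtain ⟨h1, h2⟩ := QType.tensor.inj (QType.bang.inj h0)
      obtain rfl := Fin.ext (nbang_right_injective h1)
      obtain rfl := Fin.ext (nbang_right_injective h2)
      exact ⟨rfl, hr, hr'⟩
  | letp' hs τ σ h0 d e ihd ihe =>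
    obtain ⟨rfl, rfl⟩ := judgements_append_inj h
    cases q' with
    | letp => simp [marks] at ht
    | letp' hs' τ' σ' h0' d' e' =>
      simp only [judgements, marks, List.cons_append, List.cons.injEq, true_and,
        List.append_assoc] at h ht
      -- The first premise only shows `!^τ A` and `!^σ B`, which is ambiguous. The context of the
      -- second premise yields `A` and `B`, and then `τ` and `σ` follow.
      have h3 := (judgements_append_inj h).2
      obtain ⟨h1, h', ht'⟩ := ihd h ht
      have h4 := (judgements_append_inj h').1
      simp only [List.cons.injEq, Option.some.injEq, QType.bang.injEq] at h4
      obtain ⟨rfl, rfl, rfl⟩ := h4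
      obtain ⟨h2, hr, hr'⟩ := ihe h' ht'
      obtain ⟨h4, h5⟩ := QType.tensor.inj (QType.bang.inj h3)
      obtain rfl := Fin.ext (nbang_right_injective h4)
      obtain rfl := Fin.ext (nbang_right_injective h5)
      cases h1
      cases h2
      exact ⟨rfl, hr, hr'⟩

/-- The judgements of a decoration without repeated exponentials are among finitely many. -/
theorem QDeriv.Over.judgements_mem {s : RuleSet} {Γ : QCtx κ} {M : Term G} {A : QType κ}
    {q : QDeriv arity s Γ M A} {Γ' : SCtx κ} {U : IType κ} {π : SDeriv arity Γ' M U}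
    (h : q.Over π) (hn : q.NoRepeat) (hl : Γ.length = Γ'.length) :
    q.judgements ∈ (π.judgements.map decorationsOf).sections := by
  rw [List.mem_sections]
  have root : ∀ {Γ M A} {q : QDeriv arity s Γ M A} {Γ' : SCtx κ} {U : IType κ}
      {π : SDeriv arity Γ' M U}, q.Over π → q.NoRepeat → Γ.length = Γ'.length →
      (Γ, M, A) ∈ decorationsOf (Γ', M, U) := fun h hn hl =>
    mem_decorationsOf.2 ⟨rfl, SCtx.mem_decorations.2 ⟨hl, h.le, hn.root.1⟩,
      IType.mem_decorations.2 ⟨h.skel_eq, hn.root.2⟩⟩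
  have hr := root h hn hl
  induction q generalizing Γ' U with
  | ax₁ => cases π; exact .cons hr .nil
  | ax₂ => cases π; exact .cons hr .nil
  | star => cases π; exact .cons hr .nil
  | ite hs p d e ihp ihd ihe =>
    cases π with
    | ite p' d' e' =>
      obtain ⟨-, hp, hd, he⟩ := over_ite.1 h
      obtain ⟨-, np, nd, ne⟩ := noRepeat_ite.1 hn
      have l₁ := hs.length_eq.1.trans hl
      have l₂ := hs.length_eq.2.trans hl
      simp only [judgements, SDeriv.judgements, List.map_cons, List.map_append]
      exact .cons hr (List.rel_append (List.rel_append (ihp hp np l₁ (root hp np l₁))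
        (ihd hd nd l₂ (root hd nd l₂))) (ihe he ne l₂ (root he ne l₂)))
  | app hs d e ihd ihe =>
    cases π with
    | app d' e' =>
      obtain ⟨-, hd, he⟩ := over_app.1 h
      obtain ⟨-, nd, ne⟩ := noRepeat_app.1 hn
      have l₁ := hs.length_eq.1.trans hl
      have l₂ := hs.length_eq.2.trans hl
      simp only [judgements, SDeriv.judgements, List.map_cons, List.map_append]
      exact .cons hr (List.rel_append (ihd hd nd l₁ (root hd nd l₁)) (ihe he ne l₂ (root he ne l₂)))
  | lam₁ d ih =>
    cases π with
    | lam d' =>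
      have hd := over_lam₁.1 h
      have nd := (noRepeat_lam₁.1 hn).2
      have l := congrArg Nat.succ hl
      exact .cons hr (ih hd nd l (root hd nd l))
  | lam₂ n hM d ih =>
    cases π with
    | lam d' =>
      have hd := over_lam₂.1 h
      have nd := (noRepeat_lam₂.1 hn).2
      have l := congrArg Nat.succ hl
      exact .cons hr (ih hd nd l (root hd nd l))
  | pair n hs d e ihd ihe =>
    cases π with
    | pair d' e' =>
      obtain ⟨-, hd, he⟩ := over_pair.1 h
      obtain ⟨-, nd, ne⟩ := noRepeat_pair.1 hn
      have l₁ := hs.length_eq.1.trans hl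
      have l₂ := hs.length_eq.2.trans hl
      simp only [judgements, SDeriv.judgements, List.map_cons, List.map_append]
      exact .cons hr (List.rel_append (ihd hd nd l₁ (root hd nd l₁)) (ihe he ne l₂ (root he ne l₂)))
  | pair' _ _ _ hs d e ihd ihe =>
    cases π with
    | pair d' e' =>
      obtain ⟨-, hd, he⟩ := over_pair'.1 h
      obtain ⟨-, nd, ne⟩ := noRepeat_pair'.1 hn
      have l₁ := hs.length_eq.1.trans hl
      have l₂ := hs.length_eq.2.trans hl
      simp only [judgements, SDeriv.judgements, List.map_cons, List.map_append]
      exact .cons hr (List.rel_append (ihd hd nd l₁ (root hd nd l₁)) (ihe he ne l₂ (root he ne l₂)))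
  | letp n hs d e ihd ihe =>
    cases π with
    | letp d' e' =>
      obtain ⟨-, hd, he⟩ := over_letp.1 h
      obtain ⟨-, nd, ne⟩ := noRepeat_letp.1 hn
      have l₁ := hs.length_eq.1.trans hl
      have l₂ := congrArg (fun n => n + 2) (hs.length_eq.2.trans hl)
      simp only [judgements, SDeriv.judgements, List.map_cons, List.map_append]
      exact .cons hr (List.rel_append (ihd hd nd l₁ (root hd nd l₁)) (ihe he ne l₂ (root he ne l₂)))
  | letp' _ _ _ hs d e ihd ihe =>
    cases π with
    | letp d' e' =>
      obtain ⟨-, hd, he⟩ := over_letp'.1 h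
      obtain ⟨-, nd, ne⟩ := noRepeat_letp'.1 hn
      have l₁ := hs.length_eq.1.trans hl
      have l₂ := congrArg (fun n => n + 2) (hs.length_eq.2.trans hl)
      simp only [judgements, SDeriv.judgements, List.map_cons, List.map_append]
      exact .cons hr (List.rel_append (ihd hd nd l₁ (root hd nd l₁)) (ihe he ne l₂ (root he ne l₂)))

/-- Decorations inject into pairs of a list of judgements and a list of marks. The former are
sections of a finite list of finite lists, the latter Boolean lists of bounded length. -/
theorem finite_decorations {s : RuleSet} {Γ : SCtx κ} {M : Term G} {U : IType κ}
    (π : SDeriv arity Γ M U) :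
    {d : Σ (Δ : QCtx κ) (A : QType κ), QDeriv arity s Δ M A |
        d.2.2.IsDecoration π ∧ d.2.2.NoRepeat}.Finite := by
  let S : List (List (QJudgement G κ)) := (π.judgements.map decorationsOf).sections
  let T : Set (List (QJudgement G κ) × List Bool) :=
    {l | l ∈ S} ×ˢ {t : List Bool | t.length ≤ π.judgements.length}
  have hT : T.Finite := (List.finite_toSet S).prod (List.finite_length_le Bool _)
  refine Set.Finite.of_finite_image (f := fun d => (d.2.2.judgements, d.2.2.marks))
    (hT.subset ?_) ?_
  · rintro _ ⟨⟨Δ, A, q⟩, ⟨hq, hn⟩, rfl⟩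
    obtain ⟨rfl, hq⟩ := QDeriv.isDecoration_iff.1 hq
    have hm := hq.judgements_mem hn (by simp [QCtx.skel])
    refine ⟨hm, ?_⟩
    have := List.mem_sections_length hm
    simp only [Set.mem_ofPred_eq, q.length_marks, this, List.length_map, le_refl]
  · rintro ⟨Δ, A, q⟩ - ⟨Δ', A', q'⟩ - h
    obtain ⟨h1, h2⟩ := Prod.mk.inj h
    exact (QDeriv.ext_judgements (l := []) (l' := []) (t := []) (t' := [])
      (by simpa using h1) (by simpa using h2)).1

end Finiteness

/-! ### Primitive recursive operations on terms and types -/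

section CaseDistinctions

variable {α β γ σ : Type*} [Primcodable α] [Primcodable β] [Primcodable γ] [Primcodable σ]

theorem primrec_sumElim {f : α → β ⊕ γ} {g : α → β → σ} {h : α → γ → σ} (hf : Primrec f)
    (hg : Primrec fun x : α × β => g x.1 x.2) (hh : Primrec fun x : α × γ => h x.1 x.2) :
    Primrec fun a => Sum.elim (g a) (h a) (f a) :=
  (Primrec.sumCasesOn hf hg hh).of_eq fun a => by cases f a <;> rfl

/-- The labels of compound constructs form a finite type, so a function given by cases on them is
settled by one goal per construct. -/
theorem primrec_sumElim_fin {m : ℕ} {f : α → β ⊕ Fin m} {g : α → β → σ} {h : α → Fin m → σ}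
    (hf : Primrec f) (hg : Primrec fun x : α × β => g x.1 x.2)
    (hh : ∀ i, Primrec fun a => h a i) : Primrec fun a => Sum.elim (g a) (h a) (f a) :=
  primrec_sumElim hf hg <|
    (Primrec.fin_curry₁ (f := fun i a => h a i)).2 hh |>.comp Primrec.snd Primrec.fst

theorem primrecPred_sumElim {f : α → β ⊕ γ} {p : α → β → Prop} {q : α → γ → Prop}
    (hf : Primrec f) (hp : PrimrecPred fun x : α × β => p x.1 x.2)
    (hq : PrimrecPred fun x : α × γ => q x.1 x.2) :
    PrimrecPred fun a => Sum.elim (p a) (q a) (f a) := by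
  classical
  have h := primrec_sumElim (g := fun a b => decide (p a b)) (h := fun a b => decide (q a b))
    hf hp.decide hq.decide
  refine Primrec.primrecPred (h.of_eq fun a => ?_)
  cases f a <;> rfl

theorem primrecPred_sumElim_fin {m : ℕ} {f : α → β ⊕ Fin m} {p : α → β → Prop}
    {q : α → Fin m → Prop} (hf : Primrec f) (hp : PrimrecPred fun x : α × β => p x.1 x.2)
    (hq : ∀ i, PrimrecPred fun a => q a i) : PrimrecPred fun a => Sum.elim (p a) (q a) (f a) := by
  classical
  have h := primrec_sumElim_fin (g := fun a b => decide (p a b)) (h := fun a i => decide (q a i))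
    hf hp.decide fun i => (hq i).decide
  refine Primrec.primrecPred (h.of_eq fun a => ?_)
  cases f a <;> rfl

end CaseDistinctions

/-! ### Computations on types -/

section Types

variable {κ : Type}

/-- Computes the decorations of a type from those of its components. -/
def decorationsStep (l : ITypeLabel κ) (bs : List (List (QType κ))) : List (QType κ) :=
  withBang (Sum.elim (Sum.elim (fun n => [.var n]) (fun k => [.const k]))
    (fun i : Fin 5 => match i with
      | 0 => [.bit]
      | 1 => [.qbit]
      | 2 => [.top]
      | 3 => (bs.getD 0 []).flatMap fun A => (bs.getD 1 []).map fun B => .lolli A B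
      | 4 => (bs.getD 0 []).flatMap fun A => (bs.getD 1 []).map fun B => .tensor A B) l)

theorem IType.evalsTo_decorations (U : IType κ) :
    EvalsTo itypeArity decorationsStep U.word U.decorations := by
  induction U with
  | arrow U V hU hV => rw [IType.word_arrow]; exact EvalsTo.node₂ rfl hU hV
  | prod U V hU hV => rw [IType.word_prod]; exact EvalsTo.node₂ rfl hU hV
  | _ => exact EvalsTo.node₀ rfl

/-- Computes the skeleton of a type from those of its components. -/
def skelStep (l : QTypeLabel κ) (bs : List (IType κ)) : IType κ :=
  Sum.elim (Sum.elim (fun n => .var n) (fun k => .const k))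
    (fun i : Fin 6 => match i with
      | 0 => .bit
      | 1 => .qbit
      | 2 => .top
      | 3 => bs.getD 0 .top
      | 4 => .arrow (bs.getD 0 .top) (bs.getD 1 .top)
      | 5 => .prod (bs.getD 0 .top) (bs.getD 1 .top)) l

theorem QType.evalsTo_skel (A : QType κ) : EvalsTo qtypeArity skelStep A.word A.skel := by
  induction A with
  | lolli A B hA hB => rw [QType.word_lolli]; exact EvalsTo.node₂ rfl hA hB
  | tensor A B hA hB => rw [QType.word_tensor]; exact EvalsTo.node₂ rfl hA hB
  | bang A hA => rw [QType.word_bang]; exact EvalsTo.node₁ rfl hA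
  | _ => exact EvalsTo.node₀ rfl

/-- The outermost construct is an exponential. -/
def QType.isBang : QType κ → Bool
  | .bang _ => true
  | _ => false

theorem QType.isBang_iff {A : QType κ} : A.isBang = true ↔ ∃ B, A = .bang B := by
  cases A <;> simp [QType.isBang]

/-- All supertypes and all subtypes of a type that have no repeated exponentials. -/
def QType.bounds : QType κ → List (QType κ) × List (QType κ)
  | .bit => ([.bit], withBang [.bit])
  | .qbit => ([.qbit], withBang [.qbit])
  | .const k => ([.const k], withBang [.const k])
  | .var n => ([.var n], withBang [.var n])
  | .bang A =>
    (withBang (A.bounds.1.filter fun B => !B.isBang) ++ A.bounds.1, A.bounds.2.filter QType.isBang)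
  | .lolli A B =>
    (A.bounds.2.flatMap fun A' => B.bounds.1.map fun B' => .lolli A' B',
      withBang (A.bounds.1.flatMap fun A' => B.bounds.2.map fun B' => .lolli A' B'))
  | .top => ([.top], withBang [.top])
  | .tensor A B =>
    (A.bounds.1.flatMap fun A' => B.bounds.1.map fun B' => .tensor A' B',
      withBang (A.bounds.2.flatMap fun A' => B.bounds.2.map fun B' => .tensor A' B'))

/-- Computes the bounds of a type from those of its components. -/
def boundsStep (l : QTypeLabel κ) (bs : List (List (QType κ) × List (QType κ))) :
    List (QType κ) × List (QType κ) :=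
  Sum.elim (Sum.elim (fun n => ([.var n], withBang [.var n]))
    (fun k => ([.const k], withBang [.const k])))
    (fun i : Fin 6 => match i with
      | 0 => ([.bit], withBang [.bit])
      | 1 => ([.qbit], withBang [.qbit])
      | 2 => ([.top], withBang [.top])
      | 3 => (withBang ((bs.getD 0 ([], [])).1.filter fun B => !B.isBang) ++
          (bs.getD 0 ([], [])).1, (bs.getD 0 ([], [])).2.filter QType.isBang)
      | 4 => ((bs.getD 0 ([], [])).2.flatMap fun A => (bs.getD 1 ([], [])).1.map fun B => .lolli A B,
          withBang ((bs.getD 0 ([], [])).1.flatMap fun A =>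
            (bs.getD 1 ([], [])).2.map fun B => .lolli A B))
      | 5 => ((bs.getD 0 ([], [])).1.flatMap fun A => (bs.getD 1 ([], [])).1.map fun B => .tensor A B,
          withBang ((bs.getD 0 ([], [])).2.flatMap fun A =>
            (bs.getD 1 ([], [])).2.map fun B => .tensor A B))) l

theorem QType.evalsTo_bounds (A : QType κ) : EvalsTo qtypeArity boundsStep A.word A.bounds := by
  induction A with
  | lolli A B hA hB => rw [QType.word_lolli]; exact EvalsTo.node₂ rfl hA hB
  | tensor A B hA hB => rw [QType.word_tensor]; exact EvalsTo.node₂ rfl hA hB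
  | bang A hA => rw [QType.word_bang]; exact EvalsTo.node₁ rfl hA
  | _ => exact EvalsTo.node₀ rfl

theorem QType.plain_iff {A : QType κ} : A.Plain ↔ A.isBang = false := by
  cases A <;> simp [QType.isBang, QType.Plain]

/-- Supertypes and subtypes are computed simultaneously because `⊸` is contravariant on the left.
Among types without repetition, those below `!A` are the exponentials below `A`; those above `!A`
are the types above `A` and the exponentials of the plain ones among them. -/
theorem QType.mem_bounds (A : QType κ) :
    ∀ B, (B ∈ A.bounds.1 ↔ B.NoRepeat ∧ SubType A B) ∧ (B ∈ A.bounds.2 ↔ B.NoRepeat ∧ SubType B A) := by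
  -- The five atomic cases have the same shape: such a type is comparable only to itself and, from
  -- below, to its own exponential.
  have atom : ∀ {X : QType κ}, X.NoRepeat → X.Plain → (∀ B, B.Plain → SubType X B → B = X) →
      (∀ B, B.Plain → SubType B X → B = X) → (∀ B, ¬ SubType X (.bang B)) → ∀ B,
      (B ∈ [X] ↔ B.NoRepeat ∧ SubType X B) ∧ (B ∈ withBang [X] ↔ B.NoRepeat ∧ SubType B X) := by
    intro X hX hXp h1 h2 h3 B
    simp only [mem_withBang, List.mem_singleton, exists_eq_left]
    refine ⟨⟨?_, ?_⟩, ?_, ?_⟩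
    · rintro rfl; exact ⟨hX, .refl _⟩
    · rintro ⟨hB, hXB⟩
      cases B with
      | bang B => exact absurd hXB (h3 B)
      | _ => exact h1 _ (fun _ => by simp) hXB
    · rintro (rfl | rfl)
      · exact ⟨hX, .refl _⟩
      · exact ⟨⟨hXp, hX⟩, .derelict (.refl _)⟩
    · rintro ⟨hB, hXB⟩
      cases B with
      | bang B => exact .inr (congrArg _ (h2 B hB.1 ((bang_subType_plain hXp).1 hXB)))
      | _ => exact .inl (h2 _ (fun _ => by simp) hXB)
  induction A with
  | bang A ih =>
    intro B
    have i1 := fun B => (ih B).1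
    have i2 := fun B => (ih B).2
    simp only [QType.bounds, List.mem_append, mem_withBang, List.mem_filter, i1, i2,
      Bool.not_eq_true', ← QType.plain_iff, QType.isBang_iff]
    constructor
    · constructor
      · rintro ((h | ⟨C, ⟨⟨h1, h2⟩, h3⟩, rfl⟩) | h)
        · exact ⟨h.1.1, .derelict h.1.2⟩
        · exact ⟨⟨h3, h1⟩, .promote (.derelict h2)⟩
        · exact ⟨h.1, .derelict h.2⟩
      · rintro ⟨h1, h2⟩
        cases B with
        | bang C =>
          exact .inl (.inr ⟨C, ⟨⟨h1.2, (bang_subType_plain h1.1).1 (subType_bang_bang.1 h2)⟩,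
            h1.1⟩, rfl⟩)
        | _ => exact .inr ⟨h1, (bang_subType_plain fun _ => by simp).1 h2⟩
    · constructor
      · rintro ⟨⟨h1, h2⟩, C, rfl⟩
        exact ⟨h1, subType_bang_bang.2 h2⟩
      · rintro ⟨h1, h2⟩
        exact ⟨⟨h1, h2.of_bang_right⟩, h2.exists_bang⟩
  | lolli A₁ A₂ ih₁ ih₂ =>
    intro B
    have i1 := fun B => (ih₁ B).1
    have i2 := fun B => (ih₁ B).2
    have i3 := fun B => (ih₂ B).1
    have i4 := fun B => (ih₂ B).2
    simp only [QType.bounds, mem_withBang, List.mem_flatMap, List.mem_map, i1, i2, i3, i4]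
    constructor
    · constructor
      · rintro ⟨C, ⟨h1, h2⟩, D, ⟨h3, h4⟩, rfl⟩
        exact ⟨⟨h1, h3⟩, .lolli h2 h4⟩
      · rintro ⟨h1, h2⟩
        cases h2 with
        | lolli h2 h3 => exact ⟨_, ⟨h1.1, h2⟩, _, ⟨h1.2, h3⟩, rfl⟩
    · constructor
      · rintro (⟨C, ⟨h1, h2⟩, D, ⟨h3, h4⟩, rfl⟩ | ⟨_, ⟨C, ⟨h1, h2⟩, D, ⟨h3, h4⟩, rfl⟩, rfl⟩)
        · exact ⟨⟨h1, h3⟩, .lolli h2 h4⟩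
        · exact ⟨⟨fun _ => by simp, h1, h3⟩, .derelict (.lolli h2 h4)⟩
      · rintro ⟨h1, h2⟩
        cases h2 with
        | lolli h2 h3 => exact .inl ⟨_, ⟨h1.1, h2⟩, _, ⟨h1.2, h3⟩, rfl⟩
        | derelict h2 =>
          cases h2 with
          | lolli h2 h3 => exact .inr ⟨_, ⟨_, ⟨h1.2.1, h2⟩, _, ⟨h1.2.2, h3⟩, rfl⟩, rfl⟩
          | derelict => exact absurd rfl (h1.1 _)
  | tensor A₁ A₂ ih₁ ih₂ =>
    intro B
    have i1 := fun B => (ih₁ B).1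
    have i2 := fun B => (ih₁ B).2
    have i3 := fun B => (ih₂ B).1
    have i4 := fun B => (ih₂ B).2
    simp only [QType.bounds, mem_withBang, List.mem_flatMap, List.mem_map, i1, i2, i3, i4]
    constructor
    · constructor
      · rintro ⟨C, ⟨h1, h2⟩, D, ⟨h3, h4⟩, rfl⟩
        exact ⟨⟨h1, h3⟩, .tensor h2 h4⟩
      · rintro ⟨h1, h2⟩
        cases h2 with
        | tensor h2 h3 => exact ⟨_, ⟨h1.1, h2⟩, _, ⟨h1.2, h3⟩, rfl⟩
    · constructor
      · rintro (⟨C, ⟨h1, h2⟩, D, ⟨h3, h4⟩, rfl⟩ | ⟨_, ⟨C, ⟨h1, h2⟩, D, ⟨h3, h4⟩, rfl⟩, rfl⟩)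
        · exact ⟨⟨h1, h3⟩, .tensor h2 h4⟩
        · exact ⟨⟨fun _ => by simp, h1, h3⟩, .derelict (.tensor h2 h4)⟩
      · rintro ⟨h1, h2⟩
        cases h2 with
        | tensor h2 h3 => exact .inl ⟨_, ⟨h1.1, h2⟩, _, ⟨h1.2, h3⟩, rfl⟩
        | derelict h2 =>
          cases h2 with
          | tensor h2 h3 => exact .inr ⟨_, ⟨_, ⟨h1.2.1, h2⟩, _, ⟨h1.2.2, h3⟩, rfl⟩, rfl⟩
          | derelict => exact absurd rfl (h1.1 _)
  | _ =>
    refine atom trivial (fun _ => by simp) ?_ ?_ ?_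
    · intro B _ h; cases h; rfl
    · intro B hB h
      cases h
      · rfl
      · exact absurd rfl (hB _)
    · intro B h; cases h

theorem QType.mem_supertypes {A B : QType κ} :
    B ∈ A.bounds.1 ↔ B.NoRepeat ∧ SubType A B := (A.mem_bounds B).1

variable [Primcodable κ] {α : Type} [Primcodable α]

theorem primrec_withBang {f : α → List (QType κ)} (hf : Primrec f) :
    Primrec fun a => withBang (f a) :=
  Primrec.list_append.comp hf
    (Primrec.list_map hf (QType.bang_primrec Primrec.snd).to₂)

theorem primrec_singleton {β : Type*} [Primcodable β] {f : α → β} (hf : Primrec f) :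
    Primrec fun a => [f a] :=
  Primrec.list_cons.comp hf (Primrec.const [])

theorem primrec_pairwise {β γ : Type} [Primcodable β] [Primcodable γ] {c : β → β → γ}
    (hc : ∀ {δ : Type} [Primcodable δ] {f g : δ → β}, Primrec f → Primrec g →
      Primrec fun a => c (f a) (g a))
    {f g : α → List β} (hf : Primrec f) (hg : Primrec g) :
    Primrec fun a => (f a).flatMap fun A => (g a).map fun B => c A B :=
  Primrec.list_flatMap hf (Primrec.list_map (hg.comp Primrec.fst)
    (hc (Primrec.snd.comp Primrec.fst) Primrec.snd).to₂).to₂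

theorem primrec_getD {β : Type*} [Primcodable β] (k : ℕ) (d : β) {f : α → List β}
    (hf : Primrec f) : Primrec fun a => (f a).getD k d :=
  (Primrec.list_getD d).comp hf (Primrec.const k)

theorem IType.decorations_primrec : Primrec (IType.decorations (κ := κ)) := by
  have hF : Primrec fun p : IType κ × ITypeLabel κ × List (List (QType κ)) =>
      decorationsStep p.2.1 p.2.2 := by
    refine primrec_withBang ?_
    have hb : Primrec fun p : IType κ × ITypeLabel κ × List (List (QType κ)) => p.2.2 :=
      Primrec.snd.comp Primrec.snd
    refine primrec_sumElim_fin (Primrec.fst.comp Primrec.snd) ?_ fun i => ?_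
    · refine primrec_sumElim Primrec.snd ?_ ?_
      · exact primrec_singleton (QType.var_primrec.comp Primrec.snd)
      · exact primrec_singleton (QType.const_primrec.comp Primrec.snd)
    · fin_cases i
      · exact Primrec.const _
      · exact Primrec.const _
      · exact Primrec.const _
      · exact primrec_pairwise QType.lolli_primrec (primrec_getD 0 [] hb) (primrec_getD 1 [] hb)
      · exact primrec_pairwise QType.tensor_primrec (primrec_getD 0 [] hb) (primrec_getD 1 [] hb)
  have h := evalWord_primrec (F := fun _ => decorationsStep) itypeArity_primrec hF
    IType.word_primrec
  refine (primrec_getD 0 [] h).of_eq fun U => ?_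
  rw [U.evalsTo_decorations.evalWord]
  rfl

theorem QType.skel_primrec : Primrec (QType.skel (κ := κ)) := by
  have hF : Primrec fun p : QType κ × QTypeLabel κ × List (IType κ) => skelStep p.2.1 p.2.2 := by
    have hb : Primrec fun p : QType κ × QTypeLabel κ × List (IType κ) => p.2.2 :=
      Primrec.snd.comp Primrec.snd
    refine primrec_sumElim_fin (Primrec.fst.comp Primrec.snd) ?_ fun i => ?_
    · exact primrec_sumElim Primrec.snd (IType.var_primrec.comp Primrec.snd)
        (IType.const_primrec.comp Primrec.snd)
    · fin_cases i
      · exact Primrec.const _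
      · exact Primrec.const _
      · exact Primrec.const _
      · exact primrec_getD 0 .top hb
      · exact IType.arrow_primrec (primrec_getD 0 .top hb) (primrec_getD 1 .top hb)
      · exact IType.prod_primrec (primrec_getD 0 .top hb) (primrec_getD 1 .top hb)
  have h := evalWord_primrec (F := fun _ => skelStep) qtypeArity_primrec hF QType.word_primrec
  refine (primrec_getD 0 .top h).of_eq fun A => ?_
  rw [A.evalsTo_skel.evalWord]
  rfl

theorem QType.isBang_primrec : Primrec (QType.isBang (κ := κ)) := by
  classical
  -- The label `3` marks an exponential at the head of the word.
  have h : PrimrecPred fun A : QType κ => A.word.head? = some (.inr 3) :=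
    primrecPred_eq (Primrec.list_head?.comp QType.word_primrec) (Primrec.const _)
  refine h.decide.of_eq fun A => ?_
  cases A <;> simp [QType.isBang]

theorem QType.bounds_primrec : Primrec (QType.bounds (κ := κ)) := by
  have hF : Primrec fun p : QType κ × QTypeLabel κ × List (List (QType κ) × List (QType κ)) =>
      boundsStep p.2.1 p.2.2 := by
    have hb : Primrec fun p : QType κ × QTypeLabel κ × List (List (QType κ) × List (QType κ)) =>
      p.2.2 := Primrec.snd.comp Primrec.snd
    have b0 := primrec_getD 0 ([], []) hb
    have b1 := primrec_getD 1 ([], []) hb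
    have b00 := Primrec.fst.comp b0
    have b01 := Primrec.snd.comp b0
    have b10 := Primrec.fst.comp b1
    have b11 := Primrec.snd.comp b1
    refine primrec_sumElim_fin (Primrec.fst.comp Primrec.snd) ?_ fun i => ?_
    · refine primrec_sumElim Primrec.snd ?_ ?_
      · have h : Primrec fun x : ((QType κ × QTypeLabel κ × List (List (QType κ) × List (QType κ))) ×
          (ℕ ⊕ κ)) × ℕ => [(QType.var x.2 : QType κ)] :=
          primrec_singleton (QType.var_primrec.comp Primrec.snd)
        exact Primrec.pair h (primrec_withBang h)
      · have h : Primrec fun x : ((QType κ × QTypeLabel κ × List (List (QType κ) × List (QType κ))) ×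
          (ℕ ⊕ κ)) × κ => [QType.const x.2] :=
          primrec_singleton (QType.const_primrec.comp Primrec.snd)
        exact Primrec.pair h (primrec_withBang h)
    · fin_cases i
      · exact Primrec.const _
      · exact Primrec.const _
      · exact Primrec.const _
      · refine Primrec.pair (Primrec.list_append.comp (primrec_withBang ?_) b00) ?_
        · have := primrec_filter (p := fun _ (B : QType κ) => (!B.isBang) = true) b00
            (primrecPred_eq (Primrec.not.comp (QType.isBang_primrec.comp Primrec.snd))
              (Primrec.const true))
          exact this.of_eq fun _ => by simp only [Bool.decide_eq_true]
        · have := primrec_filter (p := fun _ (B : QType κ) => B.isBang = true) b01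
            (primrecPred_eq (QType.isBang_primrec.comp Primrec.snd) (Primrec.const true))
          exact this.of_eq fun _ => by simp only [Bool.decide_eq_true]
      · exact Primrec.pair (primrec_pairwise QType.lolli_primrec b01 b10)
          (primrec_withBang (primrec_pairwise QType.lolli_primrec b00 b11))
      · exact Primrec.pair (primrec_pairwise QType.tensor_primrec b00 b10)
          (primrec_withBang (primrec_pairwise QType.tensor_primrec b01 b11))
  have h := evalWord_primrec (F := fun _ => boundsStep) qtypeArity_primrec hF QType.word_primrec
  refine (primrec_getD 0 ([], []) h).of_eq fun A => ?_
  rw [A.evalsTo_bounds.evalWord]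
  rfl

theorem QType.pow_primrec : Primrec fun n : ℕ => (QType.qbit.pow n : QType κ) := by
  -- The recursion starts at exponent `1`, since the unit type at exponent `0` does not occur as a
  -- factor of the higher powers.
  have h : Primrec fun n : ℕ => (Nat.rec .qbit (fun _ A => .tensor .qbit A) n : QType κ) :=
    Primrec.nat_rec₁ _ (QType.tensor_primrec (Primrec.const _) Primrec.snd).to₂
  have h' := Primrec.nat_casesOn Primrec.id (Primrec.const (.top : QType κ))
    (h.comp Primrec.snd).to₂
  refine h'.of_eq fun n => ?_
  cases n with
  | zero => rfl
  | succ n =>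
    change Nat.rec .qbit (fun _ A => .tensor .qbit A) n = QType.qbit.pow (n + 1)
    induction n with
    | zero => rfl
    | succ n ih => exact congrArg (QType.tensor .qbit) ih

theorem SCtx.decorations_primrec : Primrec (SCtx.decorations (κ := κ)) := by
  refine primrec_sections.comp (Primrec.list_map Primrec.id ?_)
  refine Primrec.list_cons.comp (Primrec.const none) ?_
  refine Primrec.list_map ?_ (Primrec.option_some.comp Primrec.snd).to₂
  exact Primrec.list_flatMap (Primrec.optionToList.comp Primrec.snd)
    (IType.decorations_primrec.comp Primrec.snd).to₂

theorem decorationsOf_primrec {G : Type} [Primcodable G] :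
    Primrec (decorationsOf (G := G) (κ := κ)) := by
  refine Primrec.list_flatMap (SCtx.decorations_primrec.comp Primrec.fst) ?_
  refine Primrec.list_map (IType.decorations_primrec.comp
    (Primrec.snd.comp (Primrec.snd.comp Primrec.fst))) ?_
  exact Primrec.pair (Primrec.snd.comp Primrec.fst) (Primrec.pair
    (Primrec.fst.comp (Primrec.snd.comp (Primrec.fst.comp Primrec.fst))) Primrec.snd)

end Types

/-! ### Computations on terms -/

section Terms

variable {G : Type}

/-- The outermost construct of a term. -/
def Term.label : Term G → TermLabel G
  | .var n => .inl (.inl n)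
  | .const (.gate g) => .inl (.inr g)
  | .const .zero => .inr 0
  | .const .one => .inr 1
  | .const .meas => .inr 2
  | .const .new => .inr 3
  | .star => .inr 4
  | .app _ _ => .inr 5
  | .lam _ => .inr 6
  | .ite _ _ _ => .inr 7
  | .pair _ _ => .inr 8
  | .letp _ _ => .inr 9

theorem Term.label_primrec [Primcodable G] : Primrec (Term.label (G := G)) := by
  -- Words of terms are nonempty, so the default label is never used.
  refine (Primrec.option_getD.comp (Primrec.list_head?.comp Term.word_primrec)
    (Primrec.const (.inr 0))).of_eq fun M => ?_
  cases M with
  | const c => cases c <;> simp [Term.label]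
  | _ => simp [Term.label]

/-- The variables in `l` as seen from outside of `k` binders. -/
def unshift (k : ℕ) (l : List ℕ) : List ℕ := (l.filter fun x => k ≤ x).map fun x => x - k

theorem mem_unshift {k x : ℕ} {l : List ℕ} : x ∈ unshift k l ↔ x + k ∈ l := by
  simp only [unshift, List.mem_map, List.mem_filter, decide_eq_true_eq]
  constructor
  · rintro ⟨y, ⟨h1, h2⟩, rfl⟩
    rwa [Nat.sub_add_cancel h2]
  · intro h
    exact ⟨x + k, ⟨h, by omega⟩, by omega⟩

/-- The list of the free variables of a term. -/
def Term.freeVars : Term G → List ℕ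
  | .var n => [n]
  | .const _ => []
  | .star => []
  | .app M N => M.freeVars ++ N.freeVars
  | .lam M => unshift 1 M.freeVars
  | .ite P M N => P.freeVars ++ M.freeVars ++ N.freeVars
  | .pair M N => M.freeVars ++ N.freeVars
  | .letp M N => M.freeVars ++ unshift 2 N.freeVars

theorem Term.mem_freeVars {M : Term G} {x : ℕ} : x ∈ M.freeVars ↔ M.Free x := by
  induction M generalizing x <;> simp_all [Term.freeVars, Term.Free, mem_unshift]

/-- Computes the free variables of a term from those of its components. -/
def freeVarsStep (l : TermLabel G) (bs : List (List ℕ)) : List ℕ :=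
  Sum.elim (Sum.elim (fun n => [n]) (fun _ => []))
    (fun i : Fin 10 => match i with
      | 6 => unshift 1 (bs.getD 0 [])
      | 9 => bs.getD 0 [] ++ unshift 2 (bs.getD 1 [])
      | _ => bs.flatten) l

theorem Term.evalsTo_freeVars (M : Term G) :
    EvalsTo termArity freeVarsStep M.word M.freeVars := by
  induction M with
  | var n => exact EvalsTo.node₀ rfl
  | const c => cases c <;> exact EvalsTo.node₀ rfl
  | star => exact EvalsTo.node₀ rfl
  | lam M hM => rw [Term.word_lam]; exact EvalsTo.node₁ rfl hM
  | letp M N hM hN => rw [Term.word_letp]; exact EvalsTo.node₂ rfl hM hN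
  | app M N hM hN =>
    rw [Term.word_app]
    have h := EvalsTo.node₂ (n := .inr 5) rfl hM hN
    simpa [freeVarsStep, Term.freeVars] using h
  | pair M N hM hN =>
    rw [Term.word_pair]
    have h := EvalsTo.node₂ (n := .inr 8) rfl hM hN
    simpa [freeVarsStep, Term.freeVars] using h
  | ite P M N hP hM hN =>
    rw [Term.word_ite]
    have h := EvalsTo.node₃ (n := .inr 7) rfl hP hM hN
    simpa [freeVarsStep, Term.freeVars] using h

theorem primrec_unshift {α : Type} [Primcodable α] (k : ℕ) {f : α → List ℕ} (hf : Primrec f) :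
    Primrec fun a => unshift k (f a) :=
  Primrec.list_map (primrec_filter (p := fun _ x => k ≤ x) hf
    (Primrec.nat_le.comp (Primrec.const k) Primrec.snd))
    (Primrec.nat_sub.comp Primrec.snd (Primrec.const k)).to₂

theorem Term.freeVars_primrec [Primcodable G] : Primrec (Term.freeVars (G := G)) := by
  have hF : Primrec fun p : Term G × TermLabel G × List (List ℕ) => freeVarsStep p.2.1 p.2.2 := by
    have hb : Primrec fun p : Term G × TermLabel G × List (List ℕ) => p.2.2 :=
      Primrec.snd.comp Primrec.snd
    have hd := Primrec.list_flatten.comp hb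
    refine primrec_sumElim_fin (Primrec.fst.comp Primrec.snd) ?_ fun i => ?_
    · exact primrec_sumElim Primrec.snd (primrec_singleton Primrec.snd) (Primrec.const [])
    · fin_cases i
      · exact hd
      · exact hd
      · exact hd
      · exact hd
      · exact hd
      · exact hd
      · exact primrec_unshift 1 (primrec_getD 0 [] hb)
      · exact hd
      · exact hd
      · exact Primrec.list_append.comp (primrec_getD 0 [] hb)
          (primrec_unshift 2 (primrec_getD 1 [] hb))
  have h := evalWord_primrec (F := fun _ => freeVarsStep) termArity_primrec hF Term.word_primrec
  refine (primrec_getD 0 [] h).of_eq fun M => ?_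
  rw [M.evalsTo_freeVars.evalWord]
  rfl

end Terms

/-! ### Searching for derivations -/

section Search

variable {N J : Type}

/-- The derivations, written out as a conclusion and the list of the judgements above it, that are
obtained from given derivations of the premises; `R n rs` are the conclusions that the rule for the
node `n` draws from the premises `rs`. -/
def derivStep (R : N → List J → List J) (n : N) (Ss : List (List (J × List J))) :
    List (J × List J) :=
  Ss.sections.flatMap fun cs =>
    (R n (cs.map Prod.fst)).map fun j => (j, (cs.map fun c => c.1 :: c.2).flatten)

variable {R : N → List J → List J} {n : N} {j : J} {l : List J}

/-- A section picks one derivation for each premise; their judgement lists are concatenated in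
prefix order above the new conclusion. -/
theorem mem_derivStep {Ss : List (List (J × List J))} :
    (j, l) ∈ derivStep R n Ss ↔ ∃ cs, List.Forall₂ (· ∈ ·) cs Ss ∧ j ∈ R n (cs.map Prod.fst) ∧
      (cs.map fun c => c.1 :: c.2).flatten = l := by
  simp [derivStep, List.mem_sections]

theorem mem_derivStep₀ : (j, l) ∈ derivStep R n [] ↔ j ∈ R n [] ∧ l = [] := by
  simp [mem_derivStep, eq_comm]

theorem mem_derivStep₁ {S : List (J × List J)} :
    (j, l) ∈ derivStep R n [S] ↔ ∃ r k, (r, k) ∈ S ∧ j ∈ R n [r] ∧ r :: k = l := by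
  rw [mem_derivStep]
  constructor
  · rintro ⟨_, _ | ⟨h, _ | _⟩, hj, hl⟩
    exact ⟨_, _, h, hj, by simpa using hl⟩
  · rintro ⟨r, k, h, hj, hl⟩
    exact ⟨[(r, k)], .cons h .nil, hj, by simpa using hl⟩

theorem mem_derivStep₂ {S T : List (J × List J)} :
    (j, l) ∈ derivStep R n [S, T] ↔ ∃ r k r' k', (r, k) ∈ S ∧ (r', k') ∈ T ∧ j ∈ R n [r, r'] ∧
      (r :: k) ++ (r' :: k') = l := by
  rw [mem_derivStep]
  constructor
  · rintro ⟨_, _ | ⟨h, _ | ⟨h', _ | _⟩⟩, hj, hl⟩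
    exact ⟨_, _, _, _, h, h', hj, by simpa using hl⟩
  · rintro ⟨r, k, r', k', h, h', hj, hl⟩
    exact ⟨[(r, k), (r', k')], .cons h (.cons h' .nil), hj, by simpa using hl⟩

theorem mem_derivStep₃ {S T V : List (J × List J)} :
    (j, l) ∈ derivStep R n [S, T, V] ↔ ∃ r k r' k' r'' k'', (r, k) ∈ S ∧ (r', k') ∈ T ∧
      (r'', k'') ∈ V ∧ j ∈ R n [r, r', r''] ∧ (r :: k) ++ (r' :: k') ++ (r'' :: k'') = l := by
  rw [mem_derivStep]
  constructor
  · rintro ⟨_, _ | ⟨h, _ | ⟨h', _ | ⟨h'', _ | _⟩⟩⟩, hj, hl⟩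
    exact ⟨_, _, _, _, _, _, h, h', h'', hj, by simpa using hl⟩
  · rintro ⟨r, k, r', k', r'', k'', h, h', h'', hj, hl⟩
    exact ⟨[(r, k), (r', k'), (r'', k'')], .cons h (.cons h' (.cons h'' .nil)), hj,
      by simpa using hl⟩

theorem derivStep_primrec {α : Type} [Primcodable α] [Primcodable N] [Primcodable J]
    {R : α → N → List J → List J} (hR : Primrec fun p : α × N × List J => R p.1 p.2.1 p.2.2) :
    Primrec fun p : α × N × List (List (J × List J)) => derivStep (R p.1) p.2.1 p.2.2 := by
  refine Primrec.list_flatMap (primrec_sections.comp (Primrec.snd.comp Primrec.snd)) ?_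
  refine Primrec.list_map (hR.comp (Primrec.pair (Primrec.fst.comp Primrec.fst)
    (Primrec.pair (Primrec.fst.comp (Primrec.snd.comp Primrec.fst)) ?_))) ?_
  · exact Primrec.list_map Primrec.snd (Primrec.fst.comp Primrec.snd)
  · refine Primrec.pair Primrec.snd (Primrec.list_flatten.comp ?_)
    refine Primrec.list_map (Primrec.snd.comp Primrec.fst) ?_
    exact Primrec.list_cons.comp (Primrec.fst.comp Primrec.snd) (Primrec.snd.comp Primrec.snd)

end Search

/-! ### Deciding whether a quantum rule applies -/

section Rules

variable {G κ : Type}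

/-- The relation `Split` at one variable. -/
def SplitEntry (e e₁ e₂ : Option (QType κ)) : Prop :=
  (e₁ = e ∨ e₁ = none) ∧ (e₂ = e ∨ e₂ = none) ∧ (e₁ = e ∨ e₂ = e) ∧
    (e₁ = none ∨ e₂ = none ∨ ∃ A ∈ e.toList, A.isBang = true)

theorem splitEntry_none {e₁ e₂ : Option (QType κ)} :
    SplitEntry none e₁ e₂ ↔ e₁ = none ∧ e₂ = none := by
  simp only [SplitEntry]; tauto

theorem splitEntry_some {A : QType κ} {e₁ e₂ : Option (QType κ)} :
    SplitEntry (some A) e₁ e₂ ↔ e₁ = some A ∧ e₂ = none ∨ e₁ = none ∧ e₂ = some A ∨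
      e₁ = some A ∧ e₂ = some A ∧ ∃ B, A = .bang B := by
  rcases e₁ with _ | A₁ <;> rcases e₂ with _ | A₂ <;> simp [SplitEntry, QType.isBang_iff]
  tauto

/-- The inductive relation is turned into a quantifier over finitely many positions, which makes it
primitive recursive. -/
theorem split_iff {Γ Γ₁ Γ₂ : QCtx κ} :
    Split Γ Γ₁ Γ₂ ↔ Γ₁.length = Γ.length ∧ Γ₂.length = Γ.length ∧
      ∀ x ∈ List.range Γ.length, SplitEntry (Γ.getD x none) (Γ₁.getD x none) (Γ₂.getD x none) := by
  induction Γ generalizing Γ₁ Γ₂ with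
  | nil =>
    constructor
    · rintro ⟨⟩; simp
    · rintro ⟨h₁, h₂, -⟩
      rw [List.length_eq_zero_iff.1 h₁, List.length_eq_zero_iff.1 h₂]
      exact .nil
  | cons e Γ ih =>
    cases Γ₁ with
    | nil => exact iff_of_false (by rintro ⟨⟩) (by simp)
    | cons e₁ Γ₁ =>
      cases Γ₂ with
      | nil => exact iff_of_false (by rintro ⟨⟩) (by simp)
      | cons e₂ Γ₂ =>
        simp only [List.length_cons, List.range_succ_eq_map, List.forall_mem_cons,
          List.getD_cons_zero, List.forall_mem_map, List.getD_cons_succ, add_left_inj]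
        have : Split (e :: Γ) (e₁ :: Γ₁) (e₂ :: Γ₂) ↔ SplitEntry e e₁ e₂ ∧ Split Γ Γ₁ Γ₂ := by
          cases e with
          | none =>
            rw [splitEntry_none]
            constructor
            · rintro (_ | h); exact ⟨⟨rfl, rfl⟩, h⟩
            · rintro ⟨⟨rfl, rfl⟩, h⟩; exact h.none
          | some A =>
            rw [splitEntry_some]
            constructor
            · rintro (_ | _ | ⟨_, h⟩ | ⟨_, h⟩ | ⟨_, h⟩)
              · exact ⟨.inl ⟨rfl, rfl⟩, h⟩
              · exact ⟨.inr (.inl ⟨rfl, rfl⟩), h⟩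
              · exact ⟨.inr (.inr ⟨rfl, rfl, _, rfl⟩), h⟩
            · rintro ⟨⟨rfl, rfl⟩ | ⟨rfl, rfl⟩ | ⟨rfl, rfl, B, rfl⟩, h⟩
              · exact h.left _
              · exact h.right _
              · exact h.both _
        rw [this, ih]
        tauto

theorem promotable_iff {Γ : QCtx κ} {M : Term G} :
    Promotable Γ M ↔ ∀ y ∈ unshift 1 M.freeVars, ∀ A ∈ (Γ.getD y none).toList,
      A.isBang = true := by
  simp only [Promotable, mem_unshift, Term.mem_freeVars, QType.isBang_iff, Option.mem_toList,
    List.getD_eq_getElem?_getD]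
  refine forall_congr' fun x => ?_
  constructor
  · intro h hx A hA
    refine h A ?_ hx
    cases hc : Γ[x]? with
    | none => simp [hc] at hA
    | some e => simpa [hc] using hA
  · intro h A hA hx
    exact h hx A (by simp [hA])

/-- `PairStep B₁ B₂ A`: the rules for pairs assign the type `A` to a pair of terms of types `B₁`
and `B₂`, provided these have no repeated exponentials. -/
def PairStep (B₁ B₂ A : QType κ) : Prop :=
  A = .tensor B₁ B₂ ∨ (B₁.isBang = true ∧ B₂.isBang = true) ∧
    ∃ X ∈ B₁.bounds.1, (X = B₁ ∨ X.bang = B₁) ∧ ∃ Y ∈ B₂.bounds.1, (Y = B₂ ∨ Y.bang = B₂) ∧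
      A = .bang (.tensor X Y)

/-- The same relation serves the introduction and the elimination of pairs, as both link two types
to a tensor in the same way. Searching `X` and `Y` among the supertypes bounds the choice of `τ` and
`σ`, and the basic rules with `n = 1` are the case `τ = σ = 0`. -/
theorem pairStep_iff {B₁ B₂ A : QType κ} (h₁ : B₁.NoRepeat) (h₂ : B₂.NoRepeat) :
    PairStep B₁ B₂ A ↔ A = .tensor B₁ B₂ ∨ ∃ (A₁ A₂ : QType κ) (τ σ : Fin 2), B₁ = .bang A₁ ∧
      B₂ = .bang A₂ ∧ A = .bang (.tensor (.nbang τ A₁) (.nbang σ A₂)) := by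
  refine or_congr_right ?_
  -- The alternative `X.bang = !A` corresponds to `τ = 0`, and `X = !A` to `τ = 1`.
  have key : ∀ {A X : QType κ}, (QType.bang A).NoRepeat →
      (X ∈ (QType.bang A).bounds.1 ∧ (X = .bang A ∨ X.bang = .bang A) ↔
        ∃ τ : Fin 2, X = .nbang τ A) := by
    intro A X hA
    rw [Fin.exists_fin_two, QType.mem_supertypes]
    simp only [QType.bang.injEq]
    constructor
    · rintro ⟨-, rfl | rfl⟩
      · exact .inr rfl
      · exact .inl rfl
    · rintro (rfl | rfl)
      · exact ⟨⟨hA.2, (SubType.refl _).derelict⟩, .inr rfl⟩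
      · exact ⟨⟨hA, SubType.refl _⟩, .inl rfl⟩
  rw [QType.isBang_iff, QType.isBang_iff]
  constructor
  · rintro ⟨⟨⟨A₁, rfl⟩, A₂, rfl⟩, X, hX, hX', Y, hY, hY', rfl⟩
    obtain ⟨τ, rfl⟩ := (key h₁).1 ⟨hX, hX'⟩
    obtain ⟨σ, rfl⟩ := (key h₂).1 ⟨hY, hY'⟩
    exact ⟨A₁, A₂, τ, σ, rfl, rfl, rfl⟩
  · rintro ⟨A₁, A₂, τ, σ, rfl, rfl, rfl⟩
    obtain ⟨hX, hX'⟩ := (key h₁).2 ⟨τ, rfl⟩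
    obtain ⟨hY, hY'⟩ := (key h₂).2 ⟨σ, rfl⟩
    exact ⟨⟨⟨A₁, rfl⟩, A₂, rfl⟩, _, hX, hX', _, hY, hY', rfl⟩

/-- The `k`-th premise. -/
def premise (rs : List (QJudgement G κ)) (k : ℕ) : QJudgement G κ := rs.getD k ([], .star, .top)

/-- Whether the judgement `j` follows by a quantum rule from the premises `rs`, when no repeated
exponentials occur and the terms fit; `a` is the arity of the gate if the subject is a gate. -/
def IsStep (a : ℕ) (j : QJudgement G κ) (rs : List (QJudgement G κ)) : Prop :=
  Sum.elim (Sum.elim (fun x => ∃ B ∈ (j.1.getD x none).toList, j.2.2 ∈ B.bounds.1)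
    (fun _ => j.2.2 ∈ (QType.bang (.lolli (QType.qbit.pow a) (QType.qbit.pow a))).bounds.1))
    (fun i : Fin 10 => match i with
      | 0 => j.2.2 ∈ (QType.bang .bit : QType κ).bounds.1
      | 1 => j.2.2 ∈ (QType.bang .bit : QType κ).bounds.1
      | 2 => j.2.2 ∈ (QType.bang (.lolli .qbit (.bang .bit)) : QType κ).bounds.1
      | 3 => j.2.2 ∈ (QType.bang (.lolli .bit .qbit) : QType κ).bounds.1
      | 4 => j.2.2 = .top ∨ j.2.2 = .bang .top
      | 5 => Split j.1 (premise rs 0).1 (premise rs 1).1 ∧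
          (premise rs 0).2.2 = .lolli (premise rs 1).2.2 j.2.2
      | 6 => ∃ B ∈ ((premise rs 0).1.getD 0 none).toList, (premise rs 0).1 = some B :: j.1 ∧
          (j.2.2 = .lolli B (premise rs 0).2.2 ∨
            j.2.2 = .bang (.lolli B (premise rs 0).2.2) ∧ Promotable j.1 (premise rs 0).2.1)
      | 7 => Split j.1 (premise rs 0).1 (premise rs 1).1 ∧
          (premise rs 2).1 = (premise rs 1).1 ∧ (premise rs 0).2.2 = .bit ∧
          (premise rs 1).2.2 = j.2.2 ∧ (premise rs 2).2.2 = j.2.2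
      | 8 => Split j.1 (premise rs 0).1 (premise rs 1).1 ∧
          PairStep (premise rs 0).2.2 (premise rs 1).2.2 j.2.2
      | 9 => ∃ X ∈ ((premise rs 1).1.getD 0 none).toList,
          ∃ Y ∈ ((premise rs 1).1.getD 1 none).toList,
          (premise rs 1).1 = some X :: some Y :: (premise rs 1).1.drop 2 ∧
          Split j.1 (premise rs 0).1 ((premise rs 1).1.drop 2) ∧
          PairStep X Y (premise rs 0).2.2 ∧ (premise rs 1).2.2 = j.2.2) j.2.1.label

/-! ### Primitive recursiveness of the rule check -/

section Primrec

variable [Primcodable G] [Primcodable κ] {α : Type} [Primcodable α]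

theorem primrec_optionToList_getD {β : Type} [Primcodable β] {f : α → List (Option β)} {k : α → ℕ}
    (hf : Primrec f) (hk : Primrec k) : Primrec fun a => ((f a).getD (k a) none).toList :=
  Primrec.optionToList.comp ((Primrec.list_getD none).comp hf hk)

theorem primrecPred_isBang {f : α → QType κ} (hf : Primrec f) :
    PrimrecPred fun a => (f a).isBang = true :=
  primrecPred_eq (QType.isBang_primrec.comp hf) (Primrec.const true)

theorem primrecPred_splitEntry {f g h : α → Option (QType κ)} (hf : Primrec f) (hg : Primrec g)
    (hh : Primrec h) : PrimrecPred fun a => SplitEntry (f a) (g a) (h a) := by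
  have hb : PrimrecPred fun a => ∃ A ∈ (f a).toList, A.isBang = true :=
    primrecPred_exists_mem (p := fun _ A => A.isBang = true) (Primrec.optionToList.comp hf)
      (primrecPred_isBang Primrec.snd)
  have hn : Primrec fun _ : α => (none : Option (QType κ)) := Primrec.const none
  exact ((primrecPred_eq hg hf).or (primrecPred_eq hg hn)).and
    (((primrecPred_eq hh hf).or (primrecPred_eq hh hn)).and
    (((primrecPred_eq hg hf).or (primrecPred_eq hh hf)).and
    ((primrecPred_eq hg hn).or ((primrecPred_eq hh hn).or hb))))

theorem primrecPred_split {f g h : α → QCtx κ} (hf : Primrec f) (hg : Primrec g)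
    (hh : Primrec h) : PrimrecPred fun a => Split (f a) (g a) (h a) := by
  have hl : PrimrecPred fun a => ∀ x ∈ List.range (f a).length,
      SplitEntry ((f a).getD x none) ((g a).getD x none) ((h a).getD x none) := by
    refine primrecPred_forall_mem (p := fun a x =>
      SplitEntry ((f a).getD x none) ((g a).getD x none) ((h a).getD x none))
      (Primrec.list_range.comp (Primrec.list_length.comp hf)) ?_
    exact primrecPred_splitEntry ((Primrec.list_getD none).comp (hf.comp Primrec.fst) Primrec.snd)
      ((Primrec.list_getD none).comp (hg.comp Primrec.fst) Primrec.snd)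
      ((Primrec.list_getD none).comp (hh.comp Primrec.fst) Primrec.snd)
  refine PrimrecPred.of_eq ((primrecPred_eq (Primrec.list_length.comp hg)
    (Primrec.list_length.comp hf)).and ((primrecPred_eq (Primrec.list_length.comp hh)
    (Primrec.list_length.comp hf)).and hl)) fun a => split_iff.symm

theorem primrecPred_promotable {f : α → QCtx κ} {g : α → Term G} (hf : Primrec f)
    (hg : Primrec g) : PrimrecPred fun a => Promotable (f a) (g a) := by
  refine PrimrecPred.of_eq (primrecPred_forall_mem (p := fun a y =>
    ∀ A ∈ ((f a).getD y none).toList, A.isBang = true)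
    (primrec_unshift 1 (Term.freeVars_primrec.comp hg)) ?_) fun a => promotable_iff.symm
  exact primrecPred_forall_mem (p := fun _ (A : QType κ) => A.isBang = true)
    (primrec_optionToList_getD (hf.comp Primrec.fst) Primrec.snd) (primrecPred_isBang Primrec.snd)

theorem primrec_supertypes {f : α → QType κ} (hf : Primrec f) :
    Primrec fun a => (f a).bounds.1 :=
  Primrec.fst.comp (QType.bounds_primrec.comp hf)

theorem primrecPred_pairStep {f g h : α → QType κ} (hf : Primrec f) (hg : Primrec g)
    (hh : Primrec h) : PrimrecPred fun a => PairStep (f a) (g a) (h a) := by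
  refine (primrecPred_eq hh (QType.tensor_primrec hf hg)).or
    (((primrecPred_isBang hf).and (primrecPred_isBang hg)).and ?_)
  refine primrecPred_exists_mem (p := fun a X => (X = f a ∨ X.bang = f a) ∧
    ∃ Y ∈ (g a).bounds.1, (Y = g a ∨ Y.bang = g a) ∧ h a = .bang (.tensor X Y))
    (primrec_supertypes hf) ?_
  refine ((primrecPred_eq Primrec.snd (hf.comp Primrec.fst)).or
    (primrecPred_eq (QType.bang_primrec Primrec.snd) (hf.comp Primrec.fst))).and ?_
  refine primrecPred_exists_mem (p := fun (x : α × QType κ) Y => (Y = g x.1 ∨ Y.bang = g x.1) ∧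
    h x.1 = .bang (.tensor x.2 Y)) (primrec_supertypes (hg.comp Primrec.fst)) ?_
  have hg' := hg.comp (Primrec.fst.comp (Primrec.fst (α := α × QType κ) (β := QType κ)))
  refine ((primrecPred_eq Primrec.snd hg').or
    (primrecPred_eq (QType.bang_primrec Primrec.snd) hg')).and ?_
  exact primrecPred_eq (hh.comp (Primrec.fst.comp Primrec.fst))
    (QType.bang_primrec (QType.tensor_primrec (Primrec.snd.comp Primrec.fst) Primrec.snd))

theorem isStep_primrec : PrimrecPred fun p : ℕ × QJudgement G κ × List (QJudgement G κ) =>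
    IsStep p.1 p.2.1 p.2.2 := by
  have hj : Primrec fun p : ℕ × QJudgement G κ × List (QJudgement G κ) => p.2.1 :=
    Primrec.fst.comp Primrec.snd
  have hc := Primrec.fst.comp hj
  have hA := Primrec.snd.comp (Primrec.snd.comp hj)
  have hr : ∀ k, Primrec fun p : ℕ × QJudgement G κ × List (QJudgement G κ) =>
      premise p.2.2 k := fun k => primrec_getD k _ (Primrec.snd.comp Primrec.snd)
  have rc := fun k => Primrec.fst.comp (hr k)
  have rM := fun k => Primrec.fst.comp (Primrec.snd.comp (hr k))
  have rA := fun k => Primrec.snd.comp (Primrec.snd.comp (hr k))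
  refine primrecPred_sumElim_fin (Term.label_primrec.comp (Primrec.fst.comp (Primrec.snd.comp hj)))
    ?_ fun i => ?_
  · refine primrecPred_sumElim Primrec.snd ?_ ?_
    · refine primrecPred_exists_mem (p := fun (x : ((ℕ × QJudgement G κ × List (QJudgement G κ)) ×
        (ℕ ⊕ G)) × ℕ) (B : QType κ) => x.1.1.2.1.2.2 ∈ B.bounds.1)
        (primrec_optionToList_getD (hc.comp (Primrec.fst.comp Primrec.fst)) Primrec.snd) ?_
      exact primrecPred_mem (hA.comp (Primrec.fst.comp (Primrec.fst.comp Primrec.fst)))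
        (primrec_supertypes Primrec.snd)
    · have hp := QType.pow_primrec (κ := κ) |>.comp (Primrec.fst.comp (Primrec.fst.comp
        (Primrec.fst (α := (ℕ × QJudgement G κ × List (QJudgement G κ)) × (ℕ ⊕ G)) (β := G))))
      exact primrecPred_mem (hA.comp (Primrec.fst.comp Primrec.fst))
        (primrec_supertypes (QType.bang_primrec (QType.lolli_primrec hp hp)))
  · fin_cases i
    · exact primrecPred_mem hA (Primrec.const _)
    · exact primrecPred_mem hA (Primrec.const _)
    · exact primrecPred_mem hA (Primrec.const _)
    · exact primrecPred_mem hA (Primrec.const _)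
    · exact (primrecPred_eq hA (Primrec.const _)).or (primrecPred_eq hA (Primrec.const _))
    · exact (primrecPred_split hc (rc 0) (rc 1)).and
        (primrecPred_eq (rA 0) (QType.lolli_primrec (rA 1) hA))
    · refine primrecPred_exists_mem (p := fun (p : ℕ × QJudgement G κ × List (QJudgement G κ))
        (B : QType κ) => (premise p.2.2 0).1 = some B :: p.2.1.1 ∧
          (p.2.1.2.2 = .lolli B (premise p.2.2 0).2.2 ∨
            p.2.1.2.2 = .bang (.lolli B (premise p.2.2 0).2.2) ∧
              Promotable p.2.1.1 (premise p.2.2 0).2.1))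
        (primrec_optionToList_getD (rc 0) (Primrec.const 0)) ?_
      have hl := QType.lolli_primrec Primrec.snd ((rA 0).comp Primrec.fst)
      exact (primrecPred_eq ((rc 0).comp Primrec.fst) (Primrec.list_cons.comp
        (Primrec.option_some.comp Primrec.snd) (hc.comp Primrec.fst))).and
        ((primrecPred_eq (hA.comp Primrec.fst) hl).or
          ((primrecPred_eq (hA.comp Primrec.fst) (QType.bang_primrec hl)).and
            (primrecPred_promotable (hc.comp Primrec.fst) ((rM 0).comp Primrec.fst))))
    · exact (primrecPred_split hc (rc 0) (rc 1)).and ((primrecPred_eq (rc 2) (rc 1)).and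
        ((primrecPred_eq (rA 0) (Primrec.const _)).and
          ((primrecPred_eq (rA 1) hA).and (primrecPred_eq (rA 2) hA))))
    · exact (primrecPred_split hc (rc 0) (rc 1)).and (primrecPred_pairStep (rA 0) (rA 1) hA)
    · refine primrecPred_exists_mem (p := fun (p : ℕ × QJudgement G κ × List (QJudgement G κ))
        (X : QType κ) => ∃ Y ∈ ((premise p.2.2 1).1.getD 1 none).toList,
          (premise p.2.2 1).1 = some X :: some Y :: (premise p.2.2 1).1.drop 2 ∧
          Split p.2.1.1 (premise p.2.2 0).1 ((premise p.2.2 1).1.drop 2) ∧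
          PairStep X Y (premise p.2.2 0).2.2 ∧ (premise p.2.2 1).2.2 = p.2.1.2.2)
        (primrec_optionToList_getD (rc 1) (Primrec.const 0)) ?_
      refine primrecPred_exists_mem (p := fun (x : (ℕ × QJudgement G κ × List (QJudgement G κ)) ×
          QType κ) (Y : QType κ) =>
          (premise x.1.2.2 1).1 = some x.2 :: some Y :: (premise x.1.2.2 1).1.drop 2 ∧
          Split x.1.2.1.1 (premise x.1.2.2 0).1 ((premise x.1.2.2 1).1.drop 2) ∧
          PairStep x.2 Y (premise x.1.2.2 0).2.2 ∧ (premise x.1.2.2 1).2.2 = x.1.2.1.2.2)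
        (primrec_optionToList_getD ((rc 1).comp Primrec.fst) (Primrec.const 1)) ?_
      have h2 := Primrec.fst.comp (Primrec.fst
        (α := (ℕ × QJudgement G κ × List (QJudgement G κ)) × QType κ) (β := QType κ))
      have hd := Primrec.list_drop.comp (Primrec.const 2) ((rc 1).comp h2)
      exact (primrecPred_eq ((rc 1).comp h2) (Primrec.list_cons.comp
        (Primrec.option_some.comp (Primrec.snd.comp Primrec.fst))
        (Primrec.list_cons.comp (Primrec.option_some.comp Primrec.snd) hd))).and
        ((primrecPred_split (hc.comp h2) ((rc 0).comp h2) hd).and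
        ((primrecPred_pairStep (Primrec.snd.comp Primrec.fst) Primrec.snd ((rA 0).comp h2)).and
        (primrecPred_eq ((rA 1).comp h2) (hA.comp h2))))

end Primrec

end Rules

/-! ### The search for decorations -/

section Check

variable {G κ : Type} {arity : G → ℕ}

/-- The judgement `j` and the judgements `l` above it make up a decoration of `π`, up to a
restriction of contexts, without repeated exponentials. -/
def SDeriv.Decorated {Γ : SCtx κ} {M : Term G} {U : IType κ} (π : SDeriv arity Γ M U)
    (j : QJudgement G κ) (l : List (QJudgement G κ)) : Prop :=
  ∃ (Δ : QCtx κ) (A : QType κ) (q : QDeriv arity .extended Δ M A),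
    j = (Δ, M, A) ∧ Δ ∈ Γ.decorations ∧ q.Over π ∧ q.NoRepeat ∧ q.judgements = j :: l

theorem QDeriv.judgements_eq {s : RuleSet} {Γ : QCtx κ} {M : Term G} {A : QType κ}
    (q : QDeriv arity s Γ M A) : q.judgements = (Γ, M, A) :: q.judgements.tail := by
  cases q <;> rfl

open Classical in
/-- The decorations of the judgement `n.1` that follow from the premises `rs`; `n.2` is the arity of
the gate if the subject of the judgement is a gate. -/
noncomputable def conclusions (n : SJudgement G κ × ℕ) (rs : List (QJudgement G κ)) :
    List (QJudgement G κ) :=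
  (decorationsOf n.1).filter fun j => IsStep n.2 j rs

theorem mem_conclusions {Γ : SCtx κ} {M N : Term G} {U : IType κ} {Δ : QCtx κ} {A : QType κ}
    {a : ℕ} {rs : List (QJudgement G κ)} :
    (Δ, N, A) ∈ conclusions ((Γ, M, U), a) rs ↔
      N = M ∧ Δ ∈ Γ.decorations ∧ A ∈ U.decorations ∧ IsStep a (Δ, N, A) rs := by
  simp only [conclusions, List.mem_filter, mem_decorationsOf, decide_eq_true_eq, and_assoc]

/-- The number of premises of a judgement. -/
def premiseArity (n : SJudgement G κ × ℕ) : ℕ := termArity n.1.2.1.label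

/-- The arity of a gate. -/
def gateArity (arity : G → ℕ) (M : Term G) : ℕ :=
  Sum.elim (Sum.elim (fun _ => 0) arity) (fun _ => 0) M.label

/-- Adds the arities of gates to judgements. -/
def annotate (arity : G → ℕ) (j : SJudgement G κ) : SJudgement G κ × ℕ := (j, gateArity arity j.2.1)

theorem mem_decorations_of_over {s : RuleSet} {Γ : QCtx κ} {Γ' : SCtx κ} {M : Term G} {A : QType κ}
    {U : IType κ} {q : QDeriv arity s Γ M A} {π : SDeriv arity Γ' M U} (h : q.Over π)
    (hq : q.NoRepeat) : A ∈ U.decorations :=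
  IType.mem_decorations.2 ⟨h.skel_eq, hq.root.2⟩

theorem noRepeat_of_mem_decorations {Γ : SCtx κ} {U : IType κ} {Δ : QCtx κ} {A : QType κ}
    (hΔ : Δ ∈ Γ.decorations) (hA : A ∈ U.decorations) : Δ.NoRepeat ∧ A.NoRepeat :=
  ⟨(SCtx.mem_decorations.1 hΔ).2.2, (IType.mem_decorations.1 hA).2⟩

theorem le_of_mem_decorations {Γ : SCtx κ} {Δ : QCtx κ} (hΔ : Δ ∈ Γ.decorations) :
    SCtx.Le Δ.skel Γ := (SCtx.mem_decorations.1 hΔ).2.1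

theorem mem_toList_getD {β : Type} {l : List (Option β)} {x : ℕ} {b : β} :
    b ∈ (l.getD x none).toList ↔ l[x]? = some (some b) := by
  rw [List.getD_eq_getElem?_getD]
  cases l[x]? <;> simp

theorem star_type_iff {A : QType κ} (hA : A.NoRepeat) :
    A = .top ∨ A = .bang .top ↔ ∃ n, A = .nbang n .top := by
  constructor
  · rintro (rfl | rfl)
    · exact ⟨0, rfl⟩
    · exact ⟨1, rfl⟩
  · rintro ⟨_ | _ | n, rfl⟩
    · exact .inl rfl
    · exact .inr rfl
    · exact (hA.1 _ rfl).elim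

theorem isStep_const {c : Const G} {Δ : QCtx κ} {A : QType κ} :
    IsStep (gateArity arity (.const c)) (Δ, .const c, A) [] ↔
      A.NoRepeat ∧ SubType (c.type κ arity) A := by
  rw [← QType.mem_supertypes]
  cases c <;> exact Iff.rfl

/-- The invariant of the search: when the part of the word belonging to a subderivation has been
read, the stack holds on top all its decorations without repetition, including those in restricted
contexts. The restrictions must be admitted, since splitting a context produces them in the
premises. -/
theorem SDeriv.evalsTo_check {Γ : SCtx κ} {M : Term G} {U : IType κ} (π : SDeriv arity Γ M U) :
    ∃ S, EvalsTo premiseArity (derivStep conclusions) (π.judgements.map (annotate arity)) S ∧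
      ∀ j l, (j, l) ∈ S ↔ π.Decorated j l := by
  induction π with
  | @ax₁ Γ x U hx =>
    refine ⟨_, EvalsTo.node₀ rfl, fun ⟨Δ, N, A⟩ l => ?_⟩
    rw [mem_derivStep₀, annotate, mem_conclusions]
    constructor
    · rintro ⟨⟨rfl, hΔ, hA, B, hB, h⟩, rfl⟩
      have hn := noRepeat_of_mem_decorations hΔ hA
      exact ⟨Δ, A, .ax₁ (mem_toList_getD.1 hB) (QType.mem_supertypes.1 h).2, rfl, hΔ,
        over_ax₁.2 ⟨le_of_mem_decorations hΔ, (IType.mem_decorations.1 hA).1⟩,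
        noRepeat_ax₁.2 hn, rfl⟩
    · rintro ⟨Δ, A, q, hj, hΔ, ho, hn, hl⟩
      obtain ⟨rfl, rfl, rfl⟩ : _ = _ ∧ _ = _ ∧ _ = _ := by simpa using hj
      have hA := mem_decorations_of_over ho hn
      cases q with
      | ax₁ hx h =>
        exact ⟨⟨rfl, hΔ, hA, _, mem_toList_getD.2 hx, QType.mem_supertypes.2 ⟨hn.root.2, h⟩⟩,
          by simpa [QDeriv.judgements] using hl.symm⟩
  | @ax₂ Γ c U h =>
    refine ⟨_, EvalsTo.node₀ (by cases c <;> rfl), fun ⟨Δ, N, A⟩ l => ?_⟩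
    rw [mem_derivStep₀, annotate, mem_conclusions]
    constructor
    · rintro ⟨⟨rfl, hΔ, hA, h⟩, rfl⟩
      have hn := noRepeat_of_mem_decorations hΔ hA
      exact ⟨Δ, A, .ax₂ (isStep_const.1 h).2, rfl, hΔ, over_ax₂.2 (le_of_mem_decorations hΔ),
        noRepeat_ax₂.2 hn, rfl⟩
    · rintro ⟨Δ, A, q, hj, hΔ, ho, hn, hl⟩
      obtain ⟨rfl, rfl, rfl⟩ : _ = _ ∧ _ = _ ∧ _ = _ := by simpa using hj
      have hA := mem_decorations_of_over ho hn
      cases q with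
      | ax₂ h =>
        exact ⟨⟨rfl, hΔ, hA, isStep_const.2 ⟨hn.root.2, h⟩⟩,
          by simpa [QDeriv.judgements] using hl.symm⟩
  | @star Γ =>
    refine ⟨_, EvalsTo.node₀ rfl, fun ⟨Δ, N, A⟩ l => ?_⟩
    rw [mem_derivStep₀, annotate, mem_conclusions]
    constructor
    · rintro ⟨⟨rfl, hΔ, hA, h⟩, rfl⟩
      have hn := noRepeat_of_mem_decorations hΔ hA
      obtain ⟨n, rfl⟩ := (star_type_iff hn.2).1 h
      exact ⟨Δ, _, .star n, rfl, hΔ, over_star.2 (le_of_mem_decorations hΔ),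
        noRepeat_star.2 hn, rfl⟩
    · rintro ⟨Δ, A, q, hj, hΔ, ho, hn, hl⟩
      obtain ⟨rfl, rfl, rfl⟩ : _ = _ ∧ _ = _ ∧ _ = _ := by simpa using hj
      have hA := mem_decorations_of_over ho hn
      cases q with
      | star n =>
        exact ⟨⟨rfl, hΔ, hA, (star_type_iff hn.root.2).2 ⟨n, rfl⟩⟩,
          by simpa [QDeriv.judgements] using hl.symm⟩
  | @app Γ M N U V d e ihd ihe =>
    obtain ⟨S, hS, hS'⟩ := ihd
    obtain ⟨T, hT, hT'⟩ := ihe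
    refine ⟨_, by
      rw [SDeriv.judgements, List.map_cons, List.map_append]
      exact EvalsTo.node₂ rfl hS hT, fun ⟨Δ, K, A⟩ l => ?_⟩
    simp only [mem_derivStep₂, annotate, mem_conclusions, hS', hT']
    constructor
    · rintro ⟨_, k₁, _, k₂, ⟨Δ₁, A₁, q₁, rfl, -, ho₁, hn₁, hl₁⟩, ⟨Δ₂, A₂, q₂, rfl, -, ho₂, hn₂, hl₂⟩,
        ⟨rfl, hΔ, hA, h, h'⟩, rfl⟩
      obtain rfl : A₁ = .lolli A₂ A := h'
      exact ⟨Δ, A, .app h q₁ q₂, rfl, hΔ, over_app.2 ⟨le_of_mem_decorations hΔ, ho₁, ho₂⟩,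
        noRepeat_app.2 ⟨noRepeat_of_mem_decorations hΔ hA, hn₁, hn₂⟩, by
        rw [← hl₁, ← hl₂]; rfl⟩
    · rintro ⟨Δ, A, q, hj, hΔ, ho, hn, hl⟩
      obtain ⟨rfl, rfl, rfl⟩ : _ = _ ∧ _ = _ ∧ _ = _ := by simpa using hj
      have hA := mem_decorations_of_over ho hn
      cases q with
      | app h q₁ q₂ =>
        obtain ⟨-, ho₁, ho₂⟩ := over_app.1 ho
        obtain ⟨-, hn₁, hn₂⟩ := noRepeat_app.1 hn
        exact ⟨_, _, _, _,
          ⟨_, _, q₁, rfl, (h.mem_decorations hΔ).1, ho₁, hn₁, q₁.judgements_eq⟩,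
          ⟨_, _, q₂, rfl, (h.mem_decorations hΔ).2, ho₂, hn₂, q₂.judgements_eq⟩,
          ⟨rfl, hΔ, hA, h, rfl⟩, by
          rw [← q₁.judgements_eq, ← q₂.judgements_eq]
          simpa [QDeriv.judgements] using hl⟩
  | @ite Γ P M N U p d e ihp ihd ihe =>
    obtain ⟨R, hR, hR'⟩ := ihp
    obtain ⟨S, hS, hS'⟩ := ihd
    obtain ⟨T, hT, hT'⟩ := ihe
    refine ⟨_, by
      rw [SDeriv.judgements, List.map_cons, List.map_append, List.map_append]
      exact EvalsTo.node₃ rfl hR hS hT, fun ⟨Δ, K, A⟩ l => ?_⟩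
    simp only [mem_derivStep₃, annotate, mem_conclusions, hR', hS', hT']
    constructor
    · rintro ⟨_, k₀, _, k₁, _, k₂, ⟨Δ₀, A₀, q₀, rfl, -, ho₀, hn₀, hl₀⟩,
        ⟨Δ₁, A₁, q₁, rfl, -, ho₁, hn₁, hl₁⟩, ⟨Δ₂, A₂, q₂, rfl, -, ho₂, hn₂, hl₂⟩,
        ⟨rfl, hΔ, hA, h, h₁, h₂, h₃, h₄⟩, rfl⟩
      obtain rfl : Δ₂ = Δ₁ := h₁
      obtain rfl : A₀ = .bit := h₂
      obtain rfl : A₁ = A := h₃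
      obtain rfl : A₂ = A₁ := h₄
      exact ⟨Δ, A₂, .ite h q₀ q₁ q₂, rfl, hΔ,
        over_ite.2 ⟨le_of_mem_decorations hΔ, ho₀, ho₁, ho₂⟩,
        noRepeat_ite.2 ⟨noRepeat_of_mem_decorations hΔ hA, hn₀, hn₁, hn₂⟩, by
        rw [← hl₀, ← hl₁, ← hl₂]; rfl⟩
    · rintro ⟨Δ, A, q, hj, hΔ, ho, hn, hl⟩
      obtain ⟨rfl, rfl, rfl⟩ : _ = _ ∧ _ = _ ∧ _ = _ := by simpa using hj
      have hA := mem_decorations_of_over ho hn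
      cases q with
      | ite h q₀ q₁ q₂ =>
        obtain ⟨-, ho₀, ho₁, ho₂⟩ := over_ite.1 ho
        obtain ⟨-, hn₀, hn₁, hn₂⟩ := noRepeat_ite.1 hn
        exact ⟨_, _, _, _, _, _,
          ⟨_, _, q₀, rfl, (h.mem_decorations hΔ).1, ho₀, hn₀, q₀.judgements_eq⟩,
          ⟨_, _, q₁, rfl, (h.mem_decorations hΔ).2, ho₁, hn₁, q₁.judgements_eq⟩,
          ⟨_, _, q₂, rfl, (h.mem_decorations hΔ).2, ho₂, hn₂, q₂.judgements_eq⟩,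
          ⟨rfl, hΔ, hA, h, rfl, rfl, rfl, rfl⟩, by
          rw [← q₀.judgements_eq, ← q₁.judgements_eq, ← q₂.judgements_eq]
          simpa [QDeriv.judgements] using hl⟩
  | @lam Γ M U V d ihd =>
    obtain ⟨S, hS, hS'⟩ := ihd
    refine ⟨_, by
      rw [SDeriv.judgements, List.map_cons]
      exact EvalsTo.node₁ rfl hS, fun ⟨Δ, K, A⟩ l => ?_⟩
    simp only [mem_derivStep₁, annotate, mem_conclusions, hS']
    constructor
    · rintro ⟨_, k₁, ⟨Δ₁, A₁, q₁, rfl, -, ho₁, hn₁, hl₁⟩, ⟨rfl, hΔ, hA, B, -, h, h'⟩, rfl⟩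
      obtain rfl : Δ₁ = some B :: Δ := h
      have hn := noRepeat_of_mem_decorations hΔ hA
      rcases h' with h' | ⟨h', hp⟩
      · obtain rfl : A = .lolli B A₁ := h'
        exact ⟨Δ, _, .lam₁ q₁, rfl, hΔ, over_lam₁.2 ho₁, noRepeat_lam₁.2 ⟨hn, hn₁⟩, by
          rw [← hl₁]; rfl⟩
      · obtain rfl : A = .bang (.lolli B A₁) := h'
        exact ⟨Δ, _, .lam₂ 0 hp q₁, rfl, hΔ, over_lam₂.2 ho₁, noRepeat_lam₂.2 ⟨hn, hn₁⟩, by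
          rw [← hl₁]; rfl⟩
    · rintro ⟨Δ, A, q, hj, hΔ, ho, hn, hl⟩
      obtain ⟨rfl, rfl, rfl⟩ : _ = _ ∧ _ = _ ∧ _ = _ := by simpa using hj
      have hA := mem_decorations_of_over ho hn
      cases q with
      | @lam₁ _ _ B _ q₁ =>
        have ho₁ := over_lam₁.1 ho
        obtain ⟨-, hn₁⟩ := noRepeat_lam₁.1 hn
        have hB : B.skel = U ∧ B.NoRepeat :=
          ⟨(IType.arrow.inj ho.skel_eq).1, hn.root.2.1⟩
        exact ⟨_, _, ⟨_, _, q₁, rfl, SCtx.cons_mem_decorations.2 ⟨hB, hΔ⟩, ho₁, hn₁,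
          q₁.judgements_eq⟩, ⟨rfl, hΔ, hA, B, by simp [premise], rfl, .inl rfl⟩, by
          rw [← q₁.judgements_eq]
          simpa [QDeriv.judgements] using hl⟩
      | @lam₂ _ _ B C n hp q₁ =>
        have ho₁ := over_lam₂.1 ho
        obtain ⟨-, hn₁⟩ := noRepeat_lam₂.1 hn
        -- The rule adds `n + 1` exponentials, so only `n = 0` avoids repetition.
        rcases n with _ | n
        · have hB : B.skel = U ∧ B.NoRepeat :=
            ⟨(IType.arrow.inj ho.skel_eq).1, hn.root.2.2.1⟩
          exact ⟨_, _, ⟨_, _, q₁, rfl, SCtx.cons_mem_decorations.2 ⟨hB, hΔ⟩, ho₁, hn₁,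
            q₁.judgements_eq⟩, ⟨rfl, hΔ, hA, B, by simp [premise], rfl, .inr ⟨rfl, hp⟩⟩, by
            rw [← q₁.judgements_eq]
            simpa [QDeriv.judgements] using hl⟩
        · exact (hn.root.2.1 _ rfl).elim
  | @pair Γ M N U V d e ihd ihe =>
    obtain ⟨S, hS, hS'⟩ := ihd
    obtain ⟨T, hT, hT'⟩ := ihe
    refine ⟨_, by
      rw [SDeriv.judgements, List.map_cons, List.map_append]
      exact EvalsTo.node₂ rfl hS hT, fun ⟨Δ, K, A⟩ l => ?_⟩
    simp only [mem_derivStep₂, annotate, mem_conclusions, hS', hT']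
    constructor
    · rintro ⟨_, k₁, _, k₂, ⟨Δ₁, A₁, q₁, rfl, -, ho₁, hn₁, hl₁⟩, ⟨Δ₂, A₂, q₂, rfl, -, ho₂, hn₂, hl₂⟩,
        ⟨rfl, hΔ, hA, h, hp⟩, rfl⟩
      have hn := noRepeat_of_mem_decorations hΔ hA
      have hle := le_of_mem_decorations hΔ
      rcases (pairStep_iff hn₁.root.2 hn₂.root.2).1 hp with h' | ⟨B₁, B₂, τ, σ, h₁, h₂, h'⟩
      · obtain rfl : A = .tensor A₁ A₂ := h'
        exact ⟨Δ, _, .pair 0 h q₁ q₂, rfl, hΔ, over_pair.2 ⟨hle, ho₁, ho₂⟩,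
          noRepeat_pair.2 ⟨hn, hn₁, hn₂⟩, by rw [← hl₁, ← hl₂]; rfl⟩
      · obtain rfl : A₁ = .bang B₁ := h₁
        obtain rfl : A₂ = .bang B₂ := h₂
        obtain rfl : A = .bang (.tensor (.nbang τ B₁) (.nbang σ B₂)) := h'
        exact ⟨Δ, _, .pair' rfl τ σ h q₁ q₂, rfl, hΔ, over_pair'.2 ⟨hle, ho₁, ho₂⟩,
          noRepeat_pair'.2 ⟨hn, hn₁, hn₂⟩, by rw [← hl₁, ← hl₂]; rfl⟩
    · rintro ⟨Δ, A, q, hj, hΔ, ho, hn, hl⟩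
      obtain ⟨rfl, rfl, rfl⟩ : _ = _ ∧ _ = _ ∧ _ = _ := by simpa using hj
      have hA := mem_decorations_of_over ho hn
      cases q with
      | pair n h q₁ q₂ =>
        obtain ⟨-, ho₁, ho₂⟩ := over_pair.1 ho
        obtain ⟨-, hn₁, hn₂⟩ := noRepeat_pair.1 hn
        refine ⟨_, _, _, _,
          ⟨_, _, q₁, rfl, (h.mem_decorations hΔ).1, ho₁, hn₁, q₁.judgements_eq⟩,
          ⟨_, _, q₂, rfl, (h.mem_decorations hΔ).2, ho₂, hn₂, q₂.judgements_eq⟩,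
          ⟨rfl, hΔ, hA, h, (pairStep_iff hn₁.root.2 hn₂.root.2).2 ?_⟩, by
          rw [← q₁.judgements_eq, ← q₂.judgements_eq]
          simpa [QDeriv.judgements] using hl⟩
        -- No exponential gives the plain tensor, one gives the case `τ = σ = 0`, and more would be
        -- a repetition.
        rcases n with _ | _ | n
        · exact .inl rfl
        · exact .inr ⟨_, _, 0, 0, rfl, rfl, rfl⟩
        · exact (hn.root.2.1 _ rfl).elim
      | pair' _ τ σ h q₁ q₂ =>
        obtain ⟨-, ho₁, ho₂⟩ := over_pair'.1 ho
        obtain ⟨-, hn₁, hn₂⟩ := noRepeat_pair'.1 hn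
        exact ⟨_, _, _, _,
          ⟨_, _, q₁, rfl, (h.mem_decorations hΔ).1, ho₁, hn₁, q₁.judgements_eq⟩,
          ⟨_, _, q₂, rfl, (h.mem_decorations hΔ).2, ho₂, hn₂, q₂.judgements_eq⟩,
          ⟨rfl, hΔ, hA, h, (pairStep_iff hn₁.root.2 hn₂.root.2).2
            (.inr ⟨_, _, τ, σ, rfl, rfl, rfl⟩)⟩, by
          rw [← q₁.judgements_eq, ← q₂.judgements_eq]
          simpa [QDeriv.judgements] using hl⟩
  | @letp Γ M N U V W d e ihd ihe =>
    obtain ⟨S, hS, hS'⟩ := ihd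
    obtain ⟨T, hT, hT'⟩ := ihe
    refine ⟨_, by
      rw [SDeriv.judgements, List.map_cons, List.map_append]
      exact EvalsTo.node₂ rfl hS hT, fun ⟨Δ, K, A⟩ l => ?_⟩
    simp only [mem_derivStep₂, annotate, mem_conclusions, hS', hT']
    constructor
    · rintro ⟨_, k₁, _, k₂, ⟨Δ₁, A₁, q₁, rfl, -, ho₁, hn₁, hl₁⟩, ⟨Δ₂, A₂, q₂, rfl, -, ho₂, hn₂, hl₂⟩,
        ⟨rfl, hΔ, hA, X, hX, Y, hY, h₀, h, hp, h'⟩, rfl⟩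
      have hn := noRepeat_of_mem_decorations hΔ hA
      have hle := le_of_mem_decorations hΔ
      obtain rfl : A₂ = A := h'
      -- The check describes the context by its first two entries and the rest; naming the rest
      -- restores the form required by the rule.
      obtain ⟨Δ₂, rfl⟩ : ∃ Δ₃, Δ₂ = some X :: some Y :: Δ₃ := ⟨_, h₀⟩
      replace h : Split Δ Δ₁ Δ₂ := h
      have hXY : X.NoRepeat ∧ Y.NoRepeat := ⟨hn₂.root.1 _ (by simp), hn₂.root.1 _ (by simp)⟩
      rcases (pairStep_iff hXY.1 hXY.2).1 hp with hp | ⟨B₁, B₂, τ, σ, h₁, h₂, hp⟩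
      · obtain rfl : A₁ = .tensor X Y := hp
        exact ⟨Δ, _, .letp 0 h q₁ q₂, rfl, hΔ, over_letp.2 ⟨hle, ho₁, ho₂⟩,
          noRepeat_letp.2 ⟨hn, hn₁, hn₂⟩, by rw [← hl₁, ← hl₂]; rfl⟩
      · obtain rfl : X = .bang B₁ := h₁
        obtain rfl : Y = .bang B₂ := h₂
        obtain rfl : A₁ = .bang (.tensor (.nbang τ B₁) (.nbang σ B₂)) := hp
        exact ⟨Δ, _, .letp' rfl τ σ h q₁ q₂, rfl, hΔ, over_letp'.2 ⟨hle, ho₁, ho₂⟩,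
          noRepeat_letp'.2 ⟨hn, hn₁, hn₂⟩, by rw [← hl₁, ← hl₂]; rfl⟩
    · rintro ⟨Δ, A, q, hj, hΔ, ho, hn, hl⟩
      obtain ⟨rfl, rfl, rfl⟩ : _ = _ ∧ _ = _ ∧ _ = _ := by simpa using hj
      have hA := mem_decorations_of_over ho hn
      -- Both elimination rules extend the context by two variables. Their types have the right
      -- skeletons because the second premise lies over `e`.
      have hctx : ∀ {X Y : QType κ} {Δ₂ : QCtx κ} {q₂ : QDeriv arity .extended
          (some X :: some Y :: Δ₂) N A}, Δ₂ ∈ Γ.decorations → q₂.Over e → q₂.NoRepeat →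
          (X.NoRepeat ∧ Y.NoRepeat) ∧
            some X :: some Y :: Δ₂ ∈ SCtx.decorations (some U :: some V :: Γ) := by
        intro X Y Δ₂ q₂ hΔ₂ ho₂ hn₂
        have hX : X.NoRepeat := hn₂.root.1 _ (by simp)
        have hY : Y.NoRepeat := hn₂.root.1 _ (by simp)
        exact ⟨⟨hX, hY⟩, SCtx.cons_mem_decorations.2 ⟨⟨ho₂.le.head_eq, hX⟩,
          SCtx.cons_mem_decorations.2 ⟨⟨ho₂.le.of_cons.head_eq, hY⟩, hΔ₂⟩⟩⟩
      cases q with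
      | letp n h q₁ q₂ =>
        obtain ⟨-, ho₁, ho₂⟩ := over_letp.1 ho
        obtain ⟨-, hn₁, hn₂⟩ := noRepeat_letp.1 hn
        obtain ⟨⟨hX, hY⟩, hc⟩ := hctx (h.mem_decorations hΔ).2 ho₂ hn₂
        refine ⟨_, _, _, _,
          ⟨_, _, q₁, rfl, (h.mem_decorations hΔ).1, ho₁, hn₁, q₁.judgements_eq⟩,
          ⟨_, _, q₂, rfl, hc, ho₂, hn₂, q₂.judgements_eq⟩,
          ⟨rfl, hΔ, hA, _, mem_toList_getD.2 rfl, _, mem_toList_getD.2 rfl, rfl, h,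
            (pairStep_iff hX hY).2 ?_, rfl⟩, by
          rw [← q₁.judgements_eq, ← q₂.judgements_eq]
          simpa [QDeriv.judgements] using hl⟩
        -- Two or more exponentials would be repeated in the type of the first premise.
        rcases n with _ | _ | n
        · exact .inl rfl
        · exact .inr ⟨_, _, 0, 0, rfl, rfl, rfl⟩
        · exact (hn₁.root.2.1 _ rfl).elim
      | letp' _ τ σ h q₁ q₂ =>
        obtain ⟨-, ho₁, ho₂⟩ := over_letp'.1 ho
        obtain ⟨-, hn₁, hn₂⟩ := noRepeat_letp'.1 hn
        obtain ⟨⟨hX, hY⟩, hc⟩ := hctx (h.mem_decorations hΔ).2 ho₂ hn₂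
        exact ⟨_, _, _, _,
          ⟨_, _, q₁, rfl, (h.mem_decorations hΔ).1, ho₁, hn₁, q₁.judgements_eq⟩,
          ⟨_, _, q₂, rfl, hc, ho₂, hn₂, q₂.judgements_eq⟩,
          ⟨rfl, hΔ, hA, _, mem_toList_getD.2 rfl, _, mem_toList_getD.2 rfl, rfl, h,
            (pairStep_iff hX hY).2 (.inr ⟨_, _, τ, σ, rfl, rfl, rfl⟩), rfl⟩, by
          rw [← q₁.judgements_eq, ← q₂.judgements_eq]
          simpa [QDeriv.judgements] using hl⟩

/-- A restriction with the full domain is no restriction. Comparing domains at the root thus selects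
the genuine decorations among those in restricted contexts. -/
theorem QCtx.skel_eq_of_le {Δ : QCtx κ} {Γ : SCtx κ} (h : SCtx.Le Δ.skel Γ)
    (hd : Δ.map Option.isSome = Γ.map Option.isSome) : Δ.skel = Γ := by
  refine List.ext_getElem? fun x => ?_
  have hx : Δ[x]?.map Option.isSome = Γ[x]?.map Option.isSome := by
    rw [← List.getElem?_map, ← List.getElem?_map, hd]
  rcases hΔ : Δ[x]? with _ | _ | A
  · rw [hΔ] at hx
    rw [Option.map_eq_none_iff.1 hx.symm]
    simp [QCtx.skel, hΔ]
  · rw [hΔ] at hx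
    obtain ⟨o, ho, ho'⟩ := Option.map_eq_some_iff.1 hx.symm
    rw [ho, Option.isSome_eq_false_iff.1 ho' |> Option.isNone_iff_eq_none.1]
    simp [QCtx.skel, hΔ]
  · have hs : Δ.skel[x]? = some (some A.skel) := by simp [QCtx.skel, hΔ]
    rw [hs, h x _ hs]

theorem QCtx.map_isSome_skel (Δ : QCtx κ) : Δ.skel.map Option.isSome = Δ.map Option.isSome := by
  simp [QCtx.skel]

/-- The decoration found for a simply-typed derivation that is given by its list of judgements,
annotated by the arities of gates. -/
noncomputable def checkAnnotated (l : List (SJudgement G κ × ℕ)) :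
    Option (QCtx κ × QType κ × List (QJudgement G κ)) :=
  ((((evalWord premiseArity (derivStep conclusions) l).getD 0 []).filter fun c =>
    c.1.1.map Option.isSome = (l.getD 0 (([], .star, .top), 0)).1.1.map Option.isSome).head?).map
    fun c => (c.1.1, c.1.2.2, c.1 :: c.2)

/-- The decoration found for a simply-typed derivation that is given by its list of judgements. -/
noncomputable def checkJudgements (arity : G → ℕ) (l : List (SJudgement G κ)) :
    Option (QCtx κ × QType κ × List (QJudgement G κ)) :=
  checkAnnotated (l.map (annotate arity))

theorem SDeriv.checkAnnotated_eq {Γ : SCtx κ} {M : Term G} {U : IType κ} (π : SDeriv arity Γ M U) :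
    ∃ S : List (QJudgement G κ × List (QJudgement G κ)),
      (∀ j l, (j, l) ∈ S ↔ π.Decorated j l) ∧ checkJudgements arity π.judgements =
        ((S.filter fun c => c.1.1.map Option.isSome = Γ.map Option.isSome).head?).map
          fun c => (c.1.1, c.1.2.2, c.1 :: c.2) := by
  obtain ⟨S, hS, hS'⟩ := π.evalsTo_check
  refine ⟨S, hS', ?_⟩
  -- The list starts with the root judgement, so the default value is never used.
  have hr : ((π.judgements.map (annotate arity)).getD 0 (([], .star, .top), 0)).1.1 = Γ := by
    cases π <;> rfl
  rw [checkJudgements, checkAnnotated, hS.evalWord, hr]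
  rfl

theorem SDeriv.of_check_eq_some {Γ : SCtx κ} {M : Term G} {U : IType κ} (π : SDeriv arity Γ M U)
    {Δ : QCtx κ} {A : QType κ} {l : List (QJudgement G κ)}
    (h : checkJudgements arity π.judgements = some (Δ, A, l)) :
    ∃ q : QDeriv arity .extended Δ M A, q.judgements = l ∧ q.IsDecoration π ∧ q.NoRepeat := by
  obtain ⟨S, hS, h'⟩ := π.checkAnnotated_eq
  rw [h', Option.map_eq_some_iff] at h
  obtain ⟨⟨j, k⟩, hj, h⟩ := h
  obtain ⟨hj, hd⟩ := List.mem_filter.1 (List.mem_of_mem_head? hj)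
  obtain ⟨Δ', A', q, rfl, hΔ, ho, hn, hl⟩ := (hS _ _).1 hj
  obtain ⟨rfl, rfl, rfl⟩ : Δ' = Δ ∧ A' = A ∧ _ = l := by simpa using h
  exact ⟨q, hl, QDeriv.isDecoration_iff.2
    ⟨QCtx.skel_eq_of_le ho.le (by simpa using hd), ho⟩, hn⟩

/-- A typable term has a decoration over this very derivation, by transport and contraction, and the
exhaustive list would contain it. -/
theorem SDeriv.not_qTypable_of_check_eq_none {Γ : SCtx κ} {M : Term G} {U : IType κ}
    (π : SDeriv arity Γ M U) (h : checkJudgements arity π.judgements = none) :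
    ¬ QTypable κ arity M := by
  intro hM
  obtain ⟨Δ, A, q, hq, hn⟩ := hM.exists_noRepeat π
  obtain ⟨hΔ, ho⟩ := QDeriv.isDecoration_iff.1 hq
  obtain ⟨S, hS, h'⟩ := π.checkAnnotated_eq
  rw [h', Option.map_eq_none_iff, List.head?_eq_none_iff, List.filter_eq_nil_iff] at h
  refine h ((Δ, M, A), q.judgements.tail) ((hS _ _).2 ⟨Δ, A, q, rfl, SCtx.mem_decorations.2
    ⟨by simp [← hΔ, QCtx.skel], ho.le, hn.root.1⟩, ho, hn, q.judgements_eq⟩) ?_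
  simp [← hΔ, QCtx.map_isSome_skel]

/-! ### Computability of the second step -/

section Computability

variable [Primcodable G] [Primcodable κ]

theorem conclusions_primrec : Primrec₂ (conclusions (G := G) (κ := κ)) := by
  classical
  refine primrec_filter (p := fun (x : (SJudgement G κ × ℕ) × List (QJudgement G κ)) j =>
    IsStep x.1.2 j x.2) (decorationsOf_primrec.comp (Primrec.fst.comp Primrec.fst)) ?_
  exact isStep_primrec.comp (Primrec.pair (Primrec.snd.comp (Primrec.fst.comp Primrec.fst))
    (Primrec.pair Primrec.snd (Primrec.snd.comp Primrec.fst)))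

theorem checkAnnotated_primrec : Primrec (checkAnnotated (G := G) (κ := κ)) := by
  have ha : Primrec (premiseArity (G := G) (κ := κ)) := termArity_primrec.comp
    (Term.label_primrec.comp (Primrec.fst.comp (Primrec.snd.comp Primrec.fst)))
  have hR := conclusions_primrec (G := G) (κ := κ)
  have he := evalWord_primrec (F := fun _ : List (SJudgement G κ × ℕ) => derivStep conclusions) ha
    (derivStep_primrec (R := fun _ : List (SJudgement G κ × ℕ) => conclusions)
      (hR.comp (Primrec.fst.comp Primrec.snd) (Primrec.snd.comp Primrec.snd))) Primrec.id
  have hm : ∀ {δ β : Type} [Primcodable δ] [Primcodable β] {f : δ → List (Option β)}, Primrec f →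
      Primrec fun a => (f a).map Option.isSome := fun hf =>
    Primrec.list_map hf (Primrec.option_isSome.comp Primrec.snd).to₂
  refine Primrec.option_map (Primrec.list_head?.comp (primrec_filter
    (p := fun l (c : QJudgement G κ × List (QJudgement G κ)) => c.1.1.map Option.isSome =
      (l.getD 0 (([], .star, .top), 0)).1.1.map Option.isSome) (primrec_getD 0 [] he) ?_)) ?_
  · exact primrecPred_eq (hm (Primrec.fst.comp (Primrec.fst.comp Primrec.snd)))
      (hm (Primrec.fst.comp (Primrec.fst.comp (primrec_getD 0 _ Primrec.fst))))
  · exact Primrec.pair (Primrec.fst.comp (Primrec.fst.comp Primrec.snd))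
      (Primrec.pair (Primrec.snd.comp (Primrec.snd.comp (Primrec.fst.comp Primrec.snd)))
        (Primrec.list_cons.comp (Primrec.fst.comp Primrec.snd) (Primrec.snd.comp Primrec.snd)))

theorem labelArity_computable (ha : Computable arity) :
    Computable fun l : TermLabel G => Sum.elim (Sum.elim (fun _ => 0) arity) (fun _ => 0) l := by
  have h : Computable fun l : TermLabel G => (Sum.casesOn l
      (fun x => Sum.casesOn x (fun _ => 0) arity) fun _ => 0 : ℕ) := by
    refine Computable.sumCasesOn Computable.id ?_ (Computable.const 0).to₂
    exact Computable.sumCasesOn Computable.snd (Computable.const 0).to₂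
      (ha.comp Computable.snd).to₂
  refine h.of_eq fun l => ?_
  rcases l with (_ | _) | _ <;> rfl

theorem gateArity_computable (ha : Computable arity) : Computable (gateArity arity) :=
  (labelArity_computable ha).comp Term.label_primrec.to_comp

theorem checkJudgements_computable (ha : Computable arity) :
    Computable (checkJudgements (κ := κ) arity) := by
  refine checkAnnotated_primrec.to_comp.comp (computable_list_map ?_)
  exact Computable.pair Computable.id
    ((gateArity_computable ha).comp (Computable.fst.comp Computable.snd))

end Computability

end Check

/-! ### A bound for the types of a simply-typed derivation -/

section Bound

variable {G κ : Type} {arity : G → ℕ}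

/-- The types of height at most `d` without type constants other than `bit` and `qbit`, and without
type variables other than the first one. -/
def IType.ofHeight : ℕ → List (IType κ)
  | 0 => []
  | d + 1 => [.bit, .qbit, .top, .var 0] ++
      ((ofHeight d).flatMap fun U => (ofHeight d).map fun V => .arrow U V) ++
      ((ofHeight d).flatMap fun U => (ofHeight d).map fun V => .prod U V)

theorem IType.ofHeight_subset_succ (d : ℕ) :
    (IType.ofHeight d : List (IType κ)) ⊆ IType.ofHeight (d + 1) := by
  induction d with
  | zero => intro U hU; cases hU
  | succ d ih =>
    intro U hU
    rw [IType.ofHeight] at hU ⊢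
    simp only [List.mem_append, List.mem_flatMap, List.mem_map] at hU ⊢
    rcases hU with (hU | ⟨V, hV, W, hW, rfl⟩) | ⟨V, hV, W, hW, rfl⟩
    · exact .inl (.inl hU)
    · exact .inl (.inr ⟨V, ih hV, W, ih hW, rfl⟩)
    · exact .inr ⟨V, ih hV, W, ih hW, rfl⟩

theorem IType.ofHeight_subset {d e : ℕ} (h : d ≤ e) :
    (IType.ofHeight d : List (IType κ)) ⊆ IType.ofHeight e := by
  induction h with
  | refl => exact List.Subset.refl _
  | step _ ih => exact List.Subset.trans ih (IType.ofHeight_subset_succ _)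

/-- The contexts of length at most `n` with types in `T`. -/
def SCtx.ofLength (T : List (IType κ)) : ℕ → List (SCtx κ)
  | 0 => [[]]
  | n + 1 => [] :: (none :: T.map some).flatMap fun o => (ofLength T n).map fun Γ => o :: Γ

theorem SCtx.mem_ofLength {T : List (IType κ)} {n : ℕ} {Γ : SCtx κ} (hn : Γ.length ≤ n)
    (hT : ∀ U, some U ∈ Γ → U ∈ T) : Γ ∈ SCtx.ofLength T n := by
  induction n generalizing Γ with
  | zero => rw [List.length_eq_zero_iff.1 (Nat.le_zero.1 hn)]; exact List.mem_singleton_self _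
  | succ n ih =>
    cases Γ with
    | nil => exact List.mem_cons_self
    | cons o Γ =>
      refine List.mem_cons_of_mem _ (List.mem_flatMap.2 ⟨o, ?_, List.mem_map.2
        ⟨Γ, ih (by simpa using hn) fun U hU => hT U (List.mem_cons_of_mem _ hU), rfl⟩⟩)
      cases o with
      | none => exact List.mem_cons_self
      | some U => exact List.mem_cons_of_mem _ (List.mem_map_of_mem (hT U List.mem_cons_self))

open Classical in
/-- Replaces the type variables and the type constants other than `bit` and `qbit`, and the types
whose components are not in `S`, by a type variable. -/
noncomputable def IType.prune (S : List (IType κ)) : IType κ → IType κ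
  | .bit => .bit
  | .qbit => .qbit
  | .const _ => .var 0
  | .var _ => .var 0
  | .arrow U V => if U ∈ S ∧ V ∈ S then .arrow (U.prune S) (V.prune S) else .var 0
  | .top => .top
  | .prod U V => if U ∈ S ∧ V ∈ S then .prod (U.prune S) (V.prune S) else .var 0

/-- The number of nodes of a type. -/
def IType.size : IType κ → ℕ
  | .arrow U V => U.size + V.size + 1
  | .prod U V => U.size + V.size + 1
  | _ => 0

-- Pruning descends into an arrow or product only if both components are in `S`, and components are
-- strictly smaller. Along a branch one thus meets members of `S` of decreasing size, so their
-- number bounds the height.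
open Classical in
theorem IType.prune_mem_card (S : List (IType κ)) (U : IType κ) :
    U.prune S ∈ IType.ofHeight ((S.toFinset.filter fun V => V.size < U.size).card + 1) := by
  -- The count drops strictly, as `U` is counted among the members smaller than `V` but not among
  -- those smaller than itself.
  have key : ∀ {U V : IType κ}, U ∈ S → U.size < V.size →
      IType.ofHeight ((S.toFinset.filter fun W => W.size < U.size).card + 1) ⊆
        (IType.ofHeight (S.toFinset.filter fun W => W.size < V.size).card : List (IType κ)) := by
    intro U V hU hUV
    refine IType.ofHeight_subset (Finset.card_lt_card ?_)
    refine Finset.ssubset_iff_subset_ne.2 ⟨fun W hW => ?_, fun he => ?_⟩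
    · rw [Finset.mem_filter] at hW ⊢
      exact ⟨hW.1, hW.2.trans hUV⟩
    · have : U ∈ S.toFinset.filter fun W => W.size < V.size :=
        Finset.mem_filter.2 ⟨List.mem_toFinset.2 hU, hUV⟩
      rw [← he, Finset.mem_filter] at this
      exact lt_irrefl _ this.2
  induction U with
  | arrow U V hU hV =>
    rw [IType.prune]
    split_ifs with h
    · rw [IType.ofHeight]
      simp only [List.mem_append, List.mem_flatMap, List.mem_map]
      exact .inl (.inr ⟨_, key h.1 (by simp only [IType.size]; omega) hU, _,
        key h.2 (by simp only [IType.size]; omega) hV, rfl⟩)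
    · simp [IType.ofHeight]
  | prod U V hU hV =>
    rw [IType.prune]
    split_ifs with h
    · rw [IType.ofHeight]
      simp only [List.mem_append, List.mem_flatMap, List.mem_map]
      exact .inr ⟨_, key h.1 (by simp only [IType.size]; omega) hU, _,
        key h.2 (by simp only [IType.size]; omega) hV, rfl⟩
    · simp [IType.ofHeight]
  | _ => simp [IType.prune, IType.ofHeight]

theorem IType.prune_mem {S : List (IType κ)} {n : ℕ} (hS : S.length ≤ n) (U : IType κ) :
    U.prune S ∈ IType.ofHeight (n + 1) := by
  classical
  refine IType.ofHeight_subset (Nat.succ_le_succ ?_) (U.prune_mem_card S)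
  exact (Finset.card_le_card (Finset.filter_subset _ _)).trans
    ((List.toFinset_card_le S).trans hS)

theorem IType.prune_arrow {S : List (IType κ)} {U V : IType κ} (hU : U ∈ S) (hV : V ∈ S) :
    (IType.arrow U V).prune S = .arrow (U.prune S) (V.prune S) := by
  rw [IType.prune, if_pos ⟨hU, hV⟩]

theorem IType.prune_prod {S : List (IType κ)} {U V : IType κ} (hU : U ∈ S) (hV : V ∈ S) :
    (IType.prod U V).prune S = .prod (U.prune S) (V.prune S) := by
  rw [IType.prune, if_pos ⟨hU, hV⟩]

/-- The types of the components of the type of a constant. -/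
def Const.components (κ : Type) (arity : G → ℕ) : Const G → List (IType κ)
  | .zero => []
  | .one => []
  | .new => [.bit, .qbit]
  | .meas => [.bit, .qbit]
  | .gate g => .qbit :: (List.range (arity g + 1)).map fun k => (QType.qbit.pow k).skel

theorem Const.length_components_le (c : Const G) :
    (c.components κ arity).length ≤ gateArity arity (.const c) + 2 := by
  cases c <;> simp [Const.components, gateArity, Term.label]

/-- Types of gates must survive pruning, for which all lower powers of `qbit` have to be in `S`. -/
theorem prune_pow {S : List (IType κ)} {n : ℕ} (hq : .qbit ∈ S)
    (hS : ∀ k ≤ n, (QType.qbit.pow k).skel ∈ S) :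
    (QType.qbit.pow n).skel.prune S = (QType.qbit.pow n).skel := by
  induction n with
  | zero => rfl
  | succ n ih =>
    cases n with
    | zero => rfl
    | succ n =>
      change (IType.prod .qbit (QType.qbit.pow (n + 1)).skel).prune S = _
      rw [IType.prune_prod hq (hS _ (by omega)), ih fun k hk => hS k (by omega)]
      rfl

theorem Const.prune_type {S : List (IType κ)} (c : Const G) (hS : c.components κ arity ⊆ S) :
    (c.type κ arity).skel.prune S = (c.type κ arity).skel := by
  cases c with
  | zero => rfl
  | one => rfl
  | new => exact IType.prune_arrow (hS (by simp [components, QType.skel])) (hS (by simp [components, QType.skel]))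
  | meas => exact IType.prune_arrow (hS (by simp [components, QType.skel])) (hS (by simp [components, QType.skel]))
  | gate g =>
    have hp : ∀ k ≤ arity g, (QType.qbit.pow k).skel ∈ S := fun k hk =>
      hS (List.mem_cons_of_mem _ (List.mem_map.2 ⟨k, by simpa [Nat.lt_succ_iff] using hk, rfl⟩))
    have := prune_pow (hS (by simp [components])) hp
    change (IType.arrow _ _).prune S = IType.arrow _ _
    rw [IType.prune_arrow (hp _ le_rfl) (hp _ le_rfl), this]

/-- The components of the types on which the rules of a derivation depend. -/
def SDeriv.components {Γ : SCtx κ} {M : Term G} {U : IType κ} : SDeriv arity Γ M U → List (IType κ)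
  | .ax₁ _ => []
  | .ax₂ (c := c) _ => c.components κ arity
  | .ite p d e => p.components ++ d.components ++ e.components
  | .app (U := U) (V := V) d e => U :: V :: (d.components ++ e.components)
  | .lam (U := U) (V := V) d => U :: V :: d.components
  | .pair (U := U) (V := V) d e => U :: V :: (d.components ++ e.components)
  | .star => []
  | .letp (U := U) (V := V) d e => U :: V :: (d.components ++ e.components)

/-- The label of a node of a term, with the arity of the gate if it is a gate. -/
def annotateLabel (arity : G → ℕ) (l : TermLabel G) : TermLabel G × ℕ :=
  (l, Sum.elim (Sum.elim (fun _ => 0) arity) (fun _ => 0) l)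

/-- The contribution of a node to the bound for derivations. -/
def nodeWeight (n : TermLabel G × ℕ) : ℕ :=
  Sum.elim (Sum.elim id (fun _ => 0)) (fun _ => 0) n.1 + n.2 + 2

/-- A bound for the free variables of a term and the length and types in its derivations. -/
def Term.weight (arity : G → ℕ) (M : Term G) : ℕ :=
  ((M.word.map (annotateLabel arity)).map nodeWeight).sum

theorem Term.weight_var (x : ℕ) : (Term.var x : Term G).weight arity = x + 2 := rfl

theorem Term.weight_const (c : Const G) :
    (Term.const c : Term G).weight arity = gateArity arity (.const c) + 2 := by
  cases c <;> simp [Term.weight, gateArity, Term.label, annotateLabel, nodeWeight]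

theorem Term.weight_app (M N : Term G) :
    (Term.app M N).weight arity = M.weight arity + N.weight arity + 2 := by
  simp [Term.weight, annotateLabel, nodeWeight]; omega

theorem Term.weight_pair (M N : Term G) :
    (Term.pair M N).weight arity = M.weight arity + N.weight arity + 2 := by
  simp [Term.weight, annotateLabel, nodeWeight]; omega

theorem Term.weight_letp (M N : Term G) :
    (Term.letp M N).weight arity = M.weight arity + N.weight arity + 2 := by
  simp [Term.weight, annotateLabel, nodeWeight]; omega

theorem Term.weight_lam (M : Term G) : (Term.lam M).weight arity = M.weight arity + 2 := by
  simp [Term.weight, annotateLabel, nodeWeight]; omega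

theorem Term.weight_ite (P M N : Term G) : (Term.ite P M N).weight arity =
    P.weight arity + M.weight arity + N.weight arity + 2 := by
  simp [Term.weight, annotateLabel, nodeWeight]; omega

/-- An occurrence of a variable weighs more than its index, and passing out of a binder only lowers
indices. -/
theorem Term.Free.lt_weight {M : Term G} {x : ℕ} (h : M.Free x) : x < M.weight arity := by
  induction M generalizing x with
  | var y => cases h; rw [Term.weight_var]; omega
  | const c => cases h
  | star => cases h
  | app M N hM hN =>
    rw [Term.weight_app]
    rcases h with h | h
    · have := hM h; omega
    · have := hN h; omega
  | lam M hM => have := hM (x := x + 1) h; rw [Term.weight_lam]; omega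
  | ite P M N hP hM hN =>
    rw [Term.weight_ite]
    rcases h with h | h | h
    · have := hP h; omega
    · have := hM h; omega
    · have := hN h; omega
  | pair M N hM hN =>
    rw [Term.weight_pair]
    rcases h with h | h
    · have := hM h; omega
    · have := hN h; omega
  | letp M N hM hN =>
    rw [Term.weight_letp]
    rcases h with h | h
    · have := hM h; omega
    · have := hN (x := x + 2) h; omega

/-- A compound rule contributes at most two types and a gate its arity plus two, which is what the
weights of the nodes allow for. -/
theorem SDeriv.length_components_le {Γ : SCtx κ} {M : Term G} {U : IType κ}
    (π : SDeriv arity Γ M U) : π.components.length ≤ M.weight arity := by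
  induction π with
  | ax₁ => exact Nat.zero_le _
  | star => exact Nat.zero_le _
  | ax₂ => rw [Term.weight_const]; exact Const.length_components_le _
  | ite p d e hp hd he => simp only [components, List.length_append, Term.weight_ite]; omega
  | app d e hd he =>
    simp only [components, List.length_cons, List.length_append, Term.weight_app]; omega
  | pair d e hd he =>
    simp only [components, List.length_cons, List.length_append, Term.weight_pair]; omega
  | letp d e hd he =>
    simp only [components, List.length_cons, List.length_append, Term.weight_letp]; omega
  | lam d hd => simp only [components, List.length_cons, Term.weight_lam]; omega

/-- All contexts and types of the judgements of a derivation are in given lists. -/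
def SDeriv.Within {Γ : SCtx κ} {M : Term G} {U : IType κ} (π : SDeriv arity Γ M U)
    (C : List (SCtx κ)) (T : List (IType κ)) : Prop :=
  ∀ j ∈ π.judgements, j.1 ∈ C ∧ j.2.2 ∈ T

/-- The derivation is replayed with pruned types. Pruning commutes with every arrow and product that
a rule builds or takes apart, because their components are in `S`. The new context needs to agree
with the old one on the free variables only, so its length can be controlled: each binder adds at
most two entries, paid for by the weight of its node. -/
theorem SDeriv.exists_prune {S T : List (IType κ)} (hT : ∀ U : IType κ, U.prune S ∈ T) {n : ℕ}
    {Γ : SCtx κ} {M : Term G} {U : IType κ} (π : SDeriv arity Γ M U) (hS : π.components ⊆ S)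
    {Γ' : SCtx κ} (hn : Γ'.length + M.weight arity ≤ n) (hΓ' : ∀ V, some V ∈ Γ' → V ∈ T)
    (hΓ : ∀ x V, M.Free x → Γ[x]? = some (some V) → Γ'[x]? = some (some (V.prune S))) :
    ∃ π' : SDeriv arity Γ' M (U.prune S), π'.Within (SCtx.ofLength T n) T := by
  have hC : Γ' ∈ SCtx.ofLength T n := SCtx.mem_ofLength (by omega) hΓ'
  induction π generalizing Γ' with
  | @ax₁ Γ x U hx =>
    refine ⟨.ax₁ (hΓ x U rfl hx), ?_⟩
    simp [Within, judgements, hC, hT]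
  | @ax₂ Γ c U h =>
    refine ⟨.ax₂ (by rw [← h, c.prune_type hS]), ?_⟩
    simp [Within, judgements, hC, hT]
  | star =>
    refine ⟨.star, ?_⟩
    simp only [Within, judgements, List.forall_mem_cons, hC, true_and]
    exact ⟨hT .top, by simp⟩
  | @ite Γ P M N U p d e ihp ihd ihe =>
    rw [Term.weight_ite] at hn
    simp only [components, List.append_subset] at hS
    obtain ⟨p', hp⟩ := ihp hS.1.1 (by omega) hΓ' (fun x V h => hΓ x V (.inl h)) hC
    obtain ⟨d', hd⟩ := ihd hS.1.2 (by omega) hΓ' (fun x V h => hΓ x V (.inr (.inl h))) hC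
    obtain ⟨e', he⟩ := ihe hS.2 (by omega) hΓ' (fun x V h => hΓ x V (.inr (.inr h))) hC
    refine ⟨.ite p' d' e', ?_⟩
    simp only [Within, judgements, List.forall_mem_cons, List.forall_mem_append]
    exact ⟨⟨hC, hT _⟩, ⟨hp, hd⟩, he⟩
  | @app Γ M N U V d e ihd ihe =>
    rw [Term.weight_app] at hn
    simp only [components, List.cons_subset, List.append_subset] at hS
    have hd' := ihd hS.2.2.1 (by omega) hΓ' (fun x V h => hΓ x V (.inl h)) hC
    -- The function type keeps its arrow since the rule has recorded both of its components in `S`.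
    rw [IType.prune_arrow hS.1 hS.2.1] at hd'
    obtain ⟨d', hd⟩ := hd'
    obtain ⟨e', he⟩ := ihe hS.2.2.2 (by omega) hΓ' (fun x V h => hΓ x V (.inr h)) hC
    refine ⟨.app d' e', ?_⟩
    simp only [Within, judgements, List.forall_mem_cons, List.forall_mem_append]
    exact ⟨⟨hC, hT _⟩, hd, he⟩
  | @lam Γ M U V d ihd =>
    rw [Term.weight_lam] at hn
    simp only [components, List.cons_subset] at hS
    have hU : ∀ V, some V ∈ some (U.prune S) :: Γ' → V ∈ T := by
      intro V hV
      rcases List.mem_cons.1 hV with hV | hV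
      · obtain rfl := Option.some.inj hV
        exact hT U
      · exact hΓ' V hV
    -- The weight `2` of the abstraction covers the new entry.
    have hl : (some (U.prune S) :: Γ').length + M.weight arity ≤ n := by
      rw [List.length_cons]; omega
    obtain ⟨d', hd⟩ := ihd hS.2.2 hl hU (fun x V h h' => by
      cases x with
      | zero => simp_all
      | succ x => simpa using hΓ x V h (by simpa using h'))
      (SCtx.mem_ofLength (by omega) hU)
    have hA := IType.prune_arrow hS.1 hS.2.1
    rw [hA]
    refine ⟨.lam d', ?_⟩
    simp only [Within, judgements, List.forall_mem_cons]
    exact ⟨⟨hC, hA ▸ hT _⟩, hd⟩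
  | @pair Γ M N U V d e ihd ihe =>
    rw [Term.weight_pair] at hn
    simp only [components, List.cons_subset, List.append_subset] at hS
    obtain ⟨d', hd⟩ := ihd hS.2.2.1 (by omega) hΓ' (fun x V h => hΓ x V (.inl h)) hC
    obtain ⟨e', he⟩ := ihe hS.2.2.2 (by omega) hΓ' (fun x V h => hΓ x V (.inr h)) hC
    have hA := IType.prune_prod hS.1 hS.2.1
    rw [hA]
    refine ⟨.pair d' e', ?_⟩
    simp only [Within, judgements, List.forall_mem_cons, List.forall_mem_append]
    exact ⟨⟨hC, hA ▸ hT _⟩, hd, he⟩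
  | @letp Γ M N U V W d e ihd ihe =>
    rw [Term.weight_letp] at hn
    simp only [components, List.cons_subset, List.append_subset] at hS
    have hd' := ihd hS.2.2.1 (by omega) hΓ' (fun x V h => hΓ x V (.inl h)) hC
    rw [IType.prune_prod hS.1 hS.2.1] at hd'
    obtain ⟨d', hd⟩ := hd'
    have hU : ∀ W, some W ∈ some (U.prune S) :: some (V.prune S) :: Γ' → W ∈ T := by
      intro W hW
      rcases List.mem_cons.1 hW with hW | hW
      · obtain rfl := Option.some.inj hW
        exact hT U
      rcases List.mem_cons.1 hW with hW | hW
      · obtain rfl := Option.some.inj hW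
        exact hT V
      · exact hΓ' W hW
    have hl : (some (U.prune S) :: some (V.prune S) :: Γ').length + N.weight arity ≤ n := by
      rw [List.length_cons, List.length_cons]; omega
    obtain ⟨e', he⟩ := ihe hS.2.2.2 hl hU (fun x V h h' => by
      rcases x with _ | _ | x
      · simp_all
      · simp_all
      · simpa using hΓ x V (.inr h) (by simpa using h'))
      (SCtx.mem_ofLength (by omega) hU)
    refine ⟨.letp d' e', ?_⟩
    simp only [Within, judgements, List.forall_mem_cons, List.forall_mem_append]
    exact ⟨⟨hC, hT _⟩, hd, he⟩

/-- A simply typable term has a derivation in which contexts and types are bounded. -/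
theorem STypable.exists_within {M : Term G} (h : STypable κ arity M) :
    ∃ (Γ : SCtx κ) (U : IType κ) (π : SDeriv arity Γ M U),
      π.Within (SCtx.ofLength (IType.ofHeight (M.weight arity + 1)) (2 * M.weight arity))
        (IType.ofHeight (M.weight arity + 1)) := by
  obtain ⟨Γ, U, ⟨π⟩⟩ := h
  have hT := fun V => IType.prune_mem π.length_components_le V
  -- The context is cut to the first `M.weight arity` variables, which include all free ones. The
  -- binders add at most as many entries again, hence the factor `2` in the bound.
  refine ⟨(List.range (M.weight arity)).map fun x => (Γ.getD x none).map
    (IType.prune π.components), _, π.exists_prune hT (List.Subset.refl _) ?_ ?_ ?_⟩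
  · rw [List.length_map, List.length_range]; omega
  · intro V hV
    obtain ⟨x, -, hx⟩ := List.mem_map.1 hV
    obtain ⟨W, -, rfl⟩ := Option.map_eq_some_iff.1 hx
    exact hT W
  · intro x V hx hV
    simp [hx.lt_weight, List.getD_eq_getElem?_getD, hV]

end Bound

/-! ### The search for simply-typed derivations -/

section Find

variable {G κ : Type} {arity : G → ℕ}

/-- The term with a given outermost construct and given components. -/
def Term.build (l : TermLabel G) (Ms : List (Term G)) : Term G :=
  Sum.elim (Sum.elim .var (fun g => .const (.gate g)))
    (fun i : Fin 10 => match i with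
      | 0 => .const .zero
      | 1 => .const .one
      | 2 => .const .meas
      | 3 => .const .new
      | 4 => .star
      | 5 => .app (Ms.getD 0 .star) (Ms.getD 1 .star)
      | 6 => .lam (Ms.getD 0 .star)
      | 7 => .ite (Ms.getD 0 .star) (Ms.getD 1 .star) (Ms.getD 2 .star)
      | 8 => .pair (Ms.getD 0 .star) (Ms.getD 1 .star)
      | 9 => .letp (Ms.getD 0 .star) (Ms.getD 1 .star)) l

/-- The `k`-th premise. -/
def simplePremise (rs : List (SJudgement G κ)) (k : ℕ) : SJudgement G κ :=
  rs.getD k ([], .star, .top)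

/-- Whether a judgement with context `j.1` and type `j.2` follows from the premises `rs` by the
simply-typed rule for the construct `n.1`; `n.2` is the arity of the gate if this is a gate. -/
def IsSimpleStep (n : TermLabel G × ℕ) (j : SCtx κ × IType κ) (rs : List (SJudgement G κ)) : Prop :=
  Sum.elim (Sum.elim (fun x => j.1.getD x none = some j.2)
    (fun _ => .arrow (QType.qbit.pow n.2).skel (QType.qbit.pow n.2).skel = j.2))
    (fun i : Fin 10 => match i with
      | 0 => .bit = j.2
      | 1 => .bit = j.2
      | 2 => .arrow .qbit .bit = j.2
      | 3 => .arrow .bit .qbit = j.2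
      | 4 => .top = j.2
      | 5 => (simplePremise rs 0).1 = j.1 ∧ (simplePremise rs 1).1 = j.1 ∧
          (simplePremise rs 0).2.2 = .arrow (simplePremise rs 1).2.2 j.2
      | 6 => ∃ V ∈ ((simplePremise rs 0).1.getD 0 none).toList,
          (simplePremise rs 0).1 = some V :: j.1 ∧ j.2 = .arrow V (simplePremise rs 0).2.2
      | 7 => (simplePremise rs 0).1 = j.1 ∧ (simplePremise rs 1).1 = j.1 ∧
          (simplePremise rs 2).1 = j.1 ∧ (simplePremise rs 0).2.2 = .bit ∧
          (simplePremise rs 1).2.2 = j.2 ∧ (simplePremise rs 2).2.2 = j.2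
      | 8 => (simplePremise rs 0).1 = j.1 ∧ (simplePremise rs 1).1 = j.1 ∧
          j.2 = .prod (simplePremise rs 0).2.2 (simplePremise rs 1).2.2
      | 9 => (simplePremise rs 0).1 = j.1 ∧
          ∃ V ∈ ((simplePremise rs 1).1.getD 0 none).toList,
          ∃ W ∈ ((simplePremise rs 1).1.getD 1 none).toList,
          (simplePremise rs 1).1 = some V :: some W :: j.1 ∧
          (simplePremise rs 0).2.2 = .prod V W ∧ (simplePremise rs 1).2.2 = j.2) n.1

open Classical in
/-- The judgements with a context in `p.1` and a type in `p.2` that follow from the premises `rs` by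
the simply-typed rule for the construct `n.1`. -/
noncomputable def simpleConclusions (p : List (SCtx κ) × List (IType κ)) (n : TermLabel G × ℕ)
    (rs : List (SJudgement G κ)) : List (SJudgement G κ) :=
  ((p.1.flatMap fun Γ => p.2.map fun U => (Γ, U)).filter fun j => IsSimpleStep n j rs).map
    fun j => (j.1, Term.build n.1 (rs.map fun r => r.2.1), j.2)

variable {C : List (SCtx κ)} {T : List (IType κ)}

theorem mem_simpleConclusions {n : TermLabel G × ℕ} {Γ : SCtx κ} {M : Term G} {U : IType κ}
    {rs : List (SJudgement G κ)} :
    (Γ, M, U) ∈ simpleConclusions (C, T) n rs ↔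
      M = Term.build n.1 (rs.map fun r => r.2.1) ∧ (Γ ∈ C ∧ U ∈ T) ∧
        IsSimpleStep n (Γ, U) rs := by
  simp only [simpleConclusions, List.mem_map, List.mem_filter, List.mem_flatMap,
    decide_eq_true_eq, Prod.mk.injEq]
  constructor
  · rintro ⟨_, ⟨⟨Γ, hΓ, U, hU, rfl⟩, h⟩, rfl, rfl, rfl⟩
    exact ⟨rfl, ⟨hΓ, hU⟩, h⟩
  · rintro ⟨rfl, ⟨hΓ, hU⟩, h⟩
    exact ⟨(Γ, U), ⟨⟨Γ, hΓ, U, hU, rfl⟩, h⟩, rfl, rfl, rfl⟩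

/-- The judgement `j` and the judgements `l` above it make up a simply-typed derivation for `M`
with contexts in `C` and types in `T`. -/
def Term.Derived (arity : G → ℕ) (C : List (SCtx κ)) (T : List (IType κ)) (M : Term G)
    (j : SJudgement G κ) (l : List (SJudgement G κ)) : Prop :=
  ∃ (Γ : SCtx κ) (U : IType κ) (π : SDeriv arity Γ M U),
    j = (Γ, M, U) ∧ π.Within C T ∧ π.judgements = j :: l

theorem SDeriv.judgements_eq {Γ : SCtx κ} {M : Term G} {U : IType κ} (π : SDeriv arity Γ M U) :
    π.judgements = (Γ, M, U) :: π.judgements.tail := by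
  cases π <;> rfl

theorem SDeriv.Within.root {Γ : SCtx κ} {M : Term G} {U : IType κ} {π : SDeriv arity Γ M U}
    (h : π.Within C T) : Γ ∈ C ∧ U ∈ T :=
  h _ (by rw [π.judgements_eq]; exact List.mem_cons_self)

theorem isSimpleStep_const {c : Const G} {Γ : SCtx κ} {U : IType κ} :
    IsSimpleStep (annotateLabel arity (Term.const c).label) (Γ, U) [] ↔
      (c.type κ arity).skel = U := by
  cases c <;> exact Iff.rfl

/-- The same bottom-up evaluation as for decorations, with candidates for contexts and types drawn
from `C` and `T`. The word holds only labels, so the subject of each judgement is rebuilt from those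
of its premises by `Term.build`. -/
theorem Term.evalsTo_find (M : Term G) :
    ∃ S, EvalsTo (fun n : TermLabel G × ℕ => termArity n.1) (derivStep (simpleConclusions (C, T)))
        (M.word.map (annotateLabel arity)) S ∧ ∀ j l, (j, l) ∈ S ↔ M.Derived arity C T j l := by
  induction M with
  | var x =>
    refine ⟨_, EvalsTo.node₀ rfl, fun ⟨Γ, N, U⟩ l => ?_⟩
    rw [mem_derivStep₀, mem_simpleConclusions]
    constructor
    · rintro ⟨⟨rfl, hw, h⟩, rfl⟩
      refine ⟨Γ, U, .ax₁ (mem_toList_getD.1 (Option.mem_toList.2 h)), rfl, ?_, rfl⟩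
      simpa [SDeriv.Within, SDeriv.judgements] using hw
    · rintro ⟨Γ, U, π, hj, hw, hl⟩
      obtain ⟨rfl, rfl, rfl⟩ : _ = _ ∧ _ = _ ∧ _ = _ := by simpa using hj
      cases π with
      | ax₁ hx =>
        exact ⟨⟨rfl, hw.root, Option.mem_toList.1 (mem_toList_getD.2 hx)⟩,
          by simpa [SDeriv.judgements] using hl.symm⟩
  | const c =>
    have hc : (Term.const c).word = [(Term.const c).label] := by cases c <;> rfl
    have hb : Term.build (Term.const c).label [] = .const c := by cases c <;> rfl
    rw [hc]
    refine ⟨_, EvalsTo.node₀ (by cases c <;> rfl), fun ⟨Γ, N, U⟩ l => ?_⟩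
    rw [mem_derivStep₀, mem_simpleConclusions, isSimpleStep_const]
    constructor
    · rintro ⟨⟨hN, hw, h⟩, rfl⟩
      obtain rfl : N = .const c := hN.trans hb
      refine ⟨Γ, U, .ax₂ h, rfl, ?_, rfl⟩
      simpa [SDeriv.Within, SDeriv.judgements] using hw
    · rintro ⟨Γ, U, π, hj, hw, hl⟩
      obtain ⟨rfl, rfl, rfl⟩ : _ = _ ∧ _ = _ ∧ _ = _ := by simpa using hj
      cases π with
      | ax₂ h =>
        exact ⟨⟨hb.symm, hw.root, h⟩, by simpa [SDeriv.judgements] using hl.symm⟩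
  | star =>
    refine ⟨_, EvalsTo.node₀ rfl, fun ⟨Γ, N, U⟩ l => ?_⟩
    rw [mem_derivStep₀, mem_simpleConclusions]
    constructor
    · rintro ⟨⟨rfl, hw, h⟩, rfl⟩
      obtain rfl : .top = U := h
      refine ⟨Γ, _, .star, rfl, ?_, rfl⟩
      simpa [SDeriv.Within, SDeriv.judgements] using hw
    · rintro ⟨Γ, U, π, hj, hw, hl⟩
      obtain ⟨rfl, rfl, rfl⟩ : _ = _ ∧ _ = _ ∧ _ = _ := by simpa using hj
      cases π with
      | star => exact ⟨⟨rfl, hw.root, rfl⟩, by simpa [SDeriv.judgements] using hl.symm⟩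
  | app M N ihM ihN =>
    obtain ⟨S, hS, hS'⟩ := ihM
    obtain ⟨S₂, hS₂, hS₂'⟩ := ihN
    refine ⟨_, by
      rw [Term.word_app, List.map_cons, List.map_append]
      exact EvalsTo.node₂ rfl hS hS₂, fun ⟨Γ, K, U⟩ l => ?_⟩
    simp only [mem_derivStep₂, mem_simpleConclusions, hS', hS₂']
    constructor
    · rintro ⟨_, k₁, _, k₂, ⟨Γ₁, U₁, π₁, rfl, hw₁, hl₁⟩, ⟨Γ₂, U₂, π₂, rfl, hw₂, hl₂⟩,
        ⟨rfl, hw, h₁, h₂, h₃⟩, rfl⟩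
      obtain rfl : Γ₁ = Γ := h₁
      obtain rfl : Γ₂ = Γ₁ := h₂
      obtain rfl : U₁ = .arrow U₂ U := h₃
      refine ⟨_, _, .app π₁ π₂, rfl, ?_, by rw [← hl₁, ← hl₂]; rfl⟩
      simp only [SDeriv.Within, SDeriv.judgements, List.forall_mem_cons, List.forall_mem_append]
      exact ⟨hw, hw₁, hw₂⟩
    · rintro ⟨Γ, U, π, hj, hw, hl⟩
      obtain ⟨rfl, rfl, rfl⟩ : _ = _ ∧ _ = _ ∧ _ = _ := by simpa using hj
      cases π with
      | app π₁ π₂ =>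
        have hw' := hw
        simp only [SDeriv.Within, SDeriv.judgements, List.forall_mem_cons,
          List.forall_mem_append] at hw'
        exact ⟨_, _, _, _, ⟨_, _, π₁, rfl, hw'.2.1, π₁.judgements_eq⟩,
          ⟨_, _, π₂, rfl, hw'.2.2, π₂.judgements_eq⟩, ⟨rfl, hw.root, rfl, rfl, rfl⟩, by
          rw [← π₁.judgements_eq, ← π₂.judgements_eq]
          simpa [SDeriv.judgements] using hl⟩
  | lam M ihM =>
    obtain ⟨S, hS, hS'⟩ := ihM
    refine ⟨_, by
      rw [Term.word_lam, List.map_cons]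
      exact EvalsTo.node₁ rfl hS, fun ⟨Γ, K, U⟩ l => ?_⟩
    simp only [mem_derivStep₁, mem_simpleConclusions, hS']
    constructor
    · rintro ⟨_, k₁, ⟨Γ₁, U₁, π₁, rfl, hw₁, hl₁⟩, ⟨rfl, hw, V, -, h₁, h₂⟩, rfl⟩
      obtain rfl : Γ₁ = some V :: Γ := h₁
      obtain rfl : U = .arrow V U₁ := h₂
      refine ⟨_, _, .lam π₁, rfl, ?_, by rw [← hl₁]; rfl⟩
      simp only [SDeriv.Within, SDeriv.judgements, List.forall_mem_cons]
      exact ⟨hw, hw₁⟩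
    · rintro ⟨Γ, U, π, hj, hw, hl⟩
      obtain ⟨rfl, rfl, rfl⟩ : _ = _ ∧ _ = _ ∧ _ = _ := by simpa using hj
      cases π with
      | lam π₁ =>
        have hw' := hw
        simp only [SDeriv.Within, SDeriv.judgements, List.forall_mem_cons] at hw'
        exact ⟨_, _, ⟨_, _, π₁, rfl, hw'.2, π₁.judgements_eq⟩,
          ⟨rfl, hw.root, _, mem_toList_getD.2 rfl, rfl, rfl⟩, by
          rw [← π₁.judgements_eq]
          simpa [SDeriv.judgements] using hl⟩
  | ite P M N ihP ihM ihN =>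
    obtain ⟨S, hS, hS'⟩ := ihM
    obtain ⟨S₂, hS₂, hS₂'⟩ := ihN
    obtain ⟨S₀, hS₀, hS₀'⟩ := ihP
    refine ⟨_, by
      rw [Term.word_ite, List.map_cons, List.map_append, List.map_append]
      exact EvalsTo.node₃ rfl hS₀ hS hS₂, fun ⟨Γ, K, U⟩ l => ?_⟩
    simp only [mem_derivStep₃, mem_simpleConclusions, hS₀', hS', hS₂']
    constructor
    · rintro ⟨_, k₀, _, k₁, _, k₂, ⟨Γ₀, U₀, π₀, rfl, hw₀, hl₀⟩, ⟨Γ₁, U₁, π₁, rfl, hw₁, hl₁⟩,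
        ⟨Γ₂, U₂, π₂, rfl, hw₂, hl₂⟩, ⟨rfl, hw, h₀, h₁, h₂, h₃, h₄, h₅⟩, rfl⟩
      obtain rfl : Γ₀ = Γ := h₀
      obtain rfl : Γ₁ = Γ₀ := h₁
      obtain rfl : Γ₂ = Γ₁ := h₂
      obtain rfl : U₀ = .bit := h₃
      obtain rfl : U₁ = U := h₄
      obtain rfl : U₂ = U₁ := h₅
      refine ⟨_, _, .ite π₀ π₁ π₂, rfl, ?_, by rw [← hl₀, ← hl₁, ← hl₂]; rfl⟩
      simp only [SDeriv.Within, SDeriv.judgements, List.forall_mem_cons, List.forall_mem_append]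
      exact ⟨hw, ⟨hw₀, hw₁⟩, hw₂⟩
    · rintro ⟨Γ, U, π, hj, hw, hl⟩
      obtain ⟨rfl, rfl, rfl⟩ : _ = _ ∧ _ = _ ∧ _ = _ := by simpa using hj
      cases π with
      | ite π₀ π₁ π₂ =>
        have hw' := hw
        simp only [SDeriv.Within, SDeriv.judgements, List.forall_mem_cons,
          List.forall_mem_append] at hw'
        exact ⟨_, _, _, _, _, _, ⟨_, _, π₀, rfl, hw'.2.1.1, π₀.judgements_eq⟩,
          ⟨_, _, π₁, rfl, hw'.2.1.2, π₁.judgements_eq⟩,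
          ⟨_, _, π₂, rfl, hw'.2.2, π₂.judgements_eq⟩,
          ⟨rfl, hw.root, rfl, rfl, rfl, rfl, rfl, rfl⟩, by
          rw [← π₀.judgements_eq, ← π₁.judgements_eq, ← π₂.judgements_eq]
          simpa [SDeriv.judgements] using hl⟩
  | pair M N ihM ihN =>
    obtain ⟨S, hS, hS'⟩ := ihM
    obtain ⟨S₂, hS₂, hS₂'⟩ := ihN
    refine ⟨_, by
      rw [Term.word_pair, List.map_cons, List.map_append]
      exact EvalsTo.node₂ rfl hS hS₂, fun ⟨Γ, K, U⟩ l => ?_⟩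
    simp only [mem_derivStep₂, mem_simpleConclusions, hS', hS₂']
    constructor
    · rintro ⟨_, k₁, _, k₂, ⟨Γ₁, U₁, π₁, rfl, hw₁, hl₁⟩, ⟨Γ₂, U₂, π₂, rfl, hw₂, hl₂⟩,
        ⟨rfl, hw, h₁, h₂, h₃⟩, rfl⟩
      obtain rfl : Γ₁ = Γ := h₁
      obtain rfl : Γ₂ = Γ₁ := h₂
      obtain rfl : U = .prod U₁ U₂ := h₃
      refine ⟨_, _, .pair π₁ π₂, rfl, ?_, by rw [← hl₁, ← hl₂]; rfl⟩
      simp only [SDeriv.Within, SDeriv.judgements, List.forall_mem_cons, List.forall_mem_append]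
      exact ⟨hw, hw₁, hw₂⟩
    · rintro ⟨Γ, U, π, hj, hw, hl⟩
      obtain ⟨rfl, rfl, rfl⟩ : _ = _ ∧ _ = _ ∧ _ = _ := by simpa using hj
      cases π with
      | pair π₁ π₂ =>
        have hw' := hw
        simp only [SDeriv.Within, SDeriv.judgements, List.forall_mem_cons,
          List.forall_mem_append] at hw'
        exact ⟨_, _, _, _, ⟨_, _, π₁, rfl, hw'.2.1, π₁.judgements_eq⟩,
          ⟨_, _, π₂, rfl, hw'.2.2, π₂.judgements_eq⟩, ⟨rfl, hw.root, rfl, rfl, rfl⟩, by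
          rw [← π₁.judgements_eq, ← π₂.judgements_eq]
          simpa [SDeriv.judgements] using hl⟩
  | letp M N ihM ihN =>
    obtain ⟨S, hS, hS'⟩ := ihM
    obtain ⟨S₂, hS₂, hS₂'⟩ := ihN
    refine ⟨_, by
      rw [Term.word_letp, List.map_cons, List.map_append]
      exact EvalsTo.node₂ rfl hS hS₂, fun ⟨Γ, K, U⟩ l => ?_⟩
    simp only [mem_derivStep₂, mem_simpleConclusions, hS', hS₂']
    constructor
    · rintro ⟨_, k₁, _, k₂, ⟨Γ₁, U₁, π₁, rfl, hw₁, hl₁⟩, ⟨Γ₂, U₂, π₂, rfl, hw₂, hl₂⟩,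
        ⟨rfl, hw, h₁, V, -, W, -, h₂, h₃, h₄⟩, rfl⟩
      obtain rfl : Γ₁ = Γ := h₁
      obtain rfl : Γ₂ = some V :: some W :: Γ₁ := h₂
      obtain rfl : U₁ = .prod V W := h₃
      obtain rfl : U₂ = U := h₄
      refine ⟨_, _, .letp π₁ π₂, rfl, ?_, by rw [← hl₁, ← hl₂]; rfl⟩
      simp only [SDeriv.Within, SDeriv.judgements, List.forall_mem_cons, List.forall_mem_append]
      exact ⟨hw, hw₁, hw₂⟩
    · rintro ⟨Γ, U, π, hj, hw, hl⟩
      obtain ⟨rfl, rfl, rfl⟩ : _ = _ ∧ _ = _ ∧ _ = _ := by simpa using hj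
      cases π with
      | letp π₁ π₂ =>
        have hw' := hw
        simp only [SDeriv.Within, SDeriv.judgements, List.forall_mem_cons,
          List.forall_mem_append] at hw'
        exact ⟨_, _, _, _, ⟨_, _, π₁, rfl, hw'.2.1, π₁.judgements_eq⟩,
          ⟨_, _, π₂, rfl, hw'.2.2, π₂.judgements_eq⟩,
          ⟨rfl, hw.root, rfl, _, mem_toList_getD.2 rfl, _, mem_toList_getD.2 rfl, rfl, rfl,
            rfl⟩, by
          rw [← π₁.judgements_eq, ← π₂.judgements_eq]
          simpa [SDeriv.judgements] using hl⟩

/-- The simply-typed derivation found for a term that is given by its word, annotated by the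
arities of gates. -/
noncomputable def findAnnotated (w : List (TermLabel G × ℕ)) : Option (List (SJudgement G κ)) :=
  (((evalWord (fun n : TermLabel G × ℕ => termArity n.1)
    (derivStep (simpleConclusions (SCtx.ofLength (IType.ofHeight ((w.map nodeWeight).sum + 1))
      (2 * (w.map nodeWeight).sum), IType.ofHeight ((w.map nodeWeight).sum + 1)))) w).getD 0
        []).head?).map fun c => c.1 :: c.2

/-- The simply-typed derivation found for a term. -/
noncomputable def Term.findJudgements (κ : Type) (arity : G → ℕ) (M : Term G) :
    Option (List (SJudgement G κ)) :=
  findAnnotated (M.word.map (annotateLabel arity))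

theorem Term.findJudgements_eq (M : Term G) :
    ∃ S : List (SJudgement G κ × List (SJudgement G κ)), (∀ j l, (j, l) ∈ S ↔ M.Derived arity
        (SCtx.ofLength (IType.ofHeight (M.weight arity + 1)) (2 * M.weight arity))
        (IType.ofHeight (M.weight arity + 1)) j l) ∧
      M.findJudgements κ arity = S.head?.map fun c => c.1 :: c.2 := by
  obtain ⟨S, hS, hS'⟩ := M.evalsTo_find (arity := arity)
    (C := SCtx.ofLength (IType.ofHeight (M.weight arity + 1)) (2 * M.weight arity))
    (T := (IType.ofHeight (M.weight arity + 1) : List (IType κ)))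
  refine ⟨S, hS', ?_⟩
  have h := hS.evalWord
  -- `findAnnotated` sees only the annotated word, and recomputes from it the weight that bounds the
  -- search.
  rw [Term.weight] at h
  rw [findJudgements, findAnnotated, h]
  rfl

theorem Term.of_find_eq_some {M : Term G} {l : List (SJudgement G κ)}
    (h : M.findJudgements κ arity = some l) :
    ∃ (Γ : SCtx κ) (U : IType κ) (π : SDeriv arity Γ M U), π.judgements = l := by
  obtain ⟨S, hS, h'⟩ := M.findJudgements_eq (arity := arity) (κ := κ)
  rw [h', Option.map_eq_some_iff] at h
  obtain ⟨⟨j, k⟩, hj, rfl⟩ := h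
  obtain ⟨Γ, U, π, -, -, hl⟩ := (hS _ _).1 (List.mem_of_mem_head? hj)
  exact ⟨Γ, U, π, hl⟩

/-- The search is exhaustive within its bounds, and by `STypable.exists_within` every simply typable
term has a derivation within them. -/
theorem Term.not_sTypable_of_find_eq_none {M : Term G} (h : M.findJudgements κ arity = none) :
    ¬ STypable κ arity M := by
  intro hM
  obtain ⟨Γ, U, π, hπ⟩ := hM.exists_within
  obtain ⟨S, hS, h'⟩ := M.findJudgements_eq (arity := arity) (κ := κ)
  rw [h', Option.map_eq_none_iff, List.head?_eq_none_iff] at h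
  have := (hS _ _).2 ⟨Γ, U, π, rfl, hπ, π.judgements_eq⟩
  rw [h] at this
  cases this

/-! ### Computability of the first step -/

section Computability

variable [Primcodable G] [Primcodable κ]

theorem Term.build_primrec : Primrec₂ (Term.build (G := G)) := by
  have hg : ∀ k, Primrec fun p : TermLabel G × List (Term G) => p.2.getD k .star :=
    fun k => primrec_getD k _ Primrec.snd
  refine primrec_sumElim_fin Primrec.fst ?_ fun i => ?_
  · exact primrec_sumElim Primrec.snd (Term.var_primrec.comp Primrec.snd)
      (Term.gate_primrec.comp Primrec.snd)
  · fin_cases i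
    · exact Primrec.const _
    · exact Primrec.const _
    · exact Primrec.const _
    · exact Primrec.const _
    · exact Primrec.const _
    · exact Term.app_primrec (hg 0) (hg 1)
    · exact Term.lam_primrec (hg 0)
    · exact Term.ite_primrec (hg 0) (hg 1) (hg 2)
    · exact Term.pair_primrec (hg 0) (hg 1)
    · exact Term.letp_primrec (hg 0) (hg 1)

theorem isSimpleStep_primrec : PrimrecPred fun p : (TermLabel G × ℕ) × (SCtx κ × IType κ) ×
    List (SJudgement G κ) => IsSimpleStep p.1 p.2.1 p.2.2 := by
  have hj : Primrec fun p : (TermLabel G × ℕ) × (SCtx κ × IType κ) × List (SJudgement G κ) =>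
      p.2.1 := Primrec.fst.comp Primrec.snd
  have hc := Primrec.fst.comp hj
  have hU := Primrec.snd.comp hj
  have hr : ∀ k, Primrec fun p : (TermLabel G × ℕ) × (SCtx κ × IType κ) × List (SJudgement G κ) =>
      simplePremise p.2.2 k := fun k => primrec_getD k _ (Primrec.snd.comp Primrec.snd)
  have rc := fun k => Primrec.fst.comp (hr k)
  have rU := fun k => Primrec.snd.comp (Primrec.snd.comp (hr k))
  refine primrecPred_sumElim_fin (Primrec.fst.comp Primrec.fst) ?_ fun i => ?_
  · refine primrecPred_sumElim Primrec.snd ?_ ?_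
    · exact primrecPred_eq ((Primrec.list_getD none).comp
        (hc.comp (Primrec.fst.comp Primrec.fst)) Primrec.snd)
        (Primrec.option_some.comp (hU.comp (Primrec.fst.comp Primrec.fst)))
    · have hp := (QType.skel_primrec (κ := κ)).comp (QType.pow_primrec.comp
        (Primrec.snd.comp (Primrec.fst.comp (Primrec.fst.comp (Primrec.fst
        (α := ((TermLabel G × ℕ) × (SCtx κ × IType κ) × List (SJudgement G κ)) × (ℕ ⊕ G))
        (β := G))))))
      exact primrecPred_eq (IType.arrow_primrec hp hp) (hU.comp (Primrec.fst.comp Primrec.fst))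
  · fin_cases i
    · exact primrecPred_eq (Primrec.const _) hU
    · exact primrecPred_eq (Primrec.const _) hU
    · exact primrecPred_eq (Primrec.const _) hU
    · exact primrecPred_eq (Primrec.const _) hU
    · exact primrecPred_eq (Primrec.const _) hU
    · exact (primrecPred_eq (rc 0) hc).and ((primrecPred_eq (rc 1) hc).and
        (primrecPred_eq (rU 0) (IType.arrow_primrec (rU 1) hU)))
    · refine primrecPred_exists_mem (p := fun (p : (TermLabel G × ℕ) × (SCtx κ × IType κ) ×
        List (SJudgement G κ)) V => (simplePremise p.2.2 0).1 = some V :: p.2.1.1 ∧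
          p.2.1.2 = .arrow V (simplePremise p.2.2 0).2.2)
        (primrec_optionToList_getD (rc 0) (Primrec.const 0)) ?_
      exact (primrecPred_eq ((rc 0).comp Primrec.fst) (Primrec.list_cons.comp
        (Primrec.option_some.comp Primrec.snd) (hc.comp Primrec.fst))).and
        (primrecPred_eq (hU.comp Primrec.fst)
          (IType.arrow_primrec Primrec.snd ((rU 0).comp Primrec.fst)))
    · exact (primrecPred_eq (rc 0) hc).and ((primrecPred_eq (rc 1) hc).and
        ((primrecPred_eq (rc 2) hc).and ((primrecPred_eq (rU 0) (Primrec.const _)).and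
          ((primrecPred_eq (rU 1) hU).and (primrecPred_eq (rU 2) hU)))))
    · exact (primrecPred_eq (rc 0) hc).and ((primrecPred_eq (rc 1) hc).and
        (primrecPred_eq hU (IType.prod_primrec (rU 0) (rU 1))))
    · refine (primrecPred_eq (rc 0) hc).and ?_
      refine primrecPred_exists_mem (p := fun (p : (TermLabel G × ℕ) × (SCtx κ × IType κ) ×
        List (SJudgement G κ)) V => ∃ W ∈ ((simplePremise p.2.2 1).1.getD 1 none).toList,
          (simplePremise p.2.2 1).1 = some V :: some W :: p.2.1.1 ∧
          (simplePremise p.2.2 0).2.2 = .prod V W ∧ (simplePremise p.2.2 1).2.2 = p.2.1.2)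
        (primrec_optionToList_getD (rc 1) (Primrec.const 0)) ?_
      refine primrecPred_exists_mem (p := fun (x : ((TermLabel G × ℕ) × (SCtx κ × IType κ) ×
        List (SJudgement G κ)) × IType κ) W =>
          (simplePremise x.1.2.2 1).1 = some x.2 :: some W :: x.1.2.1.1 ∧
          (simplePremise x.1.2.2 0).2.2 = .prod x.2 W ∧ (simplePremise x.1.2.2 1).2.2 = x.1.2.1.2)
        (primrec_optionToList_getD ((rc 1).comp Primrec.fst) (Primrec.const 1)) ?_
      have h2 := Primrec.fst.comp (Primrec.fst (α := ((TermLabel G × ℕ) × (SCtx κ × IType κ) ×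
        List (SJudgement G κ)) × IType κ) (β := IType κ))
      exact (primrecPred_eq ((rc 1).comp h2) (Primrec.list_cons.comp
        (Primrec.option_some.comp (Primrec.snd.comp Primrec.fst))
        (Primrec.list_cons.comp (Primrec.option_some.comp Primrec.snd) (hc.comp h2)))).and
        ((primrecPred_eq ((rU 0).comp h2)
          (IType.prod_primrec (Primrec.snd.comp Primrec.fst) Primrec.snd)).and
        (primrecPred_eq ((rU 1).comp h2) (hU.comp h2)))

theorem simpleConclusions_primrec : Primrec fun p : (List (SCtx κ) × List (IType κ)) ×
    (TermLabel G × ℕ) × List (SJudgement G κ) => simpleConclusions p.1 p.2.1 p.2.2 := by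
  classical
  refine Primrec.list_map (primrec_filter (p := fun (p : (List (SCtx κ) × List (IType κ)) ×
    (TermLabel G × ℕ) × List (SJudgement G κ)) j => IsSimpleStep p.2.1 j p.2.2) ?_ ?_) ?_
  · refine Primrec.list_flatMap (Primrec.fst.comp Primrec.fst) ?_
    exact Primrec.list_map (Primrec.snd.comp (Primrec.fst.comp Primrec.fst))
      (Primrec.pair (Primrec.snd.comp Primrec.fst) Primrec.snd).to₂
  · exact isSimpleStep_primrec.comp (Primrec.pair (Primrec.fst.comp (Primrec.snd.comp Primrec.fst))
      (Primrec.pair Primrec.snd (Primrec.snd.comp (Primrec.snd.comp Primrec.fst))))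
  · refine Primrec.pair (Primrec.fst.comp Primrec.snd) (Primrec.pair ?_
      (Primrec.snd.comp Primrec.snd))
    refine Term.build_primrec.comp (Primrec.fst.comp (Primrec.fst.comp
      (Primrec.snd.comp Primrec.fst))) ?_
    exact Primrec.list_map (Primrec.snd.comp (Primrec.snd.comp Primrec.fst))
      (Primrec.fst.comp (Primrec.snd.comp Primrec.snd)).to₂

theorem IType.ofHeight_primrec : Primrec (IType.ofHeight (κ := κ)) := by
  have h : Primrec fun n : ℕ => (Nat.rec [] (fun _ L => [.bit, .qbit, .top, .var 0] ++
      (L.flatMap fun U => L.map fun V => .arrow U V) ++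
      (L.flatMap fun U => L.map fun V => .prod U V)) n : List (IType κ)) := by
    have hs : Primrec fun p : ℕ × List (IType κ) => ([.bit, .qbit, .top, .var 0] ++
        (p.2.flatMap fun U => p.2.map fun V => .arrow U V) ++
        (p.2.flatMap fun U => p.2.map fun V => .prod U V) : List (IType κ)) :=
      Primrec.list_append.comp (Primrec.list_append.comp (Primrec.const _)
        (primrec_pairwise IType.arrow_primrec Primrec.snd Primrec.snd))
        (primrec_pairwise IType.prod_primrec Primrec.snd Primrec.snd)
    exact Primrec.nat_rec₁ _ hs.to₂
  refine h.of_eq fun n => ?_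
  induction n with
  | zero => rfl
  | succ n ih => simp only [ih, IType.ofHeight]

theorem SCtx.ofLength_primrec : Primrec₂ (SCtx.ofLength (κ := κ)) := by
  have h : Primrec₂ fun (T : List (IType κ)) (n : ℕ) => (Nat.rec [[]] (fun _ L =>
      [] :: (none :: T.map some).flatMap fun o => L.map fun Γ => o :: Γ) n : List (SCtx κ)) := by
    have hs : Primrec fun p : List (IType κ) × ℕ × List (SCtx κ) =>
        ([] :: (none :: p.1.map some).flatMap fun o => p.2.2.map fun Γ => o :: Γ :
          List (SCtx κ)) := by
      refine Primrec.list_cons.comp (Primrec.const _) (Primrec.list_flatMap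
        (Primrec.list_cons.comp (Primrec.const none)
          (Primrec.list_map Primrec.fst (Primrec.option_some.comp Primrec.snd).to₂)) ?_)
      exact Primrec.list_map (Primrec.snd.comp (Primrec.snd.comp Primrec.fst))
        (Primrec.list_cons.comp (Primrec.snd.comp Primrec.fst) Primrec.snd).to₂
    exact Primrec.nat_rec (Primrec.const _) hs.to₂
  refine h.of_eq fun T n => ?_
  induction n with
  | zero => rfl
  | succ n ih => simp only [ih, SCtx.ofLength]

theorem nodeWeight_primrec : Primrec (nodeWeight (G := G)) := by
  refine Primrec.nat_add.comp (Primrec.nat_add.comp ?_ Primrec.snd) (Primrec.const 2)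
  refine primrec_sumElim Primrec.fst ?_ (Primrec.const 0)
  exact primrec_sumElim Primrec.snd Primrec.snd (Primrec.const 0)

theorem findAnnotated_primrec : Primrec (findAnnotated (G := G) (κ := κ)) := by
  have hn : Primrec fun w : List (TermLabel G × ℕ) => (w.map nodeWeight).sum :=
    primrec_list_sum.comp (Primrec.list_map Primrec.id (nodeWeight_primrec.comp Primrec.snd).to₂)
  have hT : Primrec fun w : List (TermLabel G × ℕ) =>
      (IType.ofHeight ((w.map nodeWeight).sum + 1) : List (IType κ)) :=
    IType.ofHeight_primrec.comp (Primrec.succ.comp hn)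
  have hC := SCtx.ofLength_primrec.comp hT (Primrec.nat_mul.comp (Primrec.const 2) hn)
  have he := evalWord_primrec (F := fun w : List (TermLabel G × ℕ) => derivStep (simpleConclusions
      (SCtx.ofLength (IType.ofHeight ((w.map nodeWeight).sum + 1) : List (IType κ))
        (2 * (w.map nodeWeight).sum), IType.ofHeight ((w.map nodeWeight).sum + 1))))
    (termArity_primrec.comp (Primrec.fst (α := TermLabel G) (β := ℕ)))
    (derivStep_primrec (R := fun w : List (TermLabel G × ℕ) => simpleConclusions
      (SCtx.ofLength (IType.ofHeight ((w.map nodeWeight).sum + 1) : List (IType κ))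
        (2 * (w.map nodeWeight).sum), IType.ofHeight ((w.map nodeWeight).sum + 1)))
      (simpleConclusions_primrec.comp
        (Primrec.pair ((Primrec.pair hC hT).comp Primrec.fst) Primrec.snd)))
    Primrec.id
  refine Primrec.option_map (Primrec.list_head?.comp (primrec_getD 0 [] he)) ?_
  exact Primrec.list_cons.comp (Primrec.fst.comp Primrec.snd) (Primrec.snd.comp Primrec.snd)

theorem Term.findJudgements_computable (ha : Computable arity) :
    Computable (Term.findJudgements κ arity) := by
  refine findAnnotated_primrec.to_comp.comp ((computable_list_map ?_).comp
    Term.word_primrec.to_comp)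
  exact Computable.pair Computable.id (labelArity_computable ha)

end Computability

end Find

/-- No backtracking between the two steps is needed: if one simply-typed derivation has no
decoration, none has. Failure of the first step also rules out quantum typability, which implies
simple typability. -/
theorem qTypable_iff_bind_ne_none {G κ : Type} {arity : G → ℕ} {M : Term G} :
    QTypable κ arity M ↔
      ((M.findJudgements κ arity).bind (checkJudgements arity)).isSome = true := by
  cases hf : M.findJudgements κ arity with
  | none =>
    simp only [Option.bind_none, Option.isSome_none, Bool.false_eq_true, iff_false]
    exact fun h => Term.not_sTypable_of_find_eq_none hf h.sTypable
  | some l =>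
    obtain ⟨Γ, U, π, rfl⟩ := Term.of_find_eq_some hf
    rw [Option.bind_some]
    cases hc : checkJudgements arity π.judgements with
    | none => simpa using π.not_qTypable_of_check_eq_none hc
    | some c =>
      obtain ⟨q, -⟩ := π.of_check_eq_some hc
      simpa using q.qTypable

theorem qTypable_computablePred {G κ : Type} [Primcodable G] [Primcodable κ] {arity : G → ℕ}
    (ha : Computable arity) : ComputablePred fun M : Term G => QTypable κ arity M := by
  have h : Computable fun M : Term G =>
      ((M.findJudgements κ arity).bind (checkJudgements arity)).isSome :=
    Primrec.option_isSome.to_comp.comp (Computable.option_bind (Term.findJudgements_computable ha)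
      ((checkJudgements_computable ha).comp Computable.snd).to₂)
  refine ComputablePred.computable_iff.2 ⟨_, h, funext fun M => propext ?_⟩
  exact qTypable_iff_bind_ne_none

end QLambda

theorem mainTheorem6 {G κ : Type} [Primcodable G] [Primcodable κ] (arity : G → ℕ)
    (harity : Computable arity) :
    -- typability is decidable
    ComputablePred (fun M : Term G => QTypable κ arity M) ∧
    -- quantum typable terms are simply typable
    (∀ M : Term G, QTypable κ arity M → STypable κ arity M) ∧
    -- any simply-typed derivation `π` of `M` decides the typability of `M` by its decorations,
    -- for which it suffices to consider the finitely many without repeated exponentials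
    (∀ (Γ : SCtx κ) (M : Term G) (U : IType κ) (π : SDeriv arity Γ M U),
      (QTypable κ arity M ↔
        ∃ (Δ : QCtx κ) (A : QType κ) (q : QDeriv arity .basic Δ M A), q.IsDecoration π) ∧
      (QTypable κ arity M ↔
        ∃ (Δ : QCtx κ) (A : QType κ) (q : QDeriv arity .extended Δ M A),
          q.IsDecoration π ∧ q.NoRepeat) ∧
      {d : Σ (Δ : QCtx κ) (A : QType κ), QDeriv arity .extended Δ M A |
        d.2.2.IsDecoration π ∧ d.2.2.NoRepeat}.Finite) ∧
    -- the two steps of the algorithm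
    (∃ (find : Term G → Option (List (SJudgement G κ)))
        (check : List (SJudgement G κ) → Option (QCtx κ × QType κ × List (QJudgement G κ))),
      Computable find ∧ Computable check ∧
      -- the first step finds a simply-typed derivation of `M`, if any
      (∀ (M : Term G) (l : List (SJudgement G κ)), find M = some l →
        ∃ (Γ : SCtx κ) (U : IType κ) (π : SDeriv arity Γ M U), π.judgements = l) ∧
      (∀ M : Term G, find M = none → ¬ STypable κ arity M) ∧
      -- the second step finds a decoration of a given simply-typed derivation, if any,
      -- and returns a valid typing of `M`
      (∀ (Γ : SCtx κ) (M : Term G) (U : IType κ) (π : SDeriv arity Γ M U),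
        (∀ (Δ : QCtx κ) (A : QType κ) (l : List (QJudgement G κ)),
          check π.judgements = some (Δ, A, l) →
            Nonempty (QDeriv arity .basic Δ M A) ∧
            ∃ q : QDeriv arity .extended Δ M A,
              q.judgements = l ∧ q.IsDecoration π ∧ q.NoRepeat) ∧
        (check π.judgements = none → ¬ QTypable κ arity M))) := by
  refine ⟨qTypable_computablePred harity, fun M h => h.sTypable, fun Γ M U π => ⟨?_, ?_, ?_⟩,
    Term.findJudgements κ arity, checkJudgements arity, Term.findJudgements_computable harity,
    checkJudgements_computable harity, fun M l h => Term.of_find_eq_some h,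
    fun M h => Term.not_sTypable_of_find_eq_none h,
    fun Γ M U π => ⟨fun Δ A l h => ?_, π.not_qTypable_of_check_eq_none⟩⟩
  · exact ⟨fun h => h.exists_isDecoration π, fun ⟨_, _, q, _⟩ => q.qTypable⟩
  · exact ⟨fun h => h.exists_noRepeat π, fun ⟨_, _, q, _⟩ => q.qTypable⟩
  · exact finite_decorations π
  · obtain ⟨q, hl, hq, hn⟩ := π.of_check_eq_some h
    exact ⟨q.basic_of_extended, q, hl, hq, hn⟩
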